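/- All functions are real-valued and smooth unless said otherwise. **Equations.** The 3-DP equation for $(u,v,w,p,r)(x,t)$ is $$u_t+(upr)_x=0,\quad v_t+3vp_xr+v_xpr+u^2p=0,\quad w_t+3wpr_x+w_xpr-u^2r=0,\quad v=p-p_{xx},\ w=r-r_{xx},$$ with Lax pair $\varphi_x=U\varphi$, $\varphi_t=V\varphi$, where $$U=\begin{pmatrix}0&1&0\\1+\lambda u^2&0&v\\ \lambda w&0&0\end{pmatrix},\quad V=\begin{pmatrix}\frac1{3\lambda}+pr_x&-pr&\frac p\lambda\\ p_xr_x-\lambda u^2pr&\frac1{3\lambda}-p_xr&\frac{p_x}\lambda-vpr\\ -\lambda wpr-r_x&r&p_xr-pr_x-\frac2{3\lambda}\end{pmatrix}.$$ The associated 3-DP equation for $(Q_1,Q_2,Q_3,q_1,q_2)(y,\tau)$ is $$Q_{1\tau}=q_{2y}+(Q_2-Q_3)q_2+Q_1q_1-1,\quad Q_{2\tau}=Q_3q_1-q_2+2q_{1y},\quad Q_{3\tau}=q_2-Q_3q_1,\quad S_1=S_2=0,$$ $$S_1=[(\partial_y+Q_3-Q_2)(\partial_y+Q_3)-Q_1]q_1+1,\qquad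 S_2=[(\partial_y-Q_3)(\partial_y+Q_2-Q_3)-Q_1]q_2+Q_3,$$ and the associated Lax pair is $\Phi_y=\hat U\Phi$, $\Phi_\tau=\hat V\Phi$, where $$\hat U=\begin{pmatrix}0&1&0\\Q_1&Q_2&\mu\\0&\mu&Q_3\end{pmatrix},\quad \hat V=\begin{pmatrix}\frac1{3\mu^2}&0&\frac{q_1}\mu\\0&\frac1{3\mu^2}+q_1&\frac{Q_3q_1+q_{1y}}\mu\\ \frac{1-q_{2y}+(Q_3-Q_2)q_2}\mu&\frac{q_2}\mu&q_1-\frac2{3\mu^2}\end{pmatrix}.$$ **(1) Liouville transformation.** Let $(u,v,w,p,r)$ be a solution of the 3-DP equation on $\mathbb R\times J$, $J$ an open interval, with $u\neq0$ and $v\neq0$ everywhere. There are functions $y$ with $dy=u\,dx-upr\,dt$; if moreover $u(\cdot,t)$ is integrable near $-\infty$ for each $t\in J$ and $upr\to0$ as $x\to-\infty$ locally uniformly in $t$, then $y=\int_{-\infty}^xu(\xi,t)\,d\xi$ is one. For every such $y$ the map $(x,t)\mapsto(y,\tau)=(y(x,t),t)$ is injective with open image $D$, and if $Q_i(y,\tau)=P_i(x,t)$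 with $$P_1=u^{-2}(1+b_x-b^2),\ b=\tfrac{vw}{u^2}+2\tfrac{u_x}u-\tfrac{v_x}v,\qquad P_2=u^{-3}(2vw-2u^2v_xv^{-1}+3uu_x),\qquad P_3=vwu^{-3},$$ and $q_1=pu^2/v$, $q_2=rv/u$, then $(Q_1,Q_2,Q_3,q_1,q_2)$ is a smooth solution of the associated 3-DP equation on $D$. Furthermore there are functions $E=\partial_y^{-1}(vwu^{-3})$, i.e. $E_x=vwu^{-2}$, whose time dependence is given by $E_t=pr_x-p_xr-prvwu^{-2}$; and for every such $E$ and every complex $\mu\neq0$, setting $a=\frac v{u^2}e^{-E}$, a $\mathbb C^3$-valued function $\varphi$ solves the Lax pair of the 3-DP equation with $\lambda=\mu^2$ if and only if $\Phi=(\phi_1,\phi_{1y},\phi_2)^T$ solves the associated Lax pair on $D$, where $\varphi_1=a\phi_1$, $\mu\frac{u^2}v\varphi_1+\frac1\mu\varphi_3=\frac{u^2}va\phi_2$, and $\phi_{1y}$ is computed using $\partial_x\varphi_1=\varphi_2$. **(2) Compatibility.** On any open set of the $(y,\tau)$-plane, $\hat U_\tau-\hat V_y+[\hat U,\hat V]=0$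 for all complex $\mu\ne0$ if and only if the associated 3-DP equation holds. **(3) Negative flow.** Let $F(Q_1,Q_2,Q_3)=(u_1,v_1,w_1)=(-Q_2-Q_3,\ Q_2Q_3-Q_1+Q_{3y},\ Q_1Q_3-(Q_2Q_3)_y-Q_{3yy})$ with Fréchet derivative $F'$, and $$\mathcal J_1=\begin{pmatrix}0&0&2\partial_y\\0&2\partial_y&\partial_y^2+u_1\partial_y\\2\partial_y&-\partial_y^2+\partial_yu_1&0\end{pmatrix},\quad \mathcal K_1=\begin{pmatrix}6\partial_y&*&*\\4u_1\partial_y&2\partial_y^3+2u_1\partial_yu_1+\partial_yv_1+v_1\partial_y&*\\2\partial_y^3-2\partial_yu_1\partial_y+2v_1\partial_y&\chi_1&\chi_2\end{pmatrix},$$ $$\chi_1=2w_1\partial_y+\partial_yw_1-(\partial_y^3-\partial_yu_1\partial_y+v_1\partial_y)(\partial_y-u_1),\quad \chi_2=\partial_yu_1w_1+u_1w_1\partial_y+w_1\partial_y^2-\partial_y^2w_1,$$ the omitted entries being determined by skew-symmetry. The first negative flow of the generalized mKdV hierarchy is $Q_\tau=F'^{-1}\mathcal J_1(A,B,C)^T$,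 $F'^{-1}\mathcal K_1(A,B,C)^T=0$, where $h=F'^{-1}g$ means $F'h=g$. Put $$A=\tfrac14(\partial_y-u_1)\sigma_1-\tfrac12\sigma_2-Q_3q_{1y}-Q_3^2q_1,\quad B=\tfrac12\sigma_1-Q_3q_1,\quad C=-q_1,\qquad \sigma_i=\partial_y^{-1}S_i .$$ For arbitrary smooth $Q_i,q_i$ and any antiderivatives $\sigma_i$ of $S_i$ on an open set, $F'^{-1}\mathcal J_1(A,B,C)^T$ is the vector of right-hand sides of the evolution equations of the associated 3-DP equation and $F'^{-1}\mathcal K_1(A,B,C)^T=(G_1,G_2,G_3)^T$ with $$G_1=Q_1S_1+\tfrac12Q_{1y}\sigma_1+S_{2y}-Q_2S_2,\quad G_2=\tfrac12(S_{1y}+(Q_2\sigma_1)_y)+2S_2,\quad G_3=\tfrac12(Q_3\sigma_1)_y+S_2 .$$ Consequently the associated 3-DP equation is the reduction $S_1=S_2=0$ of the first negative flow: for every solution of it, $G_1=G_2=G_3=0$ and $(Q_1,Q_2,Q_3)$ solves the first negative flow with these $A,B,C$ and $\sigma_1=\sigma_2=0$. **(4) Hamiltonian pair.** As differential operators, $(\partial_y-Q_3)(\partial_y^2-Q_2\partial_y-Q_1)=\partial_y(\partial_y^2+u_1\partial_y+v_1)+w_1$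 with $(u_1,v_1,w_1)=F(Q_1,Q_2,Q_3)$; and $$\mathcal J_2=F'^{-1}\mathcal J_1(F'^{-1})^\dagger,\qquad \mathcal K_2=F'^{-1}\mathcal K_1(F'^{-1})^\dagger$$ is a Hamiltonian pair: $\mathcal J_2$, $\mathcal K_2$ and all real linear combinations $\alpha\mathcal J_2+\beta\mathcal K_2$ are Hamiltonian operators. Here these (possibly nonlocal) operators are given by their graphs on differential polynomials in $Q_1,Q_2,Q_3$ with real coefficients, $\mathcal J_2\theta=h$ meaning $\theta=F'^\dagger\zeta$ and $F'h=\mathcal J_1\zeta$ for some $\zeta$ (similarly $\mathcal K_2$), and an operator $P$ is Hamiltonian if it is linear, single-valued, has a domain with zero annihilator, is skew-adjoint, and satisfies the Jacobi identity $\langle L_{h_1}\theta_2,h_3\rangle+\text{cyclic}=0$ for $h_i=P\theta_i$, where $\langle L_h\theta,k\rangle=\langle D_h\theta,k\rangle+\langle\theta,D_kh\rangle$, $D_h$ is the evolutionary derivation with characteristic $h$, and $\langle\theta,h\rangle=\int\sum_i\theta_ih_i\,dy$ is taken modulo total derivatives. -/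

import Mathlib

open scoped ContDiff

noncomputable section

namespace ThreeDP

/-! ## Functions of two real variables -/

/-- Partial derivative in the first (space) variable. -/
def pd1 {E : Type*} [NormedAddCommGroup E] [NormedSpace ℝ E] (f : ℝ × ℝ → E) : ℝ × ℝ → E :=
  fun z => deriv (fun s => f (s, z.2)) z.1

/-- Partial derivative in the second (time) variable. -/
def pd2 {E : Type*} [NormedAddCommGroup E] [NormedSpace ℝ E] (f : ℝ × ℝ → E) : ℝ × ℝ → E :=
  fun z => deriv (fun s => f (z.1, s)) z.2

/-- `(u, v, w, p, r)` is a smooth solution of the 3-DP equation on the set `Ω` of points `(x, t)`. -/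
structure IsThreeDP (Ω : Set (ℝ × ℝ)) (u v w p r : ℝ × ℝ → ℝ) : Prop where
  smooth_u : ContDiffOn ℝ ∞ u Ω
  smooth_v : ContDiffOn ℝ ∞ v Ω
  smooth_w : ContDiffOn ℝ ∞ w Ω
  smooth_p : ContDiffOn ℝ ∞ p Ω
  smooth_r : ContDiffOn ℝ ∞ r Ω
  eq_u : ∀ z ∈ Ω, pd2 u z + pd1 (u * p * r) z = 0
  eq_v : ∀ z ∈ Ω,
    pd2 v z + 3 * v z * pd1 p z * r z + pd1 v z * p z * r z + u z ^ 2 * p z = 0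
  eq_w : ∀ z ∈ Ω,
    pd2 w z + 3 * w z * p z * pd1 r z + pd1 w z * p z * r z - u z ^ 2 * r z = 0
  eq_p : ∀ z ∈ Ω, v z = p z - pd1 (pd1 p) z
  eq_r : ∀ z ∈ Ω, w z = r z - pd1 (pd1 r) z

/-! ## Lax pairs -/

/-- `φ` solves the linear system `∂₁ φ = U φ`, `∂₂ φ = V φ` on `Ω`. -/
def IsLaxSolution (Ω : Set (ℝ × ℝ)) (U V : ℝ × ℝ → Matrix (Fin 3) (Fin 3) ℂ)
    (φ : ℝ × ℝ → Fin 3 → ℂ) : Prop :=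
  DifferentiableOn ℝ φ Ω ∧ ∀ z ∈ Ω,
    pd1 φ z = (U z).mulVec (φ z) ∧ pd2 φ z = (V z).mulVec (φ z)

/-- Compatibility condition `∂₂ U - ∂₁ V + [U, V] = 0` on `Ω` (with entrywise derivatives). -/
def ZeroCurvature (Ω : Set (ℝ × ℝ)) (U V : ℝ × ℝ → Matrix (Fin 3) (Fin 3) ℂ) : Prop :=
  ∀ z ∈ Ω, (Matrix.of fun i j => pd2 (fun z' => U z' i j) z)
    - (Matrix.of fun i j => pd1 (fun z' => V z' i j) z) + (U z * V z - V z * U z) = 0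

/-- Spatial part of the Lax pair of the 3-DP equation. -/
def laxU (u v w : ℝ × ℝ → ℝ) (lam : ℂ) (z : ℝ × ℝ) : Matrix (Fin 3) (Fin 3) ℂ :=
  let u : ℂ := ((u z : ℝ) : ℂ)
  let v : ℂ := ((v z : ℝ) : ℂ)
  let w : ℂ := ((w z : ℝ) : ℂ)
  !![0, 1, 0;
     1 + lam * u ^ 2, 0, v;
     lam * w, 0, 0]

/-- Temporal part of the Lax pair of the 3-DP equation. -/
def laxV (u v w p r : ℝ × ℝ → ℝ) (lam : ℂ) (z : ℝ × ℝ) : Matrix (Fin 3) (Fin 3) ℂ :=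
  let px : ℂ := ((pd1 p z : ℝ) : ℂ)
  let rx : ℂ := ((pd1 r z : ℝ) : ℂ)
  let u : ℂ := ((u z : ℝ) : ℂ)
  let v : ℂ := ((v z : ℝ) : ℂ)
  let w : ℂ := ((w z : ℝ) : ℂ)
  let p : ℂ := ((p z : ℝ) : ℂ)
  let r : ℂ := ((r z : ℝ) : ℂ)
  !![1 / (3 * lam) + p * rx, -(p * r), p / lam;
     px * rx - lam * u ^ 2 * p * r, 1 / (3 * lam) - px * r, px / lam - v * p * r;
     -(lam * w * p * r) - rx, r, px * r - p * rx - 2 / (3 * lam)]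

/-- Spatial part of the associated Lax pair. -/
def assocU (Q₁ Q₂ Q₃ : ℝ × ℝ → ℝ) (μ : ℂ) (z : ℝ × ℝ) : Matrix (Fin 3) (Fin 3) ℂ :=
  !![0, 1, 0;
     (Q₁ z : ℂ), (Q₂ z : ℂ), μ;
     0, μ, (Q₃ z : ℂ)]

/-- Temporal part of the associated Lax pair. -/
def assocV (Q₂ Q₃ q₁ q₂ : ℝ × ℝ → ℝ) (μ : ℂ) (z : ℝ × ℝ) : Matrix (Fin 3) (Fin 3) ℂ :=
  let q₁y : ℂ := ((pd1 q₁ z : ℝ) : ℂ)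
  let q₂y : ℂ := ((pd1 q₂ z : ℝ) : ℂ)
  let Q₂ : ℂ := ((Q₂ z : ℝ) : ℂ)
  let Q₃ : ℂ := ((Q₃ z : ℝ) : ℂ)
  let q₁ : ℂ := ((q₁ z : ℝ) : ℂ)
  let q₂ : ℂ := ((q₂ z : ℝ) : ℂ)
  !![1 / (3 * μ ^ 2), 0, q₁ / μ;
     0, 1 / (3 * μ ^ 2) + q₁, (Q₃ * q₁ + q₁y) / μ;
     (1 - q₂y + (Q₃ - Q₂) * q₂) / μ, q₂ / μ, q₁ - 2 / (3 * μ ^ 2)]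

/-! ## The associated 3-DP equation

The differential expressions below make sense in any commutative ring `R` with a map `d : R → R`.
They are used with `R` the functions of `(y, τ)` and `d = ∂_y`, and with `R` the
differential polynomials and `d` the total derivative. -/

/-- `S₁ = [(∂ + Q₃ - Q₂)(∂ + Q₃) - Q₁] q₁ + 1`. -/
def S₁ {R : Type*} [CommRing R] (d : R → R) (Q₁ Q₂ Q₃ q₁ : R) : R :=
  d (d q₁ + Q₃ * q₁) + (Q₃ - Q₂) * (d q₁ + Q₃ * q₁) - Q₁ * q₁ + 1

/-- `S₂ = [(∂ - Q₃)(∂ + Q₂ - Q₃) - Q₁] q₂ + Q₃`. -/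
def S₂ {R : Type*} [CommRing R] (d : R → R) (Q₁ Q₂ Q₃ q₂ : R) : R :=
  d (d q₂ + (Q₂ - Q₃) * q₂) - Q₃ * (d q₂ + (Q₂ - Q₃) * q₂) - Q₁ * q₂ + Q₃

/-- Right-hand sides of the evolution equations of the associated 3-DP equation. -/
def assocRHS {R : Type*} [CommRing R] (d : R → R) (Q₁ Q₂ Q₃ q₁ q₂ : R) : Fin 3 → R :=
  ![d q₂ + (Q₂ - Q₃) * q₂ + Q₁ * q₁ - 1,
    Q₃ * q₁ - q₂ + 2 * d q₁,
    q₂ - Q₃ * q₁]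

/-- `(Q₁, Q₂, Q₃, q₁, q₂)` is a smooth solution of the associated 3-DP equation on the set `D` of
points `(y, τ)`. -/
structure IsAssocThreeDP (D : Set (ℝ × ℝ)) (Q₁ Q₂ Q₃ q₁ q₂ : ℝ × ℝ → ℝ) : Prop where
  smooth_Q₁ : ContDiffOn ℝ ∞ Q₁ D
  smooth_Q₂ : ContDiffOn ℝ ∞ Q₂ D
  smooth_Q₃ : ContDiffOn ℝ ∞ Q₃ D
  smooth_q₁ : ContDiffOn ℝ ∞ q₁ D
  smooth_q₂ : ContDiffOn ℝ ∞ q₂ D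
  eq_Q₁ : ∀ z ∈ D, pd2 Q₁ z = assocRHS pd1 Q₁ Q₂ Q₃ q₁ q₂ 0 z
  eq_Q₂ : ∀ z ∈ D, pd2 Q₂ z = assocRHS pd1 Q₁ Q₂ Q₃ q₁ q₂ 1 z
  eq_Q₃ : ∀ z ∈ D, pd2 Q₃ z = assocRHS pd1 Q₁ Q₂ Q₃ q₁ q₂ 2 z
  eq_S₁ : ∀ z ∈ D, S₁ pd1 Q₁ Q₂ Q₃ q₁ z = 0
  eq_S₂ : ∀ z ∈ D, S₂ pd1 Q₁ Q₂ Q₃ q₂ z = 0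

/-! ## The Liouville transformation -/

/-- `y` is a potential of the reciprocal transformation `dy = u dx - u p r dt`. -/
structure IsReciprocal (Ω : Set (ℝ × ℝ)) (u p r y : ℝ × ℝ → ℝ) : Prop where
  smooth : ContDiffOn ℝ ∞ y Ω
  d_x : ∀ z ∈ Ω, pd1 y z = u z
  d_t : ∀ z ∈ Ω, pd2 y z = -(u z * p z * r z)

/-- The change of independent variables `(x, t) ↦ (y, τ) = (y(x, t), t)`. -/
def liouvilleMap (y : ℝ × ℝ → ℝ) (z : ℝ × ℝ) : ℝ × ℝ := (y z, z.2)

/-- The expression `vw/u² + 2u_x/u - v_x/v`. -/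
def liouvilleB (u v w : ℝ × ℝ → ℝ) : ℝ × ℝ → ℝ :=
  fun z => v z * w z / u z ^ 2 + 2 * (pd1 u z / u z) - pd1 v z / v z

def liouvilleP₁ (u v w : ℝ × ℝ → ℝ) : ℝ × ℝ → ℝ :=
  fun z => (1 + pd1 (liouvilleB u v w) z - liouvilleB u v w z ^ 2) / u z ^ 2

def liouvilleP₂ (u v w : ℝ × ℝ → ℝ) : ℝ × ℝ → ℝ :=
  fun z => (2 * v z * w z - 2 * u z ^ 2 * pd1 v z / v z + 3 * u z * pd1 u z) / u z ^ 3

def liouvilleP₃ (u v w : ℝ × ℝ → ℝ) : ℝ × ℝ → ℝ :=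
  fun z => v z * w z / u z ^ 3

/-- `(Q₁, Q₂, Q₃, q₁, q₂)`, as functions of `(y, τ)`, are the Liouville transforms of
`(u, v, w, p, r)`. -/
def IsLiouvilleTransform (Ω : Set (ℝ × ℝ)) (y u v w p r Q₁ Q₂ Q₃ q₁ q₂ : ℝ × ℝ → ℝ) : Prop :=
  ∀ z ∈ Ω,
    Q₁ (liouvilleMap y z) = liouvilleP₁ u v w z ∧
    Q₂ (liouvilleMap y z) = liouvilleP₂ u v w z ∧
    Q₃ (liouvilleMap y z) = liouvilleP₃ u v w z ∧
    q₁ (liouvilleMap y z) = p z * u z ^ 2 / v z ∧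
    q₂ (liouvilleMap y z) = r z * v z / u z

/-- `E` is an antiderivative `∂_y⁻¹ (v w u⁻³)`: in the old variables `E_x = v w / u²`, with the
time dependence fixed by the conservation law of the density `v w / u²`. -/
structure IsGaugeExponent (Ω : Set (ℝ × ℝ)) (u v w p r E : ℝ × ℝ → ℝ) : Prop where
  smooth : ContDiffOn ℝ ∞ E Ω
  d_x : ∀ z ∈ Ω, pd1 E z = v z * w z / u z ^ 2
  d_t : ∀ z ∈ Ω, pd2 E z = p z * pd1 r z - pd1 p z * r z - p z * r z * (v z * w z / u z ^ 2)

/-- The gauge factor `a = (v/u²) exp (-∂_y⁻¹ (v w u⁻³))`. -/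
def gaugeFactor (u v E : ℝ × ℝ → ℝ) : ℝ × ℝ → ℝ :=
  fun z => v z / u z ^ 2 * Real.exp (-E z)

/-- The wave function in the new gauge, `Φ = (ϕ₁, ∂_y ϕ₁, ϕ₂)`, where `φ₁ = a ϕ₁`,
`μ (u²/v) φ₁ + φ₃/μ = (u²/v) a ϕ₂`, and `∂_y ϕ₁ = u⁻¹ ∂ₓ (φ₁/a)` is written with `∂ₓ φ₁ = φ₂`. -/
def gaugeTransform (u v E : ℝ × ℝ → ℝ) (μ : ℂ) (φ : ℝ × ℝ → Fin 3 → ℂ) (z : ℝ × ℝ) :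
    Fin 3 → ℂ :=
  let ax : ℂ := ((pd1 (gaugeFactor u v E) z : ℝ) : ℂ)
  let a : ℂ := ((gaugeFactor u v E z : ℝ) : ℂ)
  let u : ℂ := ((u z : ℝ) : ℂ)
  let v : ℂ := ((v z : ℝ) : ℂ)
  ![φ z 0 / a,
    (φ z 1 / a - φ z 0 * ax / a ^ 2) / u,
    v / u ^ 2 / a * (μ * (u ^ 2 / v) * φ z 0 + φ z 2 / μ)]

/-! ## The Miura map and the generalized mKdV hierarchy -/

/-- The Miura map `(u₁, v₁, w₁) = F(Q₁, Q₂, Q₃)`. -/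
def miura {R : Type*} [CommRing R] (d : R → R) (Q₁ Q₂ Q₃ : R) : Fin 3 → R :=
  ![-Q₂ - Q₃,
    Q₂ * Q₃ - Q₁ + d Q₃,
    Q₁ * Q₃ - d (Q₂ * Q₃) - d (d Q₃)]

/-- The Fréchet derivative `F'` of the Miura map, applied to `h`. -/
def miuraDeriv {R : Type*} [CommRing R] (d : R → R) (Q₁ Q₂ Q₃ : R) (h : Fin 3 → R) : Fin 3 → R :=
  ![-h 1 - h 2,
    h 1 * Q₃ + Q₂ * h 2 - h 0 + d (h 2),
    h 0 * Q₃ + Q₁ * h 2 - d (h 1 * Q₃ + Q₂ * h 2) - d (d (h 2))]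

/-- The operator `𝒥₁` at the fields `U = (u₁, v₁, w₁)`, applied to `f`. -/
def opJ₁ {R : Type*} [CommRing R] (d : R → R) (U f : Fin 3 → R) : Fin 3 → R :=
  ![2 * d (f 2),
    2 * d (f 1) + (d (d (f 2)) + U 0 * d (f 2)),
    2 * d (f 0) + (-d (d (f 1)) + d (U 0 * f 1))]

/-- `χ₁ = 2w₁∂ + ∂w₁ - (∂³ - ∂u₁∂ + v₁∂)(∂ - u₁)`. -/
def chi₁ {R : Type*} [CommRing R] (d : R → R) (U : Fin 3 → R) (f : R) : R :=
  let g := d f - U 0 * f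
  2 * U 2 * d f + d (U 2 * f) - (d (d (d g)) - d (U 0 * d g) + U 1 * d g)

/-- The negative formal adjoint `-χ₁† = 2∂w₁ + w₁∂ + (∂ + u₁)(∂³ + ∂u₁∂ + ∂v₁)`. -/
def negAdjChi₁ {R : Type*} [CommRing R] (d : R → R) (U : Fin 3 → R) (f : R) : R :=
  let g := d (d (d f)) + d (U 0 * d f) + d (U 1 * f)
  2 * d (U 2 * f) + U 2 * d f + (d g + U 0 * g)

/-- `χ₂ = ∂u₁w₁ + u₁w₁∂ + w₁∂² - ∂²w₁`. -/
def chi₂ {R : Type*} [CommRing R] (d : R → R) (U : Fin 3 → R) (f : R) : R :=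
  d (U 0 * U 2 * f) + U 0 * U 2 * d f + U 2 * d (d f) - d (d (U 2 * f))

/-- The operator `𝒦₁` at the fields `U = (u₁, v₁, w₁)`, applied to `f`; the entries above the
diagonal are the negative formal adjoints of those below it. -/
def opK₁ {R : Type*} [CommRing R] (d : R → R) (U f : Fin 3 → R) : Fin 3 → R :=
  ![6 * d (f 0) + 4 * d (U 0 * f 1)
      + (2 * d (d (d (f 2))) + 2 * d (U 0 * d (f 2)) + 2 * d (U 1 * f 2)),
    4 * U 0 * d (f 0)
      + (2 * d (d (d (f 1))) + 2 * U 0 * d (U 0 * f 1) + d (U 1 * f 1) + U 1 * d (f 1))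
      + negAdjChi₁ d U (f 2),
    (2 * d (d (d (f 0))) - 2 * d (U 0 * d (f 0)) + 2 * U 1 * d (f 0))
      + chi₁ d U (f 1) + chi₂ d U (f 2)]

/-- `(Q₁, Q₂, Q₃)` with the auxiliary functions `A, B, C` solves on `D` the first negative flow
`Q_τ = F'⁻¹ 𝒥₁ (A, B, C)ᵀ`, `F'⁻¹ 𝒦₁ (A, B, C)ᵀ = 0` of the generalized mKdV hierarchy; here
`h = F'⁻¹ g` means `F' h = g`. -/
structure IsNegativeFlow (D : Set (ℝ × ℝ)) (Q₁ Q₂ Q₃ A B C : ℝ × ℝ → ℝ) : Prop where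
  smooth_Q₁ : ContDiffOn ℝ ∞ Q₁ D
  smooth_Q₂ : ContDiffOn ℝ ∞ Q₂ D
  smooth_Q₃ : ContDiffOn ℝ ∞ Q₃ D
  smooth_A : ContDiffOn ℝ ∞ A D
  smooth_B : ContDiffOn ℝ ∞ B D
  smooth_C : ContDiffOn ℝ ∞ C D
  flow : ∀ z ∈ D, ∀ i, miuraDeriv pd1 Q₁ Q₂ Q₃ ![pd2 Q₁, pd2 Q₂, pd2 Q₃] i z =
    opJ₁ pd1 (miura pd1 Q₁ Q₂ Q₃) ![A, B, C] i z
  constraint : ∀ z ∈ D, ∀ i, miuraDeriv pd1 Q₁ Q₂ Q₃ 0 i z =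
    opK₁ pd1 (miura pd1 Q₁ Q₂ Q₃) ![A, B, C] i z

/-- The choice of `(A, B, C)`; `σ₁`, `σ₂` stand for `∂_y⁻¹ S₁`, `∂_y⁻¹ S₂`. -/
def flowABC (Q₁ Q₂ Q₃ q₁ σ₁ σ₂ : ℝ × ℝ → ℝ) : Fin 3 → ℝ × ℝ → ℝ :=
  ![fun z => 1 / 4 * (pd1 σ₁ z - miura pd1 Q₁ Q₂ Q₃ 0 z * σ₁ z) - 1 / 2 * σ₂ z
      - Q₃ z * pd1 q₁ z - Q₃ z ^ 2 * q₁ z,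
    fun z => 1 / 2 * σ₁ z - Q₃ z * q₁ z,
    fun z => -q₁ z]

/-- The expressions `G₁, G₂, G₃`; `σ₁`, `σ₂` stand for `∂_y⁻¹ S₁`, `∂_y⁻¹ S₂`. -/
def flowG (Q₁ Q₂ Q₃ q₁ q₂ σ₁ : ℝ × ℝ → ℝ) : Fin 3 → ℝ × ℝ → ℝ :=
  let s₁ := S₁ pd1 Q₁ Q₂ Q₃ q₁
  let s₂ := S₂ pd1 Q₁ Q₂ Q₃ q₂
  ![fun z => Q₁ z * s₁ z + 1 / 2 * pd1 Q₁ z * σ₁ z + pd1 s₂ z - Q₂ z * s₂ z,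
    fun z => 1 / 2 * (pd1 s₁ z + pd1 (Q₂ * σ₁) z) + 2 * s₂ z,
    fun z => 1 / 2 * pd1 (Q₃ * σ₁) z + s₂ z]

/-! ## Hamiltonian operators on differential polynomials -/

/-- Differential polynomials in `Q₁, Q₂, Q₃`; the variable `(i, n)` is `∂ⁿ Q_{i+1}`. -/
abbrev DiffPoly : Type := MvPolynomial (Fin 3 × ℕ) ℝ

namespace DiffPoly

/-- The total derivative. -/
def tot : Derivation ℝ DiffPoly DiffPoly :=
  MvPolynomial.mkDerivation ℝ fun i => MvPolynomial.X (i.1, i.2 + 1)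

/-- The field `Q_{i+1}`. -/
def Q (i : Fin 3) : DiffPoly := MvPolynomial.X (i, 0)

/-- The evolutionary derivation `D_h` with characteristic `h`: the derivation with
`D_h (∂ⁿ Q_i) = ∂ⁿ h_i`, i.e. the Fréchet derivative in the direction `h`. -/
def evol (h : Fin 3 → DiffPoly) : Derivation ℝ DiffPoly DiffPoly :=
  MvPolynomial.mkDerivation ℝ fun i => tot^[i.2] (h i.1)

/-- Equality of functionals: `∫ f = ∫ g` iff `f - g` is a total derivative. -/
def FunctionalEq (f g : DiffPoly) : Prop := ∃ k, tot k = f - g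

/-- The density of the pairing of a covector and a vector. -/
def pair (θ h : Fin 3 → DiffPoly) : DiffPoly := ∑ i, θ i * h i

/-- A possibly nonlocal operator from covectors to vectors, given by its graph: `P θ h` means
`h = P θ`. -/
abbrev Operator : Type := (Fin 3 → DiffPoly) → (Fin 3 → DiffPoly) → Prop

/-- A (possibly nonlocal) Hamiltonian operator: linear, single-valued, with nondegenerate domain,
skew-adjoint, and satisfying the Jacobi identity
`⟨L_{h₁} θ₂, h₃⟩ + ⟨L_{h₂} θ₃, h₁⟩ + ⟨L_{h₃} θ₁, h₂⟩ = 0` for `hᵢ = P θᵢ`, where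
`⟨L_h θ, k⟩ = ⟨D_h θ, k⟩ + ⟨θ, D_k h⟩` is the Lie derivative of a covector. -/
structure IsHamiltonian (P : Operator) : Prop where
  add : ∀ θ₁ θ₂ h₁ h₂, P θ₁ h₁ → P θ₂ h₂ → P (θ₁ + θ₂) (h₁ + h₂)
  smul : ∀ (c : ℝ) (θ h), P θ h → P (c • θ) (c • h)
  single_valued : ∀ θ h h', P θ h → P θ h' → h = h'
  dense : ∀ k, (∀ θ h, P θ h → FunctionalEq (pair θ k) 0) → k = 0
  skew : ∀ θ₁ θ₂ h₁ h₂, P θ₁ h₁ → P θ₂ h₂ → FunctionalEq (pair θ₁ h₂ + pair θ₂ h₁) 0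
  jacobi : ∀ θ₁ θ₂ θ₃ h₁ h₂ h₃, P θ₁ h₁ → P θ₂ h₂ → P θ₃ h₃ →
    FunctionalEq
      ((pair (fun i => evol h₁ (θ₂ i)) h₃ + pair θ₂ (fun i => evol h₃ (h₁ i)))
      + (pair (fun i => evol h₂ (θ₃ i)) h₁ + pair θ₃ (fun i => evol h₁ (h₂ i)))
      + (pair (fun i => evol h₃ (θ₁ i)) h₂ + pair θ₁ (fun i => evol h₂ (h₃ i)))) 0

/-- The linear combination `α P + β P'`. -/
def pencil (α β : ℝ) (P P' : Operator) : Operator :=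
  fun θ h => ∃ k k', P θ k ∧ P' θ k' ∧ h = α • k + β • k'

/-- A Hamiltonian pair: two compatible Hamiltonian operators. -/
def IsHamiltonianPair (P P' : Operator) : Prop :=
  IsHamiltonian P ∧ IsHamiltonian P' ∧ ∀ α β : ℝ, IsHamiltonian (pencil α β P P')

/-- The fields `(u₁, v₁, w₁) = F(Q₁, Q₂, Q₃)`. -/
def miuraField : Fin 3 → DiffPoly := miura tot (Q 0) (Q 1) (Q 2)

/-- `F'` on differential polynomials. -/
def miuraD (h : Fin 3 → DiffPoly) : Fin 3 → DiffPoly := miuraDeriv tot (Q 0) (Q 1) (Q 2) h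

/-- The formal adjoint of an operator `T`, as a graph: `θ = T† ζ`. -/
def IsAdjointValue (T : (Fin 3 → DiffPoly) → (Fin 3 → DiffPoly)) (ζ θ : Fin 3 → DiffPoly) : Prop :=
  ∀ k, FunctionalEq (pair θ k) (pair ζ (T k))

/-- The operator `F'⁻¹ T (F'⁻¹)†`: one has `h = F'⁻¹ T (F'⁻¹)† θ` when `F' h = T ζ` for
`ζ = (F'⁻¹)† θ`, i.e. `θ = F'† ζ`. -/
def miuraPullback (T : (Fin 3 → DiffPoly) → (Fin 3 → DiffPoly)) : Operator :=
  fun θ h => ∃ ζ, IsAdjointValue miuraD ζ θ ∧ miuraD h = T ζ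

/-- `𝒥₂ = F'⁻¹ 𝒥₁ (F'⁻¹)†`. -/
def opJ₂ : Operator := miuraPullback (opJ₁ tot miuraField)

/-- `𝒦₂ = F'⁻¹ 𝒦₁ (F'⁻¹)†`. -/
def opK₂ : Operator := miuraPullback (opK₁ tot miuraField)

end DiffPoly

end ThreeDP

end

set_option linter.unusedSimpArgs false

noncomputable section

namespace ThreeDP

/-! ## The pencil `α 𝒥₁ + β 𝒦₁` over a differential ring -/

section Pencil

variable {R : Type*} [CommRing R] [Algebra ℝ R]

/-! The theorem rests on identities between differential polynomials, checked by the Leibniz rule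
and `ring` in an abstract differential ring. The rest is what turns them into statements on
functions and on nonlocal operators.

Hamiltonian pair. For `P = α𝒥₁ + β𝒦₁` the Jacobi identity takes the form `P'[P g] f - P'[P f] g =
P[f, g]`, where `P'` is the linearization in the fields and `[f, g]` is the adjoint of `δ ↦ P'[δ] g`
applied to `f`. It is quadratic in `(α, β)`, hence amounts to `bracketJ_identity`,
`bracketK_identity` and the compatibility `bracketJK_identity`. The Jacobi identity is covariant, so
it passes through the Miura map (`functional_lie`). The pullback is single-valued because `F'` and
its adjoint are injective, by a count of degree in the jets of `Q₁`. The delicate point is that the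
domain of the nonlocal `𝒥₂` has zero annihilator (`eq_zero_of_orthogonal_opJ₂`). Since `𝒦₂` is given
by a differential operator on the range of the adjoint, that domain serves the whole pencil.

Liouville transformation. The equation for `u` says that `u dx - upr dt` is closed, and `y_x = u ≠
0` makes `(x, t) ↦ (y, t)` an injective local diffeomorphism with `∂_y = u⁻¹∂_x` and `∂_τ = ∂_t +
pr∂_x`. The associated equation thus becomes a set of identities in the differential ring of the old
variables (`liouville_identities`), carried over by `Rep`. The Lax pairs are related by a gauge
matrix `M`, through `M_x + M U = U' M` and its analogue in time, where `U' = u Û`. Since `a_x = -b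
a`, one has `1 - a_xx / a = 1 + b_x - b²`, whence the formula for `Q₁`.

Compatibility and the negative flow are direct expansions: the entries of the curvature matrix are
the equations themselves, and `𝒥₁(A, B, C)`, `𝒦₁(A, B, C)` factor through `F'`. -/

theorem derivation_ofNat (d : Derivation ℝ R R) (n : ℕ) [n.AtLeastTwo] :
    d (ofNat(n) : R) = 0 := by
  have h := d.map_natCast n
  rwa [← Nat.cast_ofNat (R := R) (n := n)]

/-- The operator `α 𝒥₁ + β 𝒦₁`. -/
def opPencil (d : R → R) (α β : ℝ) (U f : Fin 3 → R) : Fin 3 → R :=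
  α • opJ₁ d U f + β • opK₁ d U f

/-- The linearization of `𝒥₁` in the fields, in the direction `δ`. -/
def opJ₁Lin (d : R → R) (δ f : Fin 3 → R) : Fin 3 → R :=
  ![0, δ 0 * d (f 2), d (δ 0 * f 1)]

/-- The linearization of `𝒦₁` in the fields, in the direction `δ`. -/
def opK₁Lin (d : R → R) (U δ f : Fin 3 → R) : Fin 3 → R :=
  ![4 * d (δ 0 * f 1) + 2 * d (δ 0 * d (f 2)) + 2 * d (δ 1 * f 2),
    4 * δ 0 * d (f 0) + 2 * δ 0 * d (U 0 * f 1) + 2 * U 0 * d (δ 0 * f 1) + d (δ 1 * f 1)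
      + δ 1 * d (f 1) + 2 * d (δ 2 * f 2) + δ 2 * d (f 2)
      + d (d (δ 0 * d (f 2)) + d (δ 1 * f 2)) + U 0 * (d (δ 0 * d (f 2)) + d (δ 1 * f 2))
      + δ 0 * (d (d (d (f 2))) + d (U 0 * d (f 2)) + d (U 1 * f 2)),
    -2 * d (δ 0 * d (f 0)) + 2 * δ 1 * d (f 0)
      + 2 * δ 2 * d (f 1) + d (δ 2 * f 1) + d (d (d (δ 0 * f 1))) - d (U 0 * d (δ 0 * f 1))
      + U 1 * d (δ 0 * f 1) + d (δ 0 * d (d (f 1) - U 0 * f 1)) - δ 1 * d (d (f 1) - U 0 * f 1)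
      + d ((δ 0 * U 2 + U 0 * δ 2) * f 2) + (δ 0 * U 2 + U 0 * δ 2) * d (f 2)
      + δ 2 * d (d (f 2)) - d (d (δ 2 * f 2))]

/-- The linearization of `α 𝒥₁ + β 𝒦₁` in the fields, in the direction `δ`. -/
def opPencilLin (d : R → R) (α β : ℝ) (U δ f : Fin 3 → R) : Fin 3 → R :=
  α • opJ₁Lin d δ f + β • opK₁Lin d U δ f

/-- The bracket of covectors attached to `𝒥₁`. -/
def bracketJ (d : R → R) (f g : Fin 3 → R) : Fin 3 → R :=
  ![f 1 * d (g 2) - d (f 2) * g 1, 0, 0]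

/-- The bracket of covectors attached to `𝒦₁`. -/
def bracketK (d : R → R) (U f g : Fin 3 → R) : Fin 3 → R :=
  ![4 * (f 1 * d (g 0) - d (f 0) * g 1) - 2 * (d (f 0) * d (g 2) - d (f 2) * d (g 0))
      + 2 * U 0 * (f 1 * d (g 1) - d (f 1) * g 1)
      + U 0 * (f 1 * d (d (g 2)) - d (d (f 2)) * g 1 + d (f 2) * d (g 1) - d (f 1) * d (g 2))
      + U 1 * (f 1 * d (g 2) - d (f 2) * g 1) + d (U 1) * (f 1 * g 2 - f 2 * g 1)
      + U 2 * (f 2 * d (g 2) - d (f 2) * g 2)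
      + d (d (f 1)) * d (g 2) - d (f 2) * d (d (g 1)) + f 1 * d (d (d (g 2)))
      - d (d (d (f 2))) * g 1,
    f 1 * d (g 1) - d (f 1) * g 1 + 2 * (f 2 * d (g 0) - d (f 0) * g 2)
      + d (d (f 1)) * g 2 - f 2 * d (d (g 1)) + U 0 * (f 2 * d (g 1) - d (f 1) * g 2)
      + d (U 0) * (f 2 * g 1 - f 1 * g 2),
    f 1 * d (g 2) - d (f 2) * g 1 + 2 * (f 2 * d (g 1) - d (f 1) * g 2)
      + U 0 * (f 2 * d (g 2) - d (f 2) * g 2) + f 2 * d (d (g 2)) - d (d (f 2)) * g 2]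

/-- The bracket of covectors attached to `α 𝒥₁ + β 𝒦₁`. -/
def bracketPencil (d : R → R) (α β : ℝ) (U f g : Fin 3 → R) : Fin 3 → R :=
  α • bracketJ d f g + β • bracketK d U f g

/-- In an arbitrary differential ring being a total derivative means having a primitive there, so
the boundary term of the integration by parts is exhibited. -/
theorem opJ₁_skew (d : Derivation ℝ R R) (U f g : Fin 3 → R) :
    (∑ i, f i * opJ₁ d U g i) + ∑ i, g i * opJ₁ d U f i =
      d (2 * f 0 * g 2 + 2 * f 2 * g 0 + 2 * f 1 * g 1 + f 1 * d (g 2) - d (f 1) * g 2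
        - f 2 * d (g 1) + d (f 2) * g 1 + U 0 * (f 1 * g 2 + f 2 * g 1)) := by
  simp only [Fin.sum_univ_three, opJ₁, Matrix.cons_val_zero, Matrix.cons_val_one, Matrix.cons_val,
    map_add, map_sub, map_neg, Derivation.leibniz, smul_eq_mul, derivation_ofNat, mul_zero,
    add_zero]
  ring

theorem opK₁_skew (d : Derivation ℝ R R) (U f g : Fin 3 → R) :
    (∑ i, f i * opK₁ d U g i) + ∑ i, g i * opK₁ d U f i =
      d ((d (d (d (f 2)))) * (g 1) - (d (d (d (f 1)))) * (g 2) + 2 * (d (d (f 2))) * (g 0) + 2 *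
          (d (d (f 1))) * (g 1) + 2 * (d (d (f 2))) * (g 1) * (U 0) + 2 * (d (d (f 0))) * (g 2)
          + 2 * (d (d (f 1))) * (g 2) * (U 0) - (d (d (f 2))) * (d (g 1)) + (d (d (f 1))) * (d
          (g 2)) + 2 * (d (f 2)) * (g 0) * (U 0) + (d (f 2)) * (g 1) * (U 1) + (d (f 2)) *
          (g 1) * (U 0)^2 - 2 * (d (f 0)) * (g 2) * (U 0) + 2 * (d (f 1)) * (g 2) * (d (U 0)) -
          (d (f 1)) * (g 2) * (U 0)^2 - (d (f 1)) * (g 2) * (U 1) - 2 * (d (f 2)) * (d (g 0))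
          - 2 * (d (f 1)) * (d (g 1)) - 2 * (d (f 2)) * (d (g 1)) * (U 0) - 2 * (d (f 0)) * (d
          (g 2)) - 2 * (d (f 1)) * (d (g 2)) * (U 0) + (d (f 2)) * (d (d (g 1))) - (d (f 1)) *
          (d (d (g 2))) + 6 * (f 0) * (g 0) + 4 * (f 1) * (g 0) * (U 0) + 2 * (f 2) * (g 0) *
          (U 1) + 4 * (f 0) * (g 1) * (U 0) + 2 * (f 1) * (g 1) * (U 0)^2 + 2 * (f 1) * (g 1) *
          (U 1) + 3 * (f 2) * (g 1) * (U 2) + (f 2) * (g 1) * (d (d (U 0))) + (f 2) * (g 1) * (d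
          (U 1)) - (f 2) * (g 1) * (U 0) * (d (U 0)) + (f 2) * (g 1) * (U 0) * (U 1) + 2 *
          (f 0) * (g 2) * (U 1) + 3 * (f 1) * (g 2) * (U 2) + (f 1) * (g 2) * (d (d (U 0))) -
          (f 1) * (g 2) * (U 0) * (d (U 0)) + (f 1) * (g 2) * (U 0) * (U 1) + 2 * (f 2) *
          (g 2) * (U 0) * (U 2) - 2 * (f 2) * (g 2) * (d (U 2)) - 2 * (f 2) * (d (g 0)) * (U 0)
          - (f 2) * (d (g 1)) * (U 1) - (f 2) * (d (g 1)) * (U 0)^2 + 2 * (f 0) * (d (g 2)) *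
          (U 0) + (f 1) * (d (g 2)) * (U 0)^2 + (f 1) * (d (g 2)) * (U 1) + (f 1) * (g 2) * (d
          (U 1)) + 2 * (f 2) * (d (d (g 0))) + 2 * (f 1) * (d (d (g 1))) + 2 * (f 2) * (d (d
          (g 1))) * (U 0) + 2 * (f 2) * (d (g 1)) * (d (U 0)) + 2 * (f 0) * (d (d (g 2))) + 2 *
          (f 1) * (d (d (g 2))) * (U 0) - (f 2) * (d (d (d (g 1)))) + (f 1) * (d (d (d
          (g 2))))) := by
  simp only [Fin.sum_univ_three, opK₁, chi₁, negAdjChi₁, chi₂, Matrix.cons_val_zero,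
    Matrix.cons_val_one, Matrix.cons_val, map_add, map_sub, map_neg, Derivation.leibniz,
    smul_eq_mul, derivation_ofNat, mul_zero, add_zero, pow_two]
  ring

/-- This relation is the origin of the bracket: it is the formal adjoint of `δ ↦ 𝒥₁'[δ] g` applied
to `f`, found by moving all derivatives off `δ`. -/
theorem bracketJ_pairing (d : Derivation ℝ R R) (δ f g : Fin 3 → R) :
    ∑ i, f i * opJ₁Lin d δ g i = ∑ i, bracketJ d f g i * δ i + d (f 2 * δ 0 * g 1) := by
  simp only [Fin.sum_univ_three, opJ₁Lin, bracketJ, Matrix.cons_val_zero, Matrix.cons_val_one,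
    Matrix.cons_val, Derivation.leibniz, smul_eq_mul]
  ring

theorem bracketK_pairing (d : Derivation ℝ R R) (U δ f g : Fin 3 → R) :
    ∑ i, f i * opK₁Lin d U δ g i = ∑ i, bracketK d U f g i * δ i +
      d ((f 2) * (g 1) * (d (d (δ 0))) + (f 1) * (d (g 2)) * (d (δ 0)) + (f 1) * (g 2) * (d
          (δ 1)) + 2 * (f 2) * (d (g 1)) * (d (δ 0)) - (f 2) * (g 1) * (d (δ 0)) * (U 0) -
          (f 2) * (g 2) * (d (δ 2)) - (d (f 2)) * (g 1) * (d (δ 0)) + 4 * (f 0) * (g 1) * (δ 0)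
          + 2 * (f 0) * (d (g 2)) * (δ 0) + 2 * (f 0) * (g 2) * (δ 1) + 2 * (f 1) * (g 1) *
          (δ 0) * (U 0) + (f 1) * (g 1) * (δ 1) + 2 * (f 1) * (g 2) * (δ 2) + (f 1) * (d (d
          (g 2))) * (δ 0) + (f 1) * (d (g 2)) * (δ 1) + (f 1) * (d (g 2)) * (δ 0) * (U 0) +
          (f 1) * (g 2) * (δ 1) * (U 0) - 2 * (f 2) * (d (g 0)) * (δ 0) + (f 2) * (g 1) * (δ 2)
          + 2 * (f 2) * (d (d (g 1))) * (δ 0) - 2 * (f 2) * (d (g 1)) * (δ 0) * (U 0) - (f 2) *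
          (g 1) * (δ 0) * (d (U 0)) + (f 2) * (g 1) * (δ 0) * (U 1) + (f 2) * (g 2) * (δ 0) *
          (U 2) + (f 2) * (g 2) * (δ 2) * (U 0) - (f 2) * (d (g 2)) * (δ 2) - (d (f 1)) * (d
          (g 2)) * (δ 0) - (d (f 1)) * (g 2) * (δ 1) - (d (f 2)) * (d (g 1)) * (δ 0) + (d
          (f 2)) * (g 1) * (δ 0) * (U 0) + (d (f 2)) * (g 2) * (δ 2) + (d (d (f 2))) * (g 1) *
          (δ 0)) := by
  simp only [Fin.sum_univ_three, opK₁Lin, bracketK, Matrix.cons_val_zero,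
    Matrix.cons_val_one, Matrix.cons_val, map_add, map_sub, map_neg, Derivation.leibniz,
    smul_eq_mul, derivation_ofNat, mul_zero, add_zero]
  ring

/-- The Jacobi identity of `𝒦₁` in operator form, one component at a time. The covectors `f`, `g`
are free elements: only the coefficients of the operator are varied, so both sides expand to the
same differential polynomial in `U`, `f`, `g`. -/
theorem bracketK_identity₀ (d : Derivation ℝ R R) (U f g : Fin 3 → R) :
    opK₁Lin d U (opK₁ d U g) f 0 - opK₁Lin d U (opK₁ d U f) g 0 =
      opK₁ d U (bracketK d U f g) 0 := by
  simp only [opK₁Lin, opK₁, bracketK, chi₁, negAdjChi₁, chi₂, Matrix.cons_val_zero,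
    Matrix.cons_val_one, Matrix.cons_val, map_add, map_sub, map_neg, Derivation.leibniz,
    smul_eq_mul, derivation_ofNat, mul_zero, add_zero, pow_two]
  ring

theorem bracketK_identity₁ (d : Derivation ℝ R R) (U f g : Fin 3 → R) :
    opK₁Lin d U (opK₁ d U g) f 1 - opK₁Lin d U (opK₁ d U f) g 1 =
      opK₁ d U (bracketK d U f g) 1 := by
  simp only [opK₁Lin, opK₁, bracketK, chi₁, negAdjChi₁, chi₂, Matrix.cons_val_zero,
    Matrix.cons_val_one, Matrix.cons_val, map_add, map_sub, map_neg, Derivation.leibniz,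
    smul_eq_mul, derivation_ofNat, mul_zero, add_zero, pow_two]
  ring

theorem bracketK_identity₂ (d : Derivation ℝ R R) (U f g : Fin 3 → R) :
    opK₁Lin d U (opK₁ d U g) f 2 - opK₁Lin d U (opK₁ d U f) g 2 =
      opK₁ d U (bracketK d U f g) 2 := by
  simp only [opK₁Lin, opK₁, bracketK, chi₁, negAdjChi₁, chi₂, Matrix.cons_val_zero,
    Matrix.cons_val_one, Matrix.cons_val, map_add, map_sub, map_neg, Derivation.leibniz,
    smul_eq_mul, derivation_ofNat, mul_zero, add_zero, pow_two]
  ring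

end Pencil

/-! ### Bracket identities, linearity and chain rule for the pencil -/

section PencilIdentities

variable {R : Type*} [CommRing R] [Algebra ℝ R]

theorem bracketJ_identity (d : Derivation ℝ R R) (U f g : Fin 3 → R) :
    opJ₁Lin d (opJ₁ d U g) f - opJ₁Lin d (opJ₁ d U f) g = opJ₁ d U (bracketJ d f g) := by
  funext i
  fin_cases i <;>
  simp only [opJ₁Lin, opJ₁, bracketJ, Fin.zero_eta, Fin.mk_one, Fin.reduceFinMk, Pi.sub_apply,
    Matrix.cons_val_zero, Matrix.cons_val_one, Matrix.cons_val, map_add, map_sub, map_neg, map_zero,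
    Derivation.leibniz, smul_eq_mul, derivation_ofNat, mul_zero, add_zero] <;>
  ring

theorem bracketK_identity (d : Derivation ℝ R R) (U f g : Fin 3 → R) :
    opK₁Lin d U (opK₁ d U g) f - opK₁Lin d U (opK₁ d U f) g = opK₁ d U (bracketK d U f g) := by
  funext i
  fin_cases i
  · exact bracketK_identity₀ d U f g
  · exact bracketK_identity₁ d U f g
  · exact bracketK_identity₂ d U f g

/-- Compatibility of the two operators: this is the coefficient of `αβ` in the Jacobi identity of
the pencil. -/
theorem bracketJK_identity (d : Derivation ℝ R R) (U f g : Fin 3 → R) :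
    opJ₁Lin d (opK₁ d U g) f - opJ₁Lin d (opK₁ d U f) g
      + (opK₁Lin d U (opJ₁ d U g) f - opK₁Lin d U (opJ₁ d U f) g) =
      opJ₁ d U (bracketK d U f g) + opK₁ d U (bracketJ d f g) := by
  funext i
  fin_cases i <;>
  simp only [opJ₁Lin, opJ₁, bracketJ, opK₁Lin, opK₁, bracketK, chi₁, negAdjChi₁, chi₂,
    Fin.zero_eta, Fin.mk_one, Fin.reduceFinMk, Pi.sub_apply, Pi.add_apply,
    Matrix.cons_val_zero, Matrix.cons_val_one, Matrix.cons_val, map_add, map_sub, map_neg, map_zero,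
    Derivation.leibniz, smul_eq_mul, derivation_ofNat, mul_zero, add_zero] <;>
  ring

theorem opJ₁_linear (d : Derivation ℝ R R) (U f g : Fin 3 → R) (a b : ℝ) :
    opJ₁ d U (a • f + b • g) = a • opJ₁ d U f + b • opJ₁ d U g := by
  funext i
  fin_cases i <;>
  simp only [opJ₁, Fin.zero_eta, Fin.mk_one, Fin.reduceFinMk, Pi.smul_apply, Pi.add_apply,
    Matrix.cons_val_zero, Matrix.cons_val_one, Matrix.cons_val] <;>
  simp only [Algebra.smul_def] <;>
  simp [Derivation.leibniz] <;>
  ring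

theorem opK₁_linear (d : Derivation ℝ R R) (U f g : Fin 3 → R) (a b : ℝ) :
    opK₁ d U (a • f + b • g) = a • opK₁ d U f + b • opK₁ d U g := by
  funext i
  fin_cases i <;>
  simp only [opK₁, chi₁, negAdjChi₁, chi₂,
    Fin.zero_eta, Fin.mk_one, Fin.reduceFinMk, Pi.smul_apply, Pi.add_apply,
    Matrix.cons_val_zero, Matrix.cons_val_one, Matrix.cons_val] <;>
  simp only [Algebra.smul_def] <;>
  simp only [map_add, map_sub, map_neg, map_zero,
    Derivation.leibniz, smul_eq_mul, derivation_ofNat, mul_zero, add_zero,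
    Derivation.map_algebraMap] <;>
  ring

theorem opJ₁Lin_linear (d : Derivation ℝ R R) (δ δ' f : Fin 3 → R) (a b : ℝ) :
    opJ₁Lin d (a • δ + b • δ') f = a • opJ₁Lin d δ f + b • opJ₁Lin d δ' f := by
  funext i
  fin_cases i <;>
  simp only [opJ₁Lin, Fin.zero_eta, Fin.mk_one, Fin.reduceFinMk, Pi.smul_apply, Pi.add_apply,
    Matrix.cons_val_zero, Matrix.cons_val_one, Matrix.cons_val] <;>
  simp only [Algebra.smul_def] <;>
  try simp [Derivation.leibniz]
  all_goals ring

theorem opK₁Lin_linear (d : Derivation ℝ R R) (U δ δ' f : Fin 3 → R) (a b : ℝ) :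
    opK₁Lin d U (a • δ + b • δ') f = a • opK₁Lin d U δ f + b • opK₁Lin d U δ' f := by
  funext i
  fin_cases i <;>
  simp only [opK₁Lin,
    Fin.zero_eta, Fin.mk_one, Fin.reduceFinMk, Pi.smul_apply, Pi.add_apply,
    Matrix.cons_val_zero, Matrix.cons_val_one, Matrix.cons_val] <;>
  simp only [Algebra.smul_def] <;>
  simp only [map_add, map_sub, map_neg, map_zero,
    Derivation.leibniz, smul_eq_mul, derivation_ofNat, mul_zero, add_zero,
    Derivation.map_algebraMap] <;>
  ring

theorem opPencil_linear (d : Derivation ℝ R R) (α β : ℝ) (U f g : Fin 3 → R) (a b : ℝ) :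
    opPencil d α β U (a • f + b • g) = a • opPencil d α β U f + b • opPencil d α β U g := by
  simp only [opPencil, opJ₁_linear, opK₁_linear]
  module

theorem bracketPencil_identity (d : Derivation ℝ R R) (α β : ℝ) (U f g : Fin 3 → R) :
    opPencilLin d α β U (opPencil d α β U g) f - opPencilLin d α β U (opPencil d α β U f) g =
      opPencil d α β U (bracketPencil d α β U f g) := by
  have hJ := bracketJ_identity d U f g
  have hK := bracketK_identity d U f g
  have hJK := bracketJK_identity d U f g
  simp only [opPencilLin, opPencil, bracketPencil, opJ₁_linear, opK₁_linear, opJ₁Lin_linear,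
    opK₁Lin_linear]
  linear_combination (norm := module) (α * α) • hJ + (α * β) • hJK + (β * β) • hK

theorem opPencil_skew (d : Derivation ℝ R R) (α β : ℝ) (U f g : Fin 3 → R) :
    ∃ k, d k = (∑ i, f i * opPencil d α β U g i) + ∑ i, g i * opPencil d α β U f i := by
  obtain ⟨kJ, hJ⟩ : ∃ k, d k = _ := ⟨_, (opJ₁_skew d U f g).symm⟩
  obtain ⟨kK, hK⟩ : ∃ k, d k = _ := ⟨_, (opK₁_skew d U f g).symm⟩
  refine ⟨α • kJ + β • kK, ?_⟩
  · rw [map_add, Derivation.map_smul, Derivation.map_smul, hJ, hK]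
    simp only [opPencil, Pi.add_apply, Pi.smul_apply, mul_add, mul_smul_comm,
      Finset.sum_add_distrib, Finset.smul_sum, smul_add]
    abel

theorem bracketPencil_pairing (d : Derivation ℝ R R) (α β : ℝ) (U δ f g : Fin 3 → R) :
    ∃ k, d k = ∑ i, f i * opPencilLin d α β U δ g i - ∑ i, bracketPencil d α β U f g i * δ i := by
  obtain ⟨kJ, hJ⟩ : ∃ k, d k = _ := ⟨_, (sub_eq_of_eq_add' (bracketJ_pairing d δ f g)).symm⟩
  obtain ⟨kK, hK⟩ : ∃ k, d k = _ := ⟨_, (sub_eq_of_eq_add' (bracketK_pairing d U δ f g)).symm⟩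
  refine ⟨α • kJ + β • kK, ?_⟩
  · rw [map_add, Derivation.map_smul, Derivation.map_smul, hJ, hK]
    simp only [opPencilLin, bracketPencil, Pi.add_apply, Pi.smul_apply, mul_add, add_mul,
      mul_smul_comm, smul_mul_assoc, Finset.sum_add_distrib, Finset.smul_sum, smul_sub]
    abel

/-- The bracket is antisymmetric exactly, not only modulo total derivatives. -/
theorem bracketPencil_antisymm (d : Derivation ℝ R R) (α β : ℝ) (U f g : Fin 3 → R) :
    bracketPencil d α β U g f = -bracketPencil d α β U f g := by
  have hJ : bracketJ d g f = -bracketJ d f g := by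
    funext i; fin_cases i <;> simp [bracketJ]; ring
  have hK : bracketK d U g f = -bracketK d U f g := by
    funext i; fin_cases i <;> simp [bracketK] <;> ring
  rw [bracketPencil, hJ, hK, bracketPencil]
  module

/-- Chain rule: `e` passes through every `d` and hits either the argument or a coefficient. It is
applied to evolutionary derivations. -/
theorem derivation_opPencil (d e : Derivation ℝ R R) (h : ∀ x, e (d x) = d (e x)) (α β : ℝ)
    (U f : Fin 3 → R) :
    (fun i => e (opPencil d α β U f i)) =
      opPencil d α β U (fun i => e (f i)) + opPencilLin d α β U (fun i => e (U i)) f := by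
  have hJ : (fun i => e (opJ₁ d U f i)) =
      opJ₁ d U (fun i => e (f i)) + opJ₁Lin d (fun i => e (U i)) f := by
    funext i
    fin_cases i <;>
    simp [opJ₁, opJ₁Lin, Derivation.leibniz, h, derivation_ofNat] <;>
    ring
  have hK : (fun i => e (opK₁ d U f i)) =
      opK₁ d U (fun i => e (f i)) + opK₁Lin d U (fun i => e (U i)) f := by
    funext i
    fin_cases i <;>
    simp only [opK₁, opK₁Lin, chi₁, negAdjChi₁, chi₂, h,
      Fin.zero_eta, Fin.mk_one, Fin.reduceFinMk, Pi.smul_apply, Pi.add_apply,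
      Matrix.cons_val_zero, Matrix.cons_val_one, Matrix.cons_val, map_add, map_sub, map_neg,
      map_zero, Derivation.leibniz, smul_eq_mul, derivation_ofNat, mul_zero, add_zero] <;>
    ring
  have : (fun i => e (opPencil d α β U f i)) =
      α • (fun i => e (opJ₁ d U f i)) + β • (fun i => e (opK₁ d U f i)) := by
    funext i; simp [opPencil]
  rw [this, hJ, hK, opPencil, opPencilLin]
  module

end PencilIdentities

namespace DiffPoly

/-! ## Functionals of differential polynomials -/

/-- The class `∫ f` of a differential polynomial modulo total derivatives. -/
def functional : DiffPoly →ₗ[ℝ] DiffPoly ⧸ LinearMap.range (tot : DiffPoly →ₗ[ℝ] DiffPoly) :=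
  Submodule.mkQ _

theorem functionalEq_iff {f g : DiffPoly} : FunctionalEq f g ↔ functional f = functional g := by
  rw [functional, Submodule.mkQ_apply, Submodule.mkQ_apply, Submodule.Quotient.eq]
  rfl

@[simp]
theorem functional_tot (f : DiffPoly) : functional (tot f) = 0 :=
  (Submodule.Quotient.mk_eq_zero _).2 ⟨f, rfl⟩

theorem functional_eq_zero {f : DiffPoly} : functional f = 0 ↔ ∃ k, tot k = f :=
  Submodule.Quotient.mk_eq_zero _

/-- Integration by parts. -/
@[simp]
theorem tot_X (x : Fin 3 × ℕ) : tot (MvPolynomial.X x) = MvPolynomial.X (x.1, x.2 + 1) :=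
  MvPolynomial.mkDerivation_X _ _ _

theorem evol_X (h : Fin 3 → DiffPoly) (x : Fin 3 × ℕ) :
    evol h (MvPolynomial.X x) = tot^[x.2] (h x.1) :=
  MvPolynomial.mkDerivation_X _ _ _

@[simp]
theorem evol_Q (h : Fin 3 → DiffPoly) (i : Fin 3) : evol h (Q i) = h i := evol_X h (i, 0)

/-- The commutator is a derivation, so it is enough that it kills the generators. -/
theorem evol_tot (h : Fin 3 → DiffPoly) (f : DiffPoly) : evol h (tot f) = tot (evol h f) := by
  have : ⁅evol h, tot⁆ = 0 := by
    refine MvPolynomial.derivation_ext fun x => ?_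
    rw [Derivation.commutator_apply, tot_X, evol_X, evol_X, Function.iterate_succ_apply', sub_self,
      Derivation.zero_apply]
  have h2 := DFunLike.congr_fun this f
  rw [Derivation.commutator_apply] at h2
  exact sub_eq_zero.1 h2

theorem evol_tot_iterate (h : Fin 3 → DiffPoly) (n : ℕ) (f : DiffPoly) :
    evol h (tot^[n] f) = tot^[n] (evol h f) := by
  induction n with
  | zero => rfl
  | succ n ih => rw [Function.iterate_succ_apply', Function.iterate_succ_apply', evol_tot, ih]

theorem tot_iterate_sub (n : ℕ) (f g : DiffPoly) :
    tot^[n] (f - g) = tot^[n] f - tot^[n] g := by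
  induction n with
  | zero => rfl
  | succ n ih => simp only [Function.iterate_succ_apply', ih, map_sub]

/-- The commutator of two derivations that commute with `tot` is again evolutionary, so its values
on the fields give its characteristic. -/
theorem evol_evol_sub (h k : Fin 3 → DiffPoly) (f : DiffPoly) :
    evol h (evol k f) - evol k (evol h f) = evol (fun i => evol h (k i) - evol k (h i)) f := by
  have : ⁅evol h, evol k⁆ = evol (fun i => evol h (k i) - evol k (h i)) := by
    refine MvPolynomial.derivation_ext fun x => ?_
    rw [Derivation.commutator_apply, evol_X, evol_X, evol_X, evol_tot_iterate, evol_tot_iterate,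
      tot_iterate_sub]
  rw [← this, Derivation.commutator_apply]

theorem miuraD_eq_evol (h : Fin 3 → DiffPoly) (i : Fin 3) :
    miuraD h i = evol h (miuraField i) := by
  fin_cases i <;>
  simp only [miuraD, miuraDeriv, miuraField, miura, Fin.zero_eta, Fin.mk_one, Fin.reduceFinMk,
    Matrix.cons_val_zero, Matrix.cons_val_one, Matrix.cons_val, map_add, map_sub, map_neg,
    Derivation.leibniz, smul_eq_mul, evol_tot, evol_Q] <;>
  ring

theorem miura_factorization (f : DiffPoly) :
    tot (tot (tot f) - Q 1 * tot f - Q 0 * f) - Q 2 * (tot (tot f) - Q 1 * tot f - Q 0 * f) =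
      tot (tot (tot f) + miuraField 0 * tot f + miuraField 1 * f) + miuraField 2 * f := by
  simp only [miuraField, miura, Matrix.cons_val_zero, Matrix.cons_val_one, Matrix.cons_val,
    map_add, map_sub, map_neg, Derivation.leibniz, smul_eq_mul]
  ring

theorem functional_evol {f g : DiffPoly} (h : Fin 3 → DiffPoly)
    (hfg : functional f = functional g) : functional (evol h f) = functional (evol h g) := by
  rw [← sub_eq_zero, ← map_sub, functional_eq_zero] at hfg
  obtain ⟨k, hk⟩ := hfg
  rw [← sub_eq_zero, ← map_sub, ← map_sub, ← hk, evol_tot, functional_tot]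

theorem pair_add_left (θ θ' h : Fin 3 → DiffPoly) : pair (θ + θ') h = pair θ h + pair θ' h := by
  simp [pair, add_mul, Finset.sum_add_distrib]

theorem pair_add_right (θ h h' : Fin 3 → DiffPoly) : pair θ (h + h') = pair θ h + pair θ h' := by
  simp [pair, mul_add, Finset.sum_add_distrib]

theorem pair_sub_right (θ h h' : Fin 3 → DiffPoly) : pair θ (h - h') = pair θ h - pair θ h' := by
  simp [pair, mul_sub, Finset.sum_sub_distrib]

theorem pair_neg_left (θ h : Fin 3 → DiffPoly) : pair (-θ) h = -pair θ h := by
  simp [pair]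

theorem pair_smul_left (c : ℝ) (θ h : Fin 3 → DiffPoly) : pair (c • θ) h = c • pair θ h := by
  simp [pair, Finset.smul_sum]

theorem pair_comm (θ h : Fin 3 → DiffPoly) : pair θ h = pair h θ := by
  simp [pair, mul_comm]

theorem evol_pair (k θ h : Fin 3 → DiffPoly) :
    evol k (pair θ h) = pair (fun i => evol k (θ i)) h + pair θ (fun i => evol k (h i)) := by
  simp only [pair, map_sum, Derivation.leibniz, smul_eq_mul, Finset.sum_add_distrib]
  rw [add_comm]
  simp only [mul_comm]

/-! ## Nondegeneracy of the pairing -/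

/-- The extra term arises because `tot` produces `∂ⁿ⁺¹Q_j` out of `∂ⁿQ_j`; on generators nothing
else survives in the commutator. -/
theorem pderiv_tot_succ (j : Fin 3) (n : ℕ) (f : DiffPoly) :
    MvPolynomial.pderiv (j, n + 1) (tot f) =
      tot (MvPolynomial.pderiv (j, n + 1) f) + MvPolynomial.pderiv (j, n) f := by
  have : ⁅(MvPolynomial.pderiv (j, n + 1) : Derivation ℝ DiffPoly DiffPoly), tot⁆ =
      MvPolynomial.pderiv (j, n) := by
    refine MvPolynomial.derivation_ext fun x => ?_
    simp only [Derivation.commutator_apply, tot_X, MvPolynomial.pderiv_X]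
    simp only [Pi.single_apply, Prod.ext_iff, add_left_inj]
    split_ifs <;> simp
  have h2 := DFunLike.congr_fun this f
  rw [Derivation.commutator_apply] at h2
  rw [← h2]
  ring

theorem exists_pderiv_eq_zero (f : DiffPoly) :
    ∃ N, ∀ n, N ≤ n → ∀ j, MvPolynomial.pderiv (j, n) f = 0 := by
  refine ⟨f.vars.sup (fun x => x.2) + 1, fun n hn j => ?_⟩
  refine MvPolynomial.pderiv_eq_zero_of_notMem_vars fun hmem => ?_
  have := Finset.le_sup (f := fun x : Fin 3 × ℕ => x.2) hmem
  simp only at this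
  omega

/-- A total derivative is affine in its jets of highest order, whereas `f` times the square of a jet
of order beyond those in `f` is quadratic in that jet; so the latter can be exact only for `f = 0`.
-/
theorem eq_zero_of_functional_mul {f : DiffPoly} (hf : ∀ k, functional (f * k) = 0) : f = 0 := by
  obtain ⟨N, hN⟩ := exists_pderiv_eq_zero f
  obtain ⟨g, hg⟩ := functional_eq_zero.1 (hf (MvPolynomial.X (0, N + 1) ^ 2))
  obtain ⟨M, hM⟩ := exists_pderiv_eq_zero g
  -- Descending induction on the order: if `tot g` contains no jet of order above `N + 1`, then `g`
  -- contains none above `N`.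
  have hbig : ∀ m, ∀ n, M ≤ n + m → N + 1 ≤ n → ∀ j, MvPolynomial.pderiv (j, n) g = 0 := by
    intro m
    induction m with
    | zero => exact fun n h _ j => hM n h j
    | succ m ih =>
      intro n h1 h2 j
      have h3 := pderiv_tot_succ j n g
      have hX : MvPolynomial.pderiv (j, n + 1) (MvPolynomial.X (0, N + 1) : DiffPoly) = 0 :=
        MvPolynomial.pderiv_X_of_ne fun h => by
          have := congrArg Prod.snd h
          simp only at this
          omega
      have hf := hN (n + 1) (by omega) j
      rw [ih (n + 1) (by omega) (by omega) j, map_zero, zero_add, hg, Derivation.leibniz,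
        MvPolynomial.pderiv_pow, hX, hf] at h3
      simpa using h3.symm
  have hg' : ∀ n, N + 1 ≤ n → ∀ j, MvPolynomial.pderiv (j, n) g = 0 :=
    fun n hn j => hbig M n (by omega) hn j
  have h1 := pderiv_tot_succ 0 N g
  rw [hg' (N + 1) le_rfl, map_zero, zero_add] at h1
  -- The derivative of `g` along the `N`-th jet is `2 f` times the `(N + 1)`-st jet, yet it cannot
  -- depend on that jet because `g` does not.
  have h2 : MvPolynomial.pderiv (0, N + 1) (MvPolynomial.pderiv (0, N) g) = 0 := by
    have : ⁅(MvPolynomial.pderiv (0, N + 1) : Derivation ℝ DiffPoly DiffPoly),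
        (MvPolynomial.pderiv (0, N) : Derivation ℝ DiffPoly DiffPoly)⁆ = 0 := by
      refine MvPolynomial.derivation_ext fun x => ?_
      simp only [Derivation.commutator_apply, MvPolynomial.pderiv_X, Pi.single_apply]
      split_ifs <;> simp
    have h3 := DFunLike.congr_fun this g
    rw [Derivation.commutator_apply, hg' (N + 1) le_rfl, map_zero, sub_zero] at h3
    exact h3
  rw [← h1, hg] at h2
  have hf := hN (N + 1) (by omega) 0
  have h4 : (2 : DiffPoly) * f = 0 := by
    simpa [Derivation.leibniz, derivation_ofNat, hf, pow_two, mul_comm, two_mul] using h2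
  simpa using h4

theorem eq_zero_of_functional_pair {θ : Fin 3 → DiffPoly}
    (h : ∀ k, functional (pair θ k) = 0) : θ = 0 := by
  funext i
  refine eq_zero_of_functional_mul fun k => ?_
  have := h (Pi.single i k)
  simpa [pair, Pi.single_apply] using this

end DiffPoly

namespace DiffPoly

/-! ## The degree in the jets of the first field -/

/-- The substitution `∂ⁿQ₁ ↦ t ∂ⁿQ₁`. -/
def scaleFirst : DiffPoly →ₐ[ℝ] Polynomial DiffPoly :=
  MvPolynomial.aeval fun x =>
    if x.1 = 0 then Polynomial.C (MvPolynomial.X x) * Polynomial.X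
    else Polynomial.C (MvPolynomial.X x)

theorem scaleFirst_X (x : Fin 3 × ℕ) : scaleFirst (MvPolynomial.X x) =
    if x.1 = 0 then Polynomial.C (MvPolynomial.X x) * Polynomial.X
    else Polynomial.C (MvPolynomial.X x) :=
  MvPolynomial.aeval_X _ _

/-- Putting `t = 1` undoes the scaling, which gives injectivity and lets `degFirst` inherit
additivity on products from polynomials over a domain. -/
theorem scaleFirst_eval_one (f : DiffPoly) : (scaleFirst f).eval 1 = f := by
  have : ((Polynomial.aeval (1 : DiffPoly)).restrictScalars ℝ).comp scaleFirst =
      AlgHom.id ℝ DiffPoly := by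
    refine MvPolynomial.algHom_ext fun x => ?_
    simp only [scaleFirst, AlgHom.comp_apply, MvPolynomial.aeval_X]
    split_ifs <;> simp
  exact DFunLike.congr_fun this f

theorem scaleFirst_injective : Function.Injective scaleFirst := fun f g h => by
  rw [← scaleFirst_eval_one f, h, scaleFirst_eval_one]

/-- `tot` maps jets of `Q₁` to jets of `Q₁` and other jets to other jets, so it preserves the number
of factors of the first kind. -/
theorem scaleFirst_tot_coeff (f : DiffPoly) (n : ℕ) :
    (scaleFirst (tot f)).coeff n = tot ((scaleFirst f).coeff n) := by
  induction f using MvPolynomial.induction_on generalizing n with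
  | C a =>
    rw [MvPolynomial.derivation_C, map_zero, Polynomial.coeff_zero]
    simp only [scaleFirst, MvPolynomial.algHom_C, Polynomial.algebraMap_apply, Polynomial.coeff_C]
    split_ifs
    · exact (tot.map_algebraMap a).symm
    · exact (map_zero _).symm
  | add p q hp hq => simp only [map_add, Polynomial.coeff_add, hp, hq]
  | mul_X p x hp =>
    simp only [Derivation.leibniz, smul_eq_mul, map_add, map_mul, tot_X, Polynomial.coeff_add,
      scaleFirst_X]
    split_ifs with h
    · rw [← mul_assoc, mul_right_comm _ Polynomial.X, ← mul_assoc]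
      cases n with
      | zero => simp
      | succ n => simp [Polynomial.coeff_mul_C, Polynomial.coeff_mul_X, Polynomial.coeff_C_mul, hp]
    · simp [Polynomial.coeff_mul_C, Polynomial.coeff_C_mul, hp]

/-- The degree in the variables `∂ⁿQ₁`. -/
def degFirst (f : DiffPoly) : ℕ := (scaleFirst f).natDegree

theorem degFirst_mul {f g : DiffPoly} (hf : f ≠ 0) (hg : g ≠ 0) :
    degFirst (f * g) = degFirst f + degFirst g := by
  rw [degFirst, map_mul]
  exact Polynomial.natDegree_mul ((map_ne_zero_iff _ scaleFirst_injective).2 hf)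
    ((map_ne_zero_iff _ scaleFirst_injective).2 hg)

theorem degFirst_mul_le {f g : DiffPoly} {m n : ℕ} (hf : degFirst f ≤ m) (hg : degFirst g ≤ n) :
    degFirst (f * g) ≤ m + n := by
  rw [degFirst, map_mul]
  exact Polynomial.natDegree_mul_le_of_le hf hg

theorem degFirst_add_le {f g : DiffPoly} {n : ℕ} (hf : degFirst f ≤ n) (hg : degFirst g ≤ n) :
    degFirst (f + g) ≤ n := by
  rw [degFirst, map_add]
  exact Polynomial.natDegree_add_le_of_degree_le hf hg

theorem degFirst_neg (f : DiffPoly) : degFirst (-f) = degFirst f := by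
  rw [degFirst, map_neg, Polynomial.natDegree_neg, degFirst]

theorem degFirst_sub_le {f g : DiffPoly} {n : ℕ} (hf : degFirst f ≤ n) (hg : degFirst g ≤ n) :
    degFirst (f - g) ≤ n := by
  rw [sub_eq_add_neg]
  exact degFirst_add_le hf ((degFirst_neg g).trans_le hg)

theorem degFirst_tot_le {f : DiffPoly} {n : ℕ} (hf : degFirst f ≤ n) : degFirst (tot f) ≤ n := by
  refine Polynomial.natDegree_le_iff_coeff_eq_zero.2 fun m hm => ?_
  rw [scaleFirst_tot_coeff, Polynomial.coeff_eq_zero_of_natDegree_lt (hf.trans_lt hm), map_zero]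

theorem degFirst_Q_zero : degFirst (Q 0) = 1 := by
  have : scaleFirst (Q 0) = Polynomial.C (Q 0) * Polynomial.X := by
    simp [scaleFirst_X, Q]
  rw [degFirst, this]
  exact Polynomial.natDegree_C_mul_X _ (MvPolynomial.X_ne_zero _)

theorem degFirst_Q {i : Fin 3} (hi : i ≠ 0) : degFirst (Q i) = 0 := by
  have : scaleFirst (Q i) = Polynomial.C (Q i) := by
    simp [scaleFirst_X, Q, hi]
  rw [degFirst, this]
  exact Polynomial.natDegree_C _

theorem degFirst_Q_mul_le {i : Fin 3} (hi : i ≠ 0) {f : DiffPoly} {n : ℕ} (hf : degFirst f ≤ n) :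
    degFirst (Q i * f) ≤ n := by
  simpa using degFirst_mul_le (degFirst_Q hi).le hf

/-- Multiplication by `Q₁` raises the degree by exactly one, while `tot` and multiplication by the
other two fields do not raise it. Injectivity of `F'` and of its adjoint reduces to this count. -/
theorem eq_zero_of_Q_zero_mul_eq {f g : DiffPoly} (h : Q 0 * f = g)
    (hg : degFirst g ≤ degFirst f) : f = 0 := by
  by_contra hf
  have := degFirst_mul (show Q 0 ≠ 0 from MvPolynomial.X_ne_zero _) hf
  rw [h, degFirst_Q_zero] at this
  omega

/-- The first two components express `h 1` and `h 0` through `h 2`; the third then equates `Q 0 * h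
2` with terms of degree at most that of `h 2`. -/
theorem miuraD_injective {h : Fin 3 → DiffPoly} (hh : miuraD h = 0) : h = 0 := by
  have e0 := congrFun hh 0
  have e1 := congrFun hh 1
  have e2 := congrFun hh 2
  simp only [miuraD, miuraDeriv, Matrix.cons_val_zero, Matrix.cons_val_one, Matrix.cons_val,
    Pi.zero_apply] at e0 e1 e2
  have h1 : h 1 = -h 2 := by linear_combination -e0
  have h0 : h 0 = Q 1 * h 2 - Q 2 * h 2 + tot (h 2) := by
    rw [h1] at e1
    linear_combination -e1
  have h2 : h 2 = 0 := by
    refine eq_zero_of_Q_zero_mul_eq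
      (g := tot (tot (h 2)) + tot (Q 1 * h 2 - Q 2 * h 2) - Q 2 * h 0) ?_ ?_
    · have hc : h 1 * Q 2 + Q 1 * h 2 = Q 1 * h 2 - Q 2 * h 2 := by rw [h1]; ring
      rw [hc] at e2
      linear_combination e2
    · have a1 := degFirst_Q_mul_le (i := 1) (by decide) (le_refl (degFirst (h 2)))
      have a2 := degFirst_Q_mul_le (i := 2) (by decide) (le_refl (degFirst (h 2)))
      have a3 := degFirst_tot_le (le_refl (degFirst (h 2)))
      refine degFirst_sub_le (degFirst_add_le (degFirst_tot_le a3)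
        (degFirst_tot_le (degFirst_sub_le a1 a2))) (degFirst_Q_mul_le (by decide) ?_)
      rw [h0]
      exact degFirst_add_le (degFirst_sub_le a1 a2) a3
  funext i
  fin_cases i
  · simp [h0, h2]
  · simp [h1, h2]
  · exact h2

/-- The formal adjoint of `F'`. -/
def miuraAdj (ζ : Fin 3 → DiffPoly) : Fin 3 → DiffPoly :=
  ![-ζ 1 + Q 2 * ζ 2,
    -ζ 0 + Q 2 * ζ 1 + Q 2 * tot (ζ 2),
    -ζ 0 + Q 1 * ζ 1 - tot (ζ 1) + Q 0 * ζ 2 + Q 1 * tot (ζ 2) - tot (tot (ζ 2))]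

theorem isAdjointValue_miuraAdj (ζ : Fin 3 → DiffPoly) :
    IsAdjointValue miuraD ζ (miuraAdj ζ) := fun k => by
  refine ⟨-(ζ 1 * k 2) + ζ 2 * (k 1 * Q 2 + Q 1 * k 2) + ζ 2 * tot (k 2) - tot (ζ 2) * k 2, ?_⟩
  simp only [pair, Fin.sum_univ_three, miuraAdj, miuraD, miuraDeriv, Matrix.cons_val_zero,
    Matrix.cons_val_one, Matrix.cons_val, map_add, map_sub, map_neg, Derivation.leibniz,
    smul_eq_mul]
  ring

theorem IsAdjointValue.functional_pair {ζ θ : Fin 3 → DiffPoly} (h : IsAdjointValue miuraD ζ θ)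
    (k : Fin 3 → DiffPoly) : functional (pair θ k) = functional (pair ζ (miuraD k)) :=
  functionalEq_iff.1 (h k)

/-- The adjoint is defined only through its pairings, and nondegeneracy of the pairing makes it the
explicit differential operator. -/
theorem IsAdjointValue.eq_miuraAdj {ζ θ : Fin 3 → DiffPoly} (h : IsAdjointValue miuraD ζ θ) :
    θ = miuraAdj ζ := by
  rw [← sub_eq_zero]
  refine eq_zero_of_functional_pair fun k => ?_
  rw [pair_comm, pair_sub_right, map_sub, pair_comm, pair_comm k, h.functional_pair,
    (isAdjointValue_miuraAdj ζ).functional_pair, sub_self]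

theorem miuraAdj_sub (ζ ζ' : Fin 3 → DiffPoly) :
    miuraAdj (ζ - ζ') = miuraAdj ζ - miuraAdj ζ' := by
  funext i
  fin_cases i <;> simp [miuraAdj] <;> ring

/-- The same elimination and degree count as for `miuraD_injective`, on the transposed system. -/
theorem eq_zero_of_miuraAdj_eq_zero {ζ : Fin 3 → DiffPoly} (h : miuraAdj ζ = 0) : ζ = 0 := by
  have e0 := congrFun h 0
  have e1 := congrFun h 1
  have e2 := congrFun h 2
  simp only [miuraAdj, Matrix.cons_val_zero, Matrix.cons_val_one, Matrix.cons_val,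
    Pi.zero_apply] at e0 e1 e2
  have h1 : ζ 1 = Q 2 * ζ 2 := by linear_combination -e0
  have h0 : ζ 0 = Q 2 * ζ 1 + Q 2 * tot (ζ 2) := by linear_combination -e1
  have h2 : ζ 2 = 0 := by
    refine eq_zero_of_Q_zero_mul_eq
      (g := ζ 0 - Q 1 * ζ 1 + tot (ζ 1) - Q 1 * tot (ζ 2) + tot (tot (ζ 2))) ?_ ?_
    · linear_combination e2
    · have a3 := degFirst_tot_le (le_refl (degFirst (ζ 2)))
      have b1 : degFirst (ζ 1) ≤ degFirst (ζ 2) := by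
        rw [h1]; exact degFirst_Q_mul_le (by decide) le_rfl
      have b0 : degFirst (ζ 0) ≤ degFirst (ζ 2) := by
        rw [h0]
        exact degFirst_add_le (degFirst_Q_mul_le (by decide) b1) (degFirst_Q_mul_le (by decide) a3)
      exact degFirst_add_le (degFirst_sub_le (degFirst_add_le (degFirst_sub_le b0
        (degFirst_Q_mul_le (by decide) b1)) (degFirst_tot_le b1))
        (degFirst_Q_mul_le (by decide) a3)) (degFirst_tot_le a3)
  funext i
  fin_cases i
  · simp [h0, h1, h2]
  · simp [h1, h2]
  · exact h2

theorem IsAdjointValue.unique {ζ ζ' θ : Fin 3 → DiffPoly} (h : IsAdjointValue miuraD ζ θ)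
    (h' : IsAdjointValue miuraD ζ' θ) : ζ = ζ' := by
  rw [← sub_eq_zero]
  refine eq_zero_of_miuraAdj_eq_zero ?_
  rw [miuraAdj_sub, ← h.eq_miuraAdj, ← h'.eq_miuraAdj, sub_self]

theorem IsAdjointValue.linear {ζ ζ' θ θ' : Fin 3 → DiffPoly} (h : IsAdjointValue miuraD ζ θ)
    (h' : IsAdjointValue miuraD ζ' θ') (a b : ℝ) :
    IsAdjointValue miuraD (a • ζ + b • ζ') (a • θ + b • θ') := fun k => by
  rw [functionalEq_iff]
  simp only [pair_add_left, pair_smul_left, map_add, map_smul, h.functional_pair,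
    h'.functional_pair]

theorem miuraD_linear (h h' : Fin 3 → DiffPoly) (a b : ℝ) :
    miuraD (a • h + b • h') = a • miuraD h + b • miuraD h' := by
  have e : evol (a • h + b • h') = a • evol h + b • evol h' := by
    refine MvPolynomial.derivation_ext fun x => ?_
    have : ∀ (n : ℕ) (f g : DiffPoly), tot^[n] (a • f + b • g) = a • tot^[n] f + b • tot^[n] g := by
      intro n f g
      induction n with
      | zero => rfl
      | succ n ih =>
        simp only [Function.iterate_succ_apply', ih, map_add, Derivation.map_smul]
    simp [evol_X, this]
  funext i
  simp [miuraD_eq_evol, e]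

/-! ## The Jacobi identity -/

variable (α β : ℝ)

/-- The operator `α 𝒥₁ + β 𝒦₁` at the fields `F(Q₁, Q₂, Q₃)`. -/
def pencilOp : (Fin 3 → DiffPoly) → Fin 3 → DiffPoly := opPencil tot α β miuraField

theorem functional_pencilOp_skew (f g : Fin 3 → DiffPoly) :
    functional (pair f (pencilOp α β g)) = -functional (pair g (pencilOp α β f)) := by
  rw [eq_neg_iff_add_eq_zero, ← map_add, functional_eq_zero]
  exact opPencil_skew tot α β miuraField f g

theorem functional_opPencilLin (δ f g : Fin 3 → DiffPoly) :
    functional (pair f (opPencilLin tot α β miuraField δ g)) =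
      functional (pair (bracketPencil tot α β miuraField f g) δ) := by
  rw [← sub_eq_zero, ← map_sub, functional_eq_zero]
  exact bracketPencil_pairing tot α β miuraField δ f g

/-- Pairing everything with `ζ₂`: the second term becomes `-⟨ζ₂, P'[Pζ₁]ζ₃⟩` by antisymmetry of the
bracket, the third becomes `-⟨ζ₂, P[ζ₁, ζ₃]⟩` by skewness of `P`, and the bracket identity for `ζ₁,
ζ₃` makes the sum vanish. -/
theorem functional_opPencilLin_cyclic (ζ₁ ζ₂ ζ₃ : Fin 3 → DiffPoly) :
    functional (pair ζ₂ (opPencilLin tot α β miuraField (pencilOp α β ζ₃) ζ₁))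
      + functional (pair ζ₃ (opPencilLin tot α β miuraField (pencilOp α β ζ₁) ζ₂))
      + functional (pair ζ₁ (opPencilLin tot α β miuraField (pencilOp α β ζ₂) ζ₃)) = 0 := by
  rw [functional_opPencilLin _ _ (pencilOp α β ζ₁), bracketPencil_antisymm, pair_neg_left, map_neg,
    ← functional_opPencilLin, functional_opPencilLin _ _ (pencilOp α β ζ₂),
    functional_pencilOp_skew α β, ← sub_eq_add_neg, ← sub_eq_add_neg, ← map_sub, ← map_sub,
    ← pair_sub_right, ← pair_sub_right]
  have h := bracketPencil_identity tot α β miuraField ζ₁ ζ₃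
  have h' : opPencilLin tot α β miuraField (pencilOp α β ζ₃) ζ₁
      - opPencilLin tot α β miuraField (pencilOp α β ζ₁) ζ₃
      - pencilOp α β (bracketPencil tot α β miuraField ζ₁ ζ₃) = 0 := by
    rw [sub_eq_zero]; exact h
  rw [h']
  simp [pair]

/-- Transfers the Lie derivative to the fields `(u₁, v₁, w₁)`. One differentiates `⟨θ₂, h₃⟩ = ⟨ζ₂,
Pζ₃⟩` along `h₁` and subtracts `⟨θ₂, [h₁, h₃]⟩ = ⟨ζ₂, F'[h₁, h₃]⟩`; as `F'` is a derivative, `F'[h₁,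
h₃]` is the difference of the derivatives of `Pζ₃` along `h₁` and of `Pζ₁` along `h₃`. -/
theorem functional_lie (ζ₁ ζ₂ ζ₃ θ₂ h₁ h₃ : Fin 3 → DiffPoly)
    (hθ₂ : IsAdjointValue miuraD ζ₂ θ₂) (hh₁ : miuraD h₁ = pencilOp α β ζ₁)
    (hh₃ : miuraD h₃ = pencilOp α β ζ₃) :
    functional (pair (fun i => evol h₁ (θ₂ i)) h₃ + pair θ₂ (fun i => evol h₃ (h₁ i))) =
      functional (pair (fun i => evol h₁ (ζ₂ i)) (pencilOp α β ζ₃))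
      - functional (pair (fun i => evol h₃ (ζ₁ i)) (pencilOp α β ζ₂))
      + functional (pair ζ₂ (opPencilLin tot α β miuraField (pencilOp α β ζ₃) ζ₁)) := by
  have e1 := functional_evol h₁ (hθ₂.functional_pair h₃)
  rw [hh₃, evol_pair, evol_pair, map_add, map_add] at e1
  have e2 := hθ₂.functional_pair ((fun i => evol h₁ (h₃ i)) - fun i => evol h₃ (h₁ i))
  have e3 : miuraD ((fun i => evol h₁ (h₃ i)) - fun i => evol h₃ (h₁ i)) =
      (fun i => evol h₁ (pencilOp α β ζ₃ i)) - fun i => evol h₃ (pencilOp α β ζ₁ i) := by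
    funext i
    rw [miuraD_eq_evol, ← hh₁, ← hh₃, Pi.sub_apply, miuraD_eq_evol, miuraD_eq_evol]
    exact (evol_evol_sub h₁ h₃ _).symm
  have e4 : (fun i => evol h₃ (pencilOp α β ζ₁ i)) = pencilOp α β (fun i => evol h₃ (ζ₁ i))
      + opPencilLin tot α β miuraField (pencilOp α β ζ₃) ζ₁ := by
    have := derivation_opPencil tot (evol h₃) (evol_tot h₃) α β miuraField ζ₁
    rw [show (fun i => evol h₃ (miuraField i)) = pencilOp α β ζ₃ by
      rw [← hh₃]; funext i; exact (miuraD_eq_evol h₃ i).symm] at this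
    exact this
  rw [e3, e4] at e2
  simp only [pair_sub_right, pair_add_right, map_sub, map_add] at e2
  rw [functional_pencilOp_skew α β ζ₂] at e2
  rw [map_add]
  linear_combination (norm := module) e1 - e2

variable {α β}

/-- Single-valuedness, skewness and the Jacobi identity are inherited by any restriction of the
pulled-back operator. Restrictions are needed because `pencil` is defined only on the common domain
of its two operators. -/
theorem isHamiltonian_of_le {P : Operator}
    (hle : ∀ θ h, P θ h → miuraPullback (pencilOp α β) θ h)
    (add : ∀ θ₁ θ₂ h₁ h₂, P θ₁ h₁ → P θ₂ h₂ → P (θ₁ + θ₂) (h₁ + h₂))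
    (smul : ∀ (c : ℝ) (θ h), P θ h → P (c • θ) (c • h))
    (dense : ∀ k, (∀ θ h, P θ h → FunctionalEq (pair θ k) 0) → k = 0) : IsHamiltonian P where
  add := add
  smul := smul
  dense := dense
  single_valued θ h h' hp hp' := by
    obtain ⟨ζ, h1, h2⟩ := hle _ _ hp
    obtain ⟨ζ', h1', h2'⟩ := hle _ _ hp'
    obtain rfl := h1.unique h1'
    have := miuraD_linear h h' 1 (-1)
    rw [h2, h2'] at this
    have := miuraD_injective (this.trans (by module))
    rw [← sub_eq_zero, ← this]
    module
  skew θ₁ θ₂ h₁ h₂ hp₁ hp₂ := by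
    obtain ⟨ζ₁, a₁, b₁⟩ := hle _ _ hp₁
    obtain ⟨ζ₂, a₂, b₂⟩ := hle _ _ hp₂
    rw [functionalEq_iff, map_add, a₁.functional_pair, a₂.functional_pair, b₁, b₂,
      functional_pencilOp_skew, neg_add_cancel, map_zero]
  jacobi θ₁ θ₂ θ₃ h₁ h₂ h₃ hp₁ hp₂ hp₃ := by
    obtain ⟨ζ₁, a₁, b₁⟩ := hle _ _ hp₁
    obtain ⟨ζ₂, a₂, b₂⟩ := hle _ _ hp₂
    obtain ⟨ζ₃, a₃, b₃⟩ := hle _ _ hp₃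
    -- In the cyclic sum the derivatives of the covectors `ζᵢ` cancel in pairs, leaving the cyclic
    -- sum of the linearizations.
    rw [functionalEq_iff, map_zero, map_add, map_add, functional_lie α β ζ₁ ζ₂ ζ₃ _ _ _ a₂ b₁ b₃,
      functional_lie α β ζ₂ ζ₃ ζ₁ _ _ _ a₃ b₂ b₁, functional_lie α β ζ₃ ζ₁ ζ₂ _ _ _ a₁ b₃ b₂,
      ← functional_opPencilLin_cyclic α β ζ₁ ζ₂ ζ₃]
    abel

end DiffPoly

namespace DiffPoly

/-! ## The domain of `𝒥₂` -/

/-- The coefficient of `h₃` in the solvability condition of `F' h = 𝒥₁ ζ`. -/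
def obstruction : DiffPoly := Q 0 + Q 2 * (Q 1 - Q 2) - tot (Q 2)

theorem degFirst_obstruction_le : degFirst obstruction ≤ 1 :=
  degFirst_sub_le (degFirst_add_le degFirst_Q_zero.le (degFirst_Q_mul_le (by decide)
    (degFirst_sub_le ((degFirst_Q (by decide)).le.trans zero_le_one)
      ((degFirst_Q (by decide)).le.trans zero_le_one))))
    (degFirst_tot_le ((degFirst_Q (by decide)).le.trans zero_le_one))

theorem degFirst_obstruction : degFirst obstruction = 1 := by
  refine le_antisymm degFirst_obstruction_le ?_
  have h : degFirst (Q 2 * (Q 1 - Q 2) - tot (Q 2)) ≤ 0 :=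
    degFirst_sub_le (degFirst_Q_mul_le (by decide) (degFirst_sub_le (degFirst_Q (by decide)).le
      (degFirst_Q (by decide)).le)) (degFirst_tot_le (degFirst_Q (by decide)).le)
  by_contra hlt
  have h2 : degFirst (Q 0) ≤ 0 := by
    have : Q 0 = obstruction - (Q 2 * (Q 1 - Q 2) - tot (Q 2)) := by rw [obstruction]; ring
    rw [this]
    exact degFirst_sub_le (by omega) h
  rw [degFirst_Q_zero] at h2
  omega

theorem obstruction_ne_zero : obstruction ≠ 0 := fun h => by
  have := degFirst_obstruction
  rw [h] at this
  simp [degFirst] at this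

/-- With `ζ 1 = 2b`, `ζ 2 = 2c` and `h 2 = 2s` chosen freely, the first two components of `F' h = 𝒥₁
ζ` give `h 1` and `h 0`. The third prescribes `tot (ζ 0)`: its exact part is integrated by hand, and
`p` is a primitive of what remains. -/
theorem exists_miuraD_eq_opJ₁ {s b c p : DiffPoly}
    (hp : tot p = obstruction * s + 2 * tot (Q 2) * b
      - (tot (tot (Q 2)) + tot (Q 2 * (Q 1 - Q 2))) * c) :
    ∃ h, miuraD h = opJ₁ tot miuraField
      ![p + Q 2 * s - 2 * Q 2 * b - Q 2 * tot c + tot (Q 2) * c + Q 2 * (Q 1 - Q 2) * c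
          - ((Q 1 - Q 2) * s - 2 * Q 2 * tot c + tot s) + tot b + (Q 1 + Q 2) * b,
        2 * b, 2 * c] := by
  refine ⟨![2 * ((Q 1 - Q 2) * s + tot s - 2 * tot b - tot (tot c) + (Q 1 - Q 2) * tot c),
    2 * (-2 * tot c - s), 2 * s], ?_⟩
  funext i
  fin_cases i
  · simp only [miuraD, miuraDeriv, opJ₁, miuraField, miura, Fin.zero_eta, Matrix.cons_val_zero,
      Matrix.cons_val_one, Matrix.cons_val, Derivation.leibniz, derivation_ofNat, smul_eq_mul]
    ring
  · simp only [miuraD, miuraDeriv, opJ₁, miuraField, miura, Fin.mk_one, Matrix.cons_val_zero,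
      Matrix.cons_val_one, Matrix.cons_val, Derivation.leibniz, derivation_ofNat, smul_eq_mul,
      map_add, map_sub, map_neg, mul_zero, add_zero, neg_zero]
    ring
  · simp only [miuraD, miuraDeriv, opJ₁, miuraField, miura, Fin.reduceFinMk, Matrix.cons_val_zero,
      Matrix.cons_val_one, Matrix.cons_val, Derivation.leibniz, derivation_ofNat, smul_eq_mul,
      map_add, map_sub, map_neg, mul_zero, add_zero, neg_zero, hp, obstruction]
    ring

/-- Orthogonality to the family `θ = F'†ζ` from `exists_miuraD_eq_opJ₁` gives `⟨ζ, F' k⟩ = 0`. The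
parameters are chosen so that the required primitive exists, and they still contain an arbitrary
factor `l`; this forces the components of `F' k` to vanish in turn. -/
theorem eq_zero_of_orthogonal_opJ₂ {k : Fin 3 → DiffPoly}
    (hk : ∀ θ h, opJ₂ θ h → FunctionalEq (pair θ k) 0) : k = 0 := by
  have test : ∀ s b c p : DiffPoly, tot p = obstruction * s + 2 * tot (Q 2) * b
      - (tot (tot (Q 2)) + tot (Q 2 * (Q 1 - Q 2))) * c →
      functional ((p + Q 2 * s - 2 * Q 2 * b - Q 2 * tot c + tot (Q 2) * c + Q 2 * (Q 1 - Q 2) * c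
          - ((Q 1 - Q 2) * s - 2 * Q 2 * tot c + tot s) + tot b + (Q 1 + Q 2) * b) * miuraD k 0
        + 2 * b * miuraD k 1 + 2 * c * miuraD k 2) = 0 := by
    intro s b c p hp
    obtain ⟨h, hh⟩ := exists_miuraD_eq_opJ₁ hp
    have h1 := functionalEq_iff.1 (hk _ h ⟨_, isAdjointValue_miuraAdj _, hh⟩)
    rw [(isAdjointValue_miuraAdj _).functional_pair, map_zero] at h1
    rw [← h1]
    simp [pair, Fin.sum_univ_three]
  have hm0 : miuraD k 0 = 0 := by
    set x := miuraD k 0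
    set y := tot x + (2 * Q 2 - Q 1) * x with hy
    -- Write `ω` for `obstruction` and `'` for `tot`. The choice `s = 2lω' + l'ω` makes `ωs =
    -- (lω²)'` exact. Moving derivatives off `s` turns the test into `⟨s, y⟩ + ⟨lω², x⟩ = 0`, and
    -- then those off `l` give this equation.
    have hxy : 2 * tot obstruction * y - tot (obstruction * y) + obstruction ^ 2 * x = 0 := by
      refine eq_zero_of_functional_mul fun l => ?_
      have h1 := test (2 * l * tot obstruction + tot l * obstruction) 0 0 (l * obstruction ^ 2) (by
        simp only [Derivation.leibniz, Derivation.leibniz_pow, smul_eq_mul, nsmul_eq_mul]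
        push_cast
        ring)
      rw [← h1, ← sub_eq_zero, ← map_sub, functional_eq_zero]
      refine ⟨(2 * l * tot obstruction + tot l * obstruction) * x - l * obstruction * y, ?_⟩
      simp only [hy, Derivation.leibniz, derivation_ofNat, smul_eq_mul, map_add, map_sub, map_zero]
      ring
    by_contra hx
    -- The left side has degree two more than `x` in the jets of `Q₁`, the right side at most one
    -- more.
    have e : obstruction * (obstruction * x) =
        obstruction * tot y - tot obstruction * y := by
      rw [Derivation.leibniz] at hxy
      simp only [smul_eq_mul] at hxy
      linear_combination hxy
    have d1 := degFirst_mul obstruction_ne_zero (mul_ne_zero obstruction_ne_zero hx)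
    rw [degFirst_mul obstruction_ne_zero hx, degFirst_obstruction, e] at d1
    have d2 : degFirst y ≤ degFirst x := by
      refine degFirst_add_le (degFirst_tot_le le_rfl) ?_
      have : (2 * Q 2 - Q 1) * x = Q 2 * x + Q 2 * x - Q 1 * x := by ring
      rw [this]
      exact degFirst_sub_le (degFirst_add_le (degFirst_Q_mul_le (by decide) le_rfl)
        (degFirst_Q_mul_le (by decide) le_rfl)) (degFirst_Q_mul_le (by decide) le_rfl)
    have d3 : degFirst (obstruction * tot y - tot obstruction * y) ≤ 1 + degFirst x :=
      degFirst_sub_le (degFirst_mul_le degFirst_obstruction_le (degFirst_tot_le d2))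
        (degFirst_mul_le (degFirst_tot_le degFirst_obstruction_le) d2)
    omega
  have hm1 : miuraD k 1 = 0 := by
    refine (mul_eq_zero.1 (eq_zero_of_functional_mul (f := obstruction * miuraD k 1)
      fun l => ?_)).resolve_left obstruction_ne_zero
    -- Here `s` and `b` cancel in the solvability condition, so `p = 0` will do; the first component
    -- of `F' k` is already known to vanish.
    have h1 := test (2 * tot (Q 2) * l) (-(obstruction * l)) 0 0 (by rw [map_zero]; ring)
    rw [hm0, mul_zero, zero_add, mul_zero, zero_mul, add_zero,
      show 2 * -(obstruction * l) * miuraD k 1 = (-2 : ℝ) • (obstruction * miuraD k 1 * l) by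
        rw [neg_smul, ofNat_smul_eq_nsmul, nsmul_eq_mul]; push_cast; ring, map_smul] at h1
    exact (smul_eq_zero.1 h1).resolve_left (by norm_num)
  have hm2 : miuraD k 2 = 0 := by
    refine (mul_eq_zero.1 (eq_zero_of_functional_mul (f := obstruction * miuraD k 2)
      fun l => ?_)).resolve_left obstruction_ne_zero
    have h1 := test ((tot (tot (Q 2)) + tot (Q 2 * (Q 1 - Q 2))) * l) 0 (obstruction * l) 0
      (by rw [map_zero]; ring)
    rw [hm0, mul_zero, zero_add, mul_zero, zero_mul, zero_add,
      show 2 * (obstruction * l) * miuraD k 2 = (2 : ℝ) • (obstruction * miuraD k 2 * l) by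
        rw [ofNat_smul_eq_nsmul, nsmul_eq_mul]; push_cast; ring, map_smul] at h1
    exact (smul_eq_zero.1 h1).resolve_left (by norm_num)
  refine miuraD_injective ?_
  funext i
  fin_cases i
  exacts [hm0, hm1, hm2]

/-! ## The Hamiltonian pair -/

/-- The differential operator `𝒦₂`. -/
def localK₂ (θ : Fin 3 → DiffPoly) : Fin 3 → DiffPoly :=
  ![tot (tot (θ 2)) - Q 1 * tot (θ 2) + tot (tot (θ 1)) - Q 1 * tot (θ 1) - 2 * Q 0 * tot (θ 0)
      - tot (Q 0) * θ 0,
    tot (2 * θ 2 + 2 * θ 1 - tot (θ 0) - Q 1 * θ 0),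
    tot (2 * θ 1 - tot (θ 0) - Q 1 * θ 0)]

/-- The factorization `𝒦₁ = F' 𝒦₂ F'†` with a local `𝒦₂`: no integration is needed to solve `F' h =
𝒦₁ ζ`. -/
theorem miuraD_localK₂ (ζ : Fin 3 → DiffPoly) :
    miuraD (localK₂ (miuraAdj ζ)) = opK₁ tot miuraField ζ := by
  funext i
  fin_cases i <;>
  simp only [miuraD, miuraDeriv, opK₁, chi₁, negAdjChi₁, chi₂, miuraField, miura, localK₂, miuraAdj,
    Fin.zero_eta, Fin.mk_one, Fin.reduceFinMk, Matrix.cons_val_zero, Matrix.cons_val_one,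
    Matrix.cons_val, Derivation.leibniz, derivation_ofNat, smul_eq_mul,
    map_add, map_sub, map_neg, mul_zero, add_zero, neg_zero] <;>
  ring

theorem exists_opK₂_of_opJ₂ {θ h : Fin 3 → DiffPoly} (hJ : opJ₂ θ h) : ∃ h', opK₂ θ h' := by
  obtain ⟨ζ, hζ, -⟩ := hJ
  refine ⟨localK₂ θ, ζ, hζ, ?_⟩
  rw [hζ.eq_miuraAdj, miuraD_localK₂]

theorem pencilOp_one_zero : pencilOp 1 0 = opJ₁ tot miuraField := by
  funext f
  simp [pencilOp, opPencil]

theorem pencilOp_zero_one : pencilOp 0 1 = opK₁ tot miuraField := by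
  funext f
  simp [pencilOp, opPencil]

theorem miuraPullback_linear {α β : ℝ} {θ θ' h h' : Fin 3 → DiffPoly} (a b : ℝ)
    (hP : miuraPullback (pencilOp α β) θ h) (hP' : miuraPullback (pencilOp α β) θ' h') :
    miuraPullback (pencilOp α β) (a • θ + b • θ') (a • h + b • h') := by
  obtain ⟨ζ, h1, h2⟩ := hP
  obtain ⟨ζ', h1', h2'⟩ := hP'
  refine ⟨a • ζ + b • ζ', h1.linear h1' a b, ?_⟩
  rw [miuraD_linear, h2, h2', pencilOp, opPencil_linear]

theorem opJ₂_linear {θ θ' h h' : Fin 3 → DiffPoly} (a b : ℝ) (hP : opJ₂ θ h) (hP' : opJ₂ θ' h') :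
    opJ₂ (a • θ + b • θ') (a • h + b • h') := by
  rw [opJ₂, ← pencilOp_one_zero] at *
  exact miuraPullback_linear a b hP hP'

theorem opK₂_linear {θ θ' h h' : Fin 3 → DiffPoly} (a b : ℝ) (hP : opK₂ θ h) (hP' : opK₂ θ' h') :
    opK₂ (a • θ + b • θ') (a • h + b • h') := by
  rw [opK₂, ← pencilOp_zero_one] at *
  exact miuraPullback_linear a b hP hP'

/-- The two summands use the same `ζ`, because `F'†` is injective. -/
theorem pencil_le_miuraPullback {α β : ℝ} {θ h : Fin 3 → DiffPoly} (hP : pencil α β opJ₂ opK₂ θ h) :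
    miuraPullback (pencilOp α β) θ h := by
  obtain ⟨k, k', ⟨ζ, h1, h2⟩, ⟨ζ', h1', h2'⟩, rfl⟩ := hP
  obtain rfl := h1.unique h1'
  exact ⟨ζ, h1, by rw [miuraD_linear, h2, h2']; rfl⟩

/-- An operator defined at least where `𝒥₂` is defined inherits the vanishing annihilator of the
domain of `𝒥₂`. -/
theorem isHamiltonian_of_linear {α β : ℝ} {P : Operator}
    (hle : ∀ θ h, P θ h → miuraPullback (pencilOp α β) θ h)
    (hlin : ∀ (a b : ℝ) {θ θ' h h' : Fin 3 → DiffPoly}, P θ h → P θ' h' →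
      P (a • θ + b • θ') (a • h + b • h'))
    (hdom : ∀ θ h, opJ₂ θ h → ∃ h', P θ h') : IsHamiltonian P := by
  refine isHamiltonian_of_le hle (fun θ₁ θ₂ h₁ h₂ p₁ p₂ => ?_) (fun c θ h p => ?_) fun k hk => ?_
  · simpa using hlin 1 1 p₁ p₂
  · simpa using hlin c 0 p p
  · refine eq_zero_of_orthogonal_opJ₂ fun θ h hJ => ?_
    obtain ⟨h', hP⟩ := hdom θ h hJ
    exact hk θ h' hP

theorem isHamiltonianPair : IsHamiltonianPair opJ₂ opK₂ := by
  refine ⟨?_, ?_, fun α β => ?_⟩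
  · refine isHamiltonian_of_linear (α := 1) (β := 0) (fun θ h hP => ?_)
      (fun a b _ _ _ _ => opJ₂_linear a b) fun θ h hJ => ⟨h, hJ⟩
    rwa [pencilOp_one_zero]
  · refine isHamiltonian_of_linear (α := 0) (β := 1) (fun θ h hP => ?_)
      (fun a b _ _ _ _ => opK₂_linear a b) fun θ h => exists_opK₂_of_opJ₂
    rwa [pencilOp_zero_one]
  · refine isHamiltonian_of_linear (α := α) (β := β) (fun θ h => pencil_le_miuraPullback)
      ?_ fun θ h hJ => ?_
    · rintro a b θ θ' h h' ⟨k, l, hk, hl, rfl⟩ ⟨k', l', hk', hl', rfl⟩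
      exact ⟨_, _, opJ₂_linear a b hk hk', opK₂_linear a b hl hl', by module⟩
    · obtain ⟨h', hK⟩ := exists_opK₂_of_opJ₂ hJ
      exact ⟨_, h, h', hJ, hK, rfl⟩

end DiffPoly

/-! ## Calculus of two variables -/

section Calculus

variable {E : Type*} [NormedAddCommGroup E] [NormedSpace ℝ E]

theorem hasDerivAt_fst {f : ℝ × ℝ → E} {z : ℝ × ℝ} (hf : DifferentiableAt ℝ f z) :
    HasDerivAt (fun s => f (s, z.2)) (fderiv ℝ f z (1, 0)) z.1 :=
  hf.hasFDerivAt.comp_hasDerivAt (f := fun s => (s, z.2)) z.1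
    ((hasDerivAt_id z.1).prodMk (hasDerivAt_const z.1 z.2))

theorem hasDerivAt_snd {f : ℝ × ℝ → E} {z : ℝ × ℝ} (hf : DifferentiableAt ℝ f z) :
    HasDerivAt (fun s => f (z.1, s)) (fderiv ℝ f z (0, 1)) z.2 :=
  hf.hasFDerivAt.comp_hasDerivAt (f := fun s => (z.1, s)) z.2
    ((hasDerivAt_const z.2 z.1).prodMk (hasDerivAt_id z.2))

theorem pd1_eq_fderiv {f : ℝ × ℝ → E} {z : ℝ × ℝ} (hf : DifferentiableAt ℝ f z) :
    pd1 f z = fderiv ℝ f z (1, 0) :=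
  (hasDerivAt_fst hf).deriv

theorem pd2_eq_fderiv {f : ℝ × ℝ → E} {z : ℝ × ℝ} (hf : DifferentiableAt ℝ f z) :
    pd2 f z = fderiv ℝ f z (0, 1) :=
  (hasDerivAt_snd hf).deriv

theorem hasDerivAt_pd1 {f : ℝ × ℝ → E} {z : ℝ × ℝ} (hf : DifferentiableAt ℝ f z) :
    HasDerivAt (fun s => f (s, z.2)) (pd1 f z) z.1 := by
  rw [pd1_eq_fderiv hf]; exact hasDerivAt_fst hf

theorem hasDerivAt_pd2 {f : ℝ × ℝ → E} {z : ℝ × ℝ} (hf : DifferentiableAt ℝ f z) :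
    HasDerivAt (fun s => f (z.1, s)) (pd2 f z) z.2 := by
  rw [pd2_eq_fderiv hf]; exact hasDerivAt_snd hf

theorem fderiv_apply_eq {f : ℝ × ℝ → E} {z : ℝ × ℝ} (hf : DifferentiableAt ℝ f z) (a b : ℝ) :
    fderiv ℝ f z (a, b) = a • pd1 f z + b • pd2 f z := by
  rw [pd1_eq_fderiv hf, pd2_eq_fderiv hf, ← map_smul, ← map_smul, ← map_add]
  simp

theorem pd1_congr {f g : ℝ × ℝ → E} {D : Set (ℝ × ℝ)} (hD : IsOpen D) (h : Set.EqOn f g D)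
    {z : ℝ × ℝ} (hz : z ∈ D) : pd1 f z = pd1 g z := by
  refine Filter.EventuallyEq.deriv_eq ?_
  have hc : ContinuousAt (fun s : ℝ => (s, z.2)) z.1 := by fun_prop
  exact (hc.eventually (hD.mem_nhds hz)).mono fun s hs => h hs

theorem pd2_congr {f g : ℝ × ℝ → E} {D : Set (ℝ × ℝ)} (hD : IsOpen D) (h : Set.EqOn f g D)
    {z : ℝ × ℝ} (hz : z ∈ D) : pd2 f z = pd2 g z := by
  refine Filter.EventuallyEq.deriv_eq ?_
  have hc : ContinuousAt (fun s : ℝ => (z.1, s)) z.2 := by fun_prop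
  exact (hc.eventually (hD.mem_nhds hz)).mono fun s hs => h hs

theorem _root_.ContDiffOn.differentiableAt_of_isOpen {f : ℝ × ℝ → E} {D : Set (ℝ × ℝ)}
    (hf : ContDiffOn ℝ ∞ f D) (hD : IsOpen D) {z : ℝ × ℝ} (hz : z ∈ D) : DifferentiableAt ℝ f z :=
  (hf.contDiffAt (hD.mem_nhds hz)).differentiableAt (by simp)

theorem contDiffOn_pd1 {f : ℝ × ℝ → E} {D : Set (ℝ × ℝ)} (hD : IsOpen D)
    (hf : ContDiffOn ℝ ∞ f D) : ContDiffOn ℝ ∞ (pd1 f) D :=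
  ((hf.fderiv_of_isOpen hD (m := ∞) (by simp)).clm_apply contDiffOn_const).congr fun _ hz =>
    pd1_eq_fderiv (hf.differentiableAt_of_isOpen hD hz)

theorem contDiffOn_pd2 {f : ℝ × ℝ → E} {D : Set (ℝ × ℝ)} (hD : IsOpen D)
    (hf : ContDiffOn ℝ ∞ f D) : ContDiffOn ℝ ∞ (pd2 f) D :=
  ((hf.fderiv_of_isOpen hD (m := ∞) (by simp)).clm_apply contDiffOn_const).congr fun _ hz =>
    pd2_eq_fderiv (hf.differentiableAt_of_isOpen hD hz)

theorem pd2_pd1 {f : ℝ × ℝ → E} {D : Set (ℝ × ℝ)} (hD : IsOpen D) (hf : ContDiffOn ℝ ∞ f D)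
    {z : ℝ × ℝ} (hz : z ∈ D) : pd2 (pd1 f) z = pd1 (pd2 f) z := by
  have h1 : Set.EqOn (pd1 f) (fun z => fderiv ℝ f z (1, 0)) D := fun z hz =>
    pd1_eq_fderiv (hf.differentiableAt_of_isOpen hD hz)
  have h2 : Set.EqOn (pd2 f) (fun z => fderiv ℝ f z (0, 1)) D := fun z hz =>
    pd2_eq_fderiv (hf.differentiableAt_of_isOpen hD hz)
  have h3 : DifferentiableAt ℝ (fderiv ℝ f) z :=
    (hf.fderiv_of_isOpen hD (m := ∞) (by simp)).differentiableAt_of_isOpen hD hz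
  have hsymm : IsSymmSndFDerivAt ℝ f z :=
    (hf.contDiffAt (hD.mem_nhds hz)).isSymmSndFDerivAt (by
      simp only [minSmoothness_of_isRCLikeNormedField]
      exact WithTop.coe_le_coe.2 (le_top : (2 : ℕ∞) ≤ ⊤))
  rw [pd2_congr hD h1 hz, pd1_congr hD h2 hz,
    pd2_eq_fderiv (h3.clm_apply (differentiableAt_const _)),
    pd1_eq_fderiv (h3.clm_apply (differentiableAt_const _)),
    fderiv_clm_apply h3 (differentiableAt_const _), fderiv_clm_apply h3 (differentiableAt_const _)]
  simpa using hsymm (0, 1) (1, 0)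

end Calculus

/-! ## The differential ring of smooth functions on an open set -/

/-- The algebra of functions on `D` which are smooth on the set `D`. -/
def SmoothFun (D : Set (ℝ × ℝ)) : Subalgebra ℝ (D → ℝ) where
  carrier := {f | ∃ g : ℝ × ℝ → ℝ, ContDiffOn ℝ ∞ g D ∧ ∀ z : D, g z = f z}
  mul_mem' := by
    rintro f g ⟨f', hf, hf'⟩ ⟨g', hg, hg'⟩
    exact ⟨fun z => f' z * g' z, hf.mul hg, fun z => by simp [hf', hg']⟩
  add_mem' := by
    rintro f g ⟨f', hf, hf'⟩ ⟨g', hg, hg'⟩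
    exact ⟨fun z => f' z + g' z, hf.add hg, fun z => by simp [hf', hg']⟩
  algebraMap_mem' c := ⟨fun _ => c, contDiffOn_const, fun _ => rfl⟩

namespace SmoothFun

variable {D : Set (ℝ × ℝ)}

/-- An extension of a smooth function on `D` to the plane. -/
def extend (F : SmoothFun D) : ℝ × ℝ → ℝ := F.2.choose

theorem contDiffOn_extend (F : SmoothFun D) : ContDiffOn ℝ ∞ (extend F) D := F.2.choose_spec.1

theorem extend_apply (F : SmoothFun D) (z : D) : (extend F) z = F.1 z := F.2.choose_spec.2 z

/-- The smooth function on `D` given by a function on the plane. -/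
def mk (f : ℝ × ℝ → ℝ) (hf : ContDiffOn ℝ ∞ f D) : SmoothFun D :=
  ⟨fun z => f z, f, hf, fun _ => rfl⟩

/-- Evaluation at a point. -/
def eval (z : D) : SmoothFun D →ₐ[ℝ] ℝ := (Pi.evalAlgHom ℝ (fun _ : D => ℝ) z).comp
    (SmoothFun D).val

theorem eval_apply (z : D) (F : SmoothFun D) : eval z F = F.1 z := rfl

@[simp]
theorem eval_mk (z : D) (f : ℝ × ℝ → ℝ) (hf : ContDiffOn ℝ ∞ f D) : eval z (mk f hf) = f z := rfl

theorem eq_of_eval {F G : SmoothFun D} (h : ∀ z, eval z F = eval z G) : F = G :=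
  Subtype.ext (funext h)

variable (hD : IsOpen D)

/-- A derivation of the ring of smooth functions, from a family of tangent vectors. -/
def mkDerivation (L : (ℝ × ℝ → ℝ) → ℝ × ℝ → ℝ) (v : ℝ × ℝ)
    (hL : ∀ f, ContDiffOn ℝ ∞ f D → ∀ z ∈ D, L f z = fderiv ℝ f z v)
    (hL' : ∀ f, ContDiffOn ℝ ∞ f D → ContDiffOn ℝ ∞ (L f) D) :
    Derivation ℝ (SmoothFun D) (SmoothFun D) :=
  -- The chosen extension is arbitrary off `D`; since `D` is open, derivatives at points of `D` do
  -- not see the choice.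
  have hext : ∀ (F : SmoothFun D) (f : ℝ × ℝ → ℝ), (∀ z : D, f z = F.1 z) → ∀ z ∈ D,
      fderiv ℝ (extend F) z v = fderiv ℝ f z v := fun F f hf z hz => by
    have : (extend F) =ᶠ[nhds z] f := Filter.eventuallyEq_of_mem (hD.mem_nhds hz) fun w hw => by
      rw [extend_apply F ⟨w, hw⟩, ← hf ⟨w, hw⟩]
    rw [this.fderiv_eq]
  have hd : ∀ F : SmoothFun D, ∀ z ∈ D, DifferentiableAt ℝ (extend F) z := fun F _ hz =>
    (contDiffOn_extend F).differentiableAt_of_isOpen hD hz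
  Derivation.mk'
    { toFun := fun F => mk (L (extend F)) (hL' _ (contDiffOn_extend F))
      map_add' := fun F G => eq_of_eval fun z => by
        simp only [map_add, eval_mk, hL _ (contDiffOn_extend _) z z.2]
        rw [hext (F + G) ((extend F) + (extend G)) (fun w => by
          simp [extend_apply]) z z.2, fderiv_add (hd F z z.2) (hd G z z.2)]
        rfl
      map_smul' := fun c F => eq_of_eval fun z => by
        simp only [map_smul, eval_mk, hL _ (contDiffOn_extend _) z z.2, RingHom.id_apply]
        rw [hext (c • F) (c • (extend F)) (fun w => by
          simp [extend_apply]) z z.2, fderiv_const_smul (hd F z z.2)]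
        rfl }
    fun F G => eq_of_eval fun z => by
      simp only [LinearMap.coe_mk, AddHom.coe_mk, map_add, map_mul, smul_eq_mul, eval_mk,
        hL _ (contDiffOn_extend _) z z.2]
      rw [hext (F * G) ((extend F) * (extend G)) (fun w => by
        simp [extend_apply]) z z.2, fderiv_mul (hd F z z.2) (hd G z z.2)]
      simp [eval_apply, extend_apply]

/-- The derivation `∂₁`. -/
def d1 : Derivation ℝ (SmoothFun D) (SmoothFun D) :=
  mkDerivation hD pd1 (1, 0) (fun _ hf _ hz => pd1_eq_fderiv (hf.differentiableAt_of_isOpen hD hz))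
    fun _ => contDiffOn_pd1 hD

/-- The derivation `∂₂`. -/
def d2 : Derivation ℝ (SmoothFun D) (SmoothFun D) :=
  mkDerivation hD pd2 (0, 1) (fun _ hf _ hz => pd2_eq_fderiv (hf.differentiableAt_of_isOpen hD hz))
    fun _ => contDiffOn_pd2 hD

theorem eval_d1 (F : SmoothFun D) (z : D) : eval z (d1 hD F) = pd1 (extend F) z := rfl

theorem eval_d2 (F : SmoothFun D) (z : D) : eval z (d2 hD F) = pd2 (extend F) z := rfl

theorem eqOn_extend {F : SmoothFun D} {f : ℝ × ℝ → ℝ} (h : ∀ z : D, f z = eval z F) :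
    Set.EqOn (extend F) f D := fun z hz => by
  rw [extend_apply F ⟨z, hz⟩, h ⟨z, hz⟩, eval_apply]

theorem d2_d1 (F : SmoothFun D) : d2 hD (d1 hD F) = d1 hD (d2 hD F) := by
  refine eq_of_eval fun z => ?_
  rw [eval_d2, eval_d1, pd2_congr hD (eqOn_extend (F := d1 hD F) fun w =>
      (eval_d1 hD F w).symm) z.2,
    pd1_congr hD (eqOn_extend (F := d2 hD F) fun w => (eval_d2 hD F w).symm) z.2,
    pd2_pd1 hD (contDiffOn_extend F) z.2]

end SmoothFun

/-! ## Representation of functions by elements of a differential ring -/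

/-- The function `f`, smooth on `D`, is represented through the parametrization `Ψ` of `D` by the
element `F` of the ring of smooth functions on `Ω`. -/
structure Rep {Ω : Set (ℝ × ℝ)} (D : Set (ℝ × ℝ)) (Ψ : ℝ × ℝ → ℝ × ℝ) (f : ℝ × ℝ → ℝ)
    (F : SmoothFun Ω) : Prop where
  smooth : ContDiffOn ℝ ∞ f D
  eval : ∀ z : Ω, f (Ψ z) = SmoothFun.eval z F

namespace Rep

variable {Ω D : Set (ℝ × ℝ)} {Ψ : ℝ × ℝ → ℝ × ℝ} {f g : ℝ × ℝ → ℝ} {F G : SmoothFun Ω}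

theorem add (hf : Rep D Ψ f F) (hg : Rep D Ψ g G) : Rep D Ψ (f + g) (F + G) :=
  ⟨hf.1.add hg.1, fun z => by rw [Pi.add_apply, hf.2, hg.2, map_add]⟩

theorem sub (hf : Rep D Ψ f F) (hg : Rep D Ψ g G) : Rep D Ψ (f - g) (F - G) :=
  ⟨hf.1.sub hg.1, fun z => by rw [Pi.sub_apply, hf.2, hg.2, map_sub]⟩

theorem mul (hf : Rep D Ψ f F) (hg : Rep D Ψ g G) : Rep D Ψ (f * g) (F * G) :=
  ⟨hf.1.mul hg.1, fun z => by rw [Pi.mul_apply, hf.2, hg.2, map_mul]⟩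

theorem neg (hf : Rep D Ψ f F) : Rep D Ψ (-f) (-F) :=
  ⟨hf.1.neg, fun z => by rw [Pi.neg_apply, hf.2, map_neg]⟩

theorem zero : Rep D Ψ 0 (0 : SmoothFun Ω) :=
  ⟨contDiffOn_const, fun z => by rw [map_zero, Pi.zero_apply]⟩

theorem one : Rep D Ψ 1 (1 : SmoothFun Ω) :=
  ⟨contDiffOn_const, fun z => by rw [map_one, Pi.one_apply]⟩

theorem ofNat (n : ℕ) [n.AtLeastTwo] : Rep D Ψ ofNat(n) (ofNat(n) : SmoothFun Ω) :=
  ⟨contDiffOn_const, fun z => by rw [map_ofNat]; rfl⟩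

theorem smul (c : ℝ) (hf : Rep D Ψ f F) : Rep D Ψ (c • f) (c • F) :=
  ⟨contDiffOn_const.smul hf.1, fun z => by rw [Pi.smul_apply, hf.2, map_smul]⟩

theorem congr_fun (hf : Rep D Ψ f F) (hg : ∀ z, g z = f z) : Rep D Ψ g F := by
  rwa [show g = f from funext hg]

theorem pd1_id (hD : IsOpen Ω) (hf : Rep Ω id f F) : Rep Ω id (pd1 f) (SmoothFun.d1 hD F) :=
  ⟨contDiffOn_pd1 hD hf.1, fun z => by
    rw [SmoothFun.eval_d1, id, pd1_congr hD (SmoothFun.eqOn_extend hf.2) z.2]⟩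

theorem pd2_id (hD : IsOpen Ω) (hf : Rep Ω id f F) : Rep Ω id (pd2 f) (SmoothFun.d2 hD F) :=
  ⟨contDiffOn_pd2 hD hf.1, fun z => by
    rw [SmoothFun.eval_d2, id, pd2_congr hD (SmoothFun.eqOn_extend hf.2) z.2]⟩

theorem mk_id (hf : ContDiffOn ℝ ∞ f Ω) : Rep Ω id f (SmoothFun.mk f hf) := ⟨hf, fun _ => rfl⟩

end Rep

/-! ### Compatibility of representations with the differential expressions -/

section RepOperators

variable {Ω D : Set (ℝ × ℝ)} {Ψ : ℝ × ℝ → ℝ × ℝ} {Q₁ Q₂ Q₃ q₁ q₂ : ℝ × ℝ → ℝ}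
  {F₁ F₂ F₃ p₁ p₂ : SmoothFun Ω} {d : SmoothFun Ω → SmoothFun Ω}
  {U f : Fin 3 → ℝ × ℝ → ℝ} {U' f' : Fin 3 → SmoothFun Ω}

/-- Only the intertwining `hd` of `∂_y` with `d` is required, so the same lemmas serve `Ψ = id` with
`d = ∂₁` and the Liouville map with `d = u⁻¹∂_x`. -/
theorem Rep.S₁ (hd : ∀ {f F}, Rep D Ψ f F → Rep D Ψ (pd1 f) (d F)) (h₁ : Rep D Ψ Q₁ F₁)
    (h₂ : Rep D Ψ Q₂ F₂) (h₃ : Rep D Ψ Q₃ F₃) (hq : Rep D Ψ q₁ p₁) :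
    Rep D Ψ (S₁ pd1 Q₁ Q₂ Q₃ q₁) (S₁ d F₁ F₂ F₃ p₁) := by
  unfold ThreeDP.S₁
  repeat' first | assumption | apply Rep.add | apply Rep.sub | apply Rep.mul | apply hd
                | apply Rep.one

theorem Rep.S₂ (hd : ∀ {f F}, Rep D Ψ f F → Rep D Ψ (pd1 f) (d F)) (h₁ : Rep D Ψ Q₁ F₁)
    (h₂ : Rep D Ψ Q₂ F₂) (h₃ : Rep D Ψ Q₃ F₃) (hq : Rep D Ψ q₂ p₂) :
    Rep D Ψ (S₂ pd1 Q₁ Q₂ Q₃ q₂) (S₂ d F₁ F₂ F₃ p₂) := by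
  unfold ThreeDP.S₂
  repeat' first | assumption | apply Rep.add | apply Rep.sub | apply Rep.mul | apply hd

theorem Rep.assocRHS (hd : ∀ {f F}, Rep D Ψ f F → Rep D Ψ (pd1 f) (d F)) (h₁ : Rep D Ψ Q₁ F₁)
    (h₂ : Rep D Ψ Q₂ F₂) (h₃ : Rep D Ψ Q₃ F₃) (hq₁ : Rep D Ψ q₁ p₁) (hq₂ : Rep D Ψ q₂ p₂)
    (i : Fin 3) :
    Rep D Ψ (assocRHS pd1 Q₁ Q₂ Q₃ q₁ q₂ i) (assocRHS d F₁ F₂ F₃ p₁ p₂ i) := by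
  fin_cases i <;>
  simp only [ThreeDP.assocRHS, Fin.zero_eta, Fin.mk_one, Fin.reduceFinMk, Matrix.cons_val_zero,
    Matrix.cons_val_one, Matrix.cons_val] <;>
  repeat' first | assumption | apply Rep.add | apply Rep.sub | apply Rep.mul | apply hd
                | apply Rep.one | apply Rep.ofNat

theorem Rep.miura (hd : ∀ {f F}, Rep D Ψ f F → Rep D Ψ (pd1 f) (d F)) (h₁ : Rep D Ψ Q₁ F₁)
    (h₂ : Rep D Ψ Q₂ F₂) (h₃ : Rep D Ψ Q₃ F₃) (i : Fin 3) :
    Rep D Ψ (miura pd1 Q₁ Q₂ Q₃ i) (miura d F₁ F₂ F₃ i) := by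
  fin_cases i <;>
  simp only [ThreeDP.miura, Fin.zero_eta, Fin.mk_one, Fin.reduceFinMk, Matrix.cons_val_zero,
    Matrix.cons_val_one, Matrix.cons_val] <;>
  repeat' first | assumption | apply Rep.add | apply Rep.sub | apply Rep.mul | apply Rep.neg
                | apply hd

theorem Rep.miuraDeriv (hd : ∀ {f F}, Rep D Ψ f F → Rep D Ψ (pd1 f) (d F)) (h₁ : Rep D Ψ Q₁ F₁)
    (h₂ : Rep D Ψ Q₂ F₂) (h₃ : Rep D Ψ Q₃ F₃) (hf : ∀ i, Rep D Ψ (f i) (f' i)) (i : Fin 3) :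
    Rep D Ψ (miuraDeriv pd1 Q₁ Q₂ Q₃ f i) (miuraDeriv d F₁ F₂ F₃ f' i) := by
  fin_cases i <;>
  simp only [ThreeDP.miuraDeriv, Fin.zero_eta, Fin.mk_one, Fin.reduceFinMk, Matrix.cons_val_zero,
    Matrix.cons_val_one, Matrix.cons_val] <;>
  repeat' first | assumption | apply hf | apply Rep.add | apply Rep.sub | apply Rep.mul
                | apply Rep.neg | apply hd

theorem Rep.opJ₁ (hd : ∀ {f F}, Rep D Ψ f F → Rep D Ψ (pd1 f) (d F))
    (hU : ∀ i, Rep D Ψ (U i) (U' i)) (hf : ∀ i, Rep D Ψ (f i) (f' i)) (i : Fin 3) :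
    Rep D Ψ (opJ₁ pd1 U f i) (opJ₁ d U' f' i) := by
  fin_cases i <;>
  simp only [ThreeDP.opJ₁, Fin.zero_eta, Fin.mk_one, Fin.reduceFinMk, Matrix.cons_val_zero,
    Matrix.cons_val_one, Matrix.cons_val] <;>
  repeat' first | apply hf | apply hU | apply Rep.ofNat | apply Rep.add | apply Rep.sub
                | apply Rep.mul | apply Rep.neg | apply hd

theorem Rep.opK₁ (hd : ∀ {f F}, Rep D Ψ f F → Rep D Ψ (pd1 f) (d F))
    (hU : ∀ i, Rep D Ψ (U i) (U' i)) (hf : ∀ i, Rep D Ψ (f i) (f' i)) (i : Fin 3) :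
    Rep D Ψ (opK₁ pd1 U f i) (opK₁ d U' f' i) := by
  fin_cases i <;>
  simp only [ThreeDP.opK₁, chi₁, chi₂, negAdjChi₁, Fin.zero_eta, Fin.mk_one, Fin.reduceFinMk,
    Matrix.cons_val_zero, Matrix.cons_val_one, Matrix.cons_val] <;>
  repeat' first | apply hf | apply hU | apply Rep.ofNat | apply Rep.add | apply Rep.sub
                | apply Rep.mul | apply Rep.neg | apply hd

end RepOperators

/-! ## The zero curvature condition of the associated Lax pair -/

section ZeroCurvature

variable {f : ℝ × ℝ → ℝ} {z : ℝ × ℝ}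

theorem pd1_affine_ofReal (hf : DifferentiableAt ℝ f z) (a b : ℂ) :
    pd1 (fun z => a + (f z : ℂ) * b) z = ((pd1 f z : ℝ) : ℂ) * b :=
  (((hasDerivAt_pd1 hf).ofReal_comp.mul_const b).const_add a).deriv

theorem pd2_ofReal (hf : DifferentiableAt ℝ f z) :
    pd2 (fun z => (f z : ℂ)) z = ((pd2 f z : ℝ) : ℂ) :=
  (hasDerivAt_pd2 hf).ofReal_comp.deriv

theorem pd1_const {E : Type*} [NormedAddCommGroup E] [NormedSpace ℝ E] (c : E) (z : ℝ × ℝ) :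
    pd1 (fun _ => c) z = 0 := deriv_const _ _

theorem pd2_const {E : Type*} [NormedAddCommGroup E] [NormedSpace ℝ E] (c : E) (z : ℝ × ℝ) :
    pd2 (fun _ => c) z = 0 := deriv_const _ _

variable {D : Set (ℝ × ℝ)} {Q₁ Q₂ Q₃ q₁ q₂ : ℝ × ℝ → ℝ}

/-- Terms with other powers of `μ` cancel in the commutator, so the curvature displays the five
equations separately, with `μ` only as a denominator. -/
theorem assoc_zeroCurvature_eq (hD : IsOpen D) (h₁ : ContDiffOn ℝ ∞ Q₁ D)
    (h₂ : ContDiffOn ℝ ∞ Q₂ D) (h₃ : ContDiffOn ℝ ∞ Q₃ D) (hq₁ : ContDiffOn ℝ ∞ q₁ D)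
    (hq₂ : ContDiffOn ℝ ∞ q₂ D) {μ : ℂ} (hμ : μ ≠ 0) (hz : z ∈ D) :
    (Matrix.of fun i j => pd2 (fun z' => assocU Q₁ Q₂ Q₃ μ z' i j) z)
      - (Matrix.of fun i j => pd1 (fun z' => assocV Q₂ Q₃ q₁ q₂ μ z' i j) z)
      + (assocU Q₁ Q₂ Q₃ μ z * assocV Q₂ Q₃ q₁ q₂ μ z
        - assocV Q₂ Q₃ q₁ q₂ μ z * assocU Q₁ Q₂ Q₃ μ z) =
      !![0, 0, 0;
         ((pd2 Q₁ z : ℝ) : ℂ) - ((assocRHS pd1 Q₁ Q₂ Q₃ q₁ q₂ 0 z : ℝ) : ℂ),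
         ((pd2 Q₂ z : ℝ) : ℂ) - ((assocRHS pd1 Q₁ Q₂ Q₃ q₁ q₂ 1 z : ℝ) : ℂ),
         -((S₁ pd1 Q₁ Q₂ Q₃ q₁ z : ℝ) : ℂ) / μ;
         ((S₂ pd1 Q₁ Q₂ Q₃ q₂ z : ℝ) : ℂ) / μ, 0,
         ((pd2 Q₃ z : ℝ) : ℂ) - ((assocRHS pd1 Q₁ Q₂ Q₃ q₁ q₂ 2 z : ℝ) : ℂ)] := by
  have d₁ := h₁.differentiableAt_of_isOpen hD hz
  have d₂ := h₂.differentiableAt_of_isOpen hD hz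
  have d₃ := h₃.differentiableAt_of_isOpen hD hz
  have e₁ := hq₁.differentiableAt_of_isOpen hD hz
  have y₁ := contDiffOn_pd1 hD hq₁
  have y₂ := contDiffOn_pd1 hD hq₂
  have e₂ := hq₂.differentiableAt_of_isOpen hD hz
  have eg : DifferentiableAt ℝ (pd1 q₁ + Q₃ * q₁) z :=
    (y₁.add (h₃.mul hq₁)).differentiableAt_of_isOpen hD hz
  have ek : DifferentiableAt ℝ (pd1 q₂ + (Q₂ - Q₃) * q₂) z :=
    (y₂.add ((h₂.sub h₃).mul hq₂)).differentiableAt_of_isOpen hD hz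
  have U₁ : (Matrix.of fun i j => pd2 (fun z' => assocU Q₁ Q₂ Q₃ μ z' i j) z) =
      !![0, 0, 0; ((pd2 Q₁ z : ℝ) : ℂ), ((pd2 Q₂ z : ℝ) : ℂ), 0; 0, 0, ((pd2 Q₃ z : ℝ) : ℂ)] := by
    ext i j
    fin_cases i <;> fin_cases j <;>
    simp [assocU, pd2_const, pd2_ofReal d₁, pd2_ofReal d₂, pd2_ofReal d₃]
  have V₁ : (Matrix.of fun i j => pd1 (fun z' => assocV Q₂ Q₃ q₁ q₂ μ z' i j) z) =
      !![0, 0, ((pd1 q₁ z : ℝ) : ℂ) * μ⁻¹;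
         0, ((pd1 q₁ z : ℝ) : ℂ), ((pd1 (pd1 q₁ + Q₃ * q₁) z : ℝ) : ℂ) * μ⁻¹;
         -((pd1 (pd1 q₂ + (Q₂ - Q₃) * q₂) z : ℝ) : ℂ) * μ⁻¹, ((pd1 q₂ z : ℝ) : ℂ) * μ⁻¹,
         ((pd1 q₁ z : ℝ) : ℂ)] := by
    -- Each nonconstant entry is a constant plus a real function times a complex constant, and is
    -- differentiated as such; the two composite entries are grouped as they occur in `S₁` and `S₂`.
    have f02 : (fun z' => assocV Q₂ Q₃ q₁ q₂ μ z' 0 2) = fun z' => 0 + (q₁ z' : ℂ) * μ⁻¹ := by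
      funext z'; simp [assocV, div_eq_mul_inv]
    have f11 : (fun z' => assocV Q₂ Q₃ q₁ q₂ μ z' 1 1) =
        fun z' => 1 / (3 * μ ^ 2) + (q₁ z' : ℂ) * 1 := by
      funext z'; simp [assocV]
    have f12 : (fun z' => assocV Q₂ Q₃ q₁ q₂ μ z' 1 2) =
        fun z' => 0 + (((pd1 q₁ + Q₃ * q₁) z' : ℝ) : ℂ) * μ⁻¹ := by
      funext z'; simp [assocV, div_eq_mul_inv, add_comm]
    have f20 : (fun z' => assocV Q₂ Q₃ q₁ q₂ μ z' 2 0) =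
        fun z' => μ⁻¹ + (((pd1 q₂ + (Q₂ - Q₃) * q₂) z' : ℝ) : ℂ) * (-μ⁻¹) := by
      funext z'; simp [assocV, div_eq_mul_inv]; ring
    have f21 : (fun z' => assocV Q₂ Q₃ q₁ q₂ μ z' 2 1) = fun z' => 0 + (q₂ z' : ℂ) * μ⁻¹ := by
      funext z'; simp [assocV, div_eq_mul_inv]
    have f22 : (fun z' => assocV Q₂ Q₃ q₁ q₂ μ z' 2 2) =
        fun z' => -(2 / (3 * μ ^ 2)) + (q₁ z' : ℂ) * 1 := by
      funext z'; simp [assocV]; ring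
    ext i j
    fin_cases i <;> fin_cases j
    · simp [assocV, pd1_const]
    · simp [assocV, pd1_const]
    · simpa using (congrFun (congrArg pd1 f02) z).trans (pd1_affine_ofReal e₁ _ _)
    · simp [assocV, pd1_const]
    · simpa using (congrFun (congrArg pd1 f11) z).trans (pd1_affine_ofReal e₁ _ _)
    · simpa using (congrFun (congrArg pd1 f12) z).trans (pd1_affine_ofReal eg _ _)
    · simpa using (congrFun (congrArg pd1 f20) z).trans (pd1_affine_ofReal ek _ _)
    · simpa using (congrFun (congrArg pd1 f21) z).trans (pd1_affine_ofReal e₂ _ _)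
    · simpa using (congrFun (congrArg pd1 f22) z).trans (pd1_affine_ofReal e₁ _ _)
  rw [U₁, V₁]
  ext i j
  fin_cases i <;> fin_cases j <;>
  simp [assocU, assocV, Matrix.mul_apply, Fin.sum_univ_three, S₁, S₂, assocRHS] <;>
  field_simp <;> ring

theorem zeroCurvature_iff (hD : IsOpen D) (h₁ : ContDiffOn ℝ ∞ Q₁ D)
    (h₂ : ContDiffOn ℝ ∞ Q₂ D) (h₃ : ContDiffOn ℝ ∞ Q₃ D) (hq₁ : ContDiffOn ℝ ∞ q₁ D)
    (hq₂ : ContDiffOn ℝ ∞ q₂ D) :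
    (∀ μ : ℂ, μ ≠ 0 → ZeroCurvature D (assocU Q₁ Q₂ Q₃ μ) (assocV Q₂ Q₃ q₁ q₂ μ)) ↔
      IsAssocThreeDP D Q₁ Q₂ Q₃ q₁ q₂ := by
  constructor
  · intro h
    -- The single value `μ = 1` already yields all five equations.
    have key := fun z (hz : z ∈ D) => (assoc_zeroCurvature_eq hD h₁ h₂ h₃ hq₁ hq₂ one_ne_zero
      hz).symm.trans (h 1 one_ne_zero z hz)
    refine ⟨h₁, h₂, h₃, hq₁, hq₂, fun z hz => ?_, fun z hz => ?_, fun z hz => ?_, fun z hz => ?_,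
      fun z hz => ?_⟩
    · have := congrFun (congrFun (key z hz) 1) 0
      simp only [Matrix.of_apply, Matrix.cons_val, Matrix.zero_apply] at this
      exact_mod_cast sub_eq_zero.1 this
    · have := congrFun (congrFun (key z hz) 1) 1
      simp only [Matrix.of_apply, Matrix.cons_val, Matrix.zero_apply] at this
      exact_mod_cast sub_eq_zero.1 this
    · have := congrFun (congrFun (key z hz) 2) 2
      simp only [Matrix.of_apply, Matrix.cons_val, Matrix.zero_apply] at this
      exact_mod_cast sub_eq_zero.1 this
    · have := congrFun (congrFun (key z hz) 1) 2
      simpa using this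
    · have := congrFun (congrFun (key z hz) 2) 0
      simpa using this
  · intro h μ hμ z hz
    rw [assoc_zeroCurvature_eq hD h₁ h₂ h₃ hq₁ hq₂ hμ hz, h.eq_Q₁ z hz, h.eq_Q₂ z hz, h.eq_Q₃ z hz,
      h.eq_S₁ z hz, h.eq_S₂ z hz]
    ext i j
    fin_cases i <;> fin_cases j <;> simp

end ZeroCurvature

/-! ## The negative flow -/

section NegativeFlow

/-! ### Negative flow in a differential ring -/

section Algebraic

variable {R : Type*} [CommRing R] [Algebra ℝ R] (d : Derivation ℝ R R) {Q₁ Q₂ Q₃ q₁ q₂ σ₁ σ₂ : R}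

/-- The multiple `4 (A, B, C)` of the covector of the negative flow. -/
def flowCovector (d : R → R) (Q₁ Q₂ Q₃ q₁ σ₁ σ₂ : R) : Fin 3 → R :=
  ![d σ₁ - miura d Q₁ Q₂ Q₃ 0 * σ₁ - 2 * σ₂ - 4 * (Q₃ * d q₁) - 4 * (Q₃ * Q₃ * q₁),
    2 * σ₁ - 4 * (Q₃ * q₁),
    -(4 * q₁)]

/-- The multiple `2 (G₁, G₂, G₃)` of the residual of the negative flow. -/
def flowResidual (d : R → R) (Q₁ Q₂ Q₃ q₁ q₂ σ₁ : R) : Fin 3 → R :=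
  ![2 * (Q₁ * S₁ d Q₁ Q₂ Q₃ q₁) + d Q₁ * σ₁ + 2 * d (S₂ d Q₁ Q₂ Q₃ q₂)
      - 2 * (Q₂ * S₂ d Q₁ Q₂ Q₃ q₂),
    d (S₁ d Q₁ Q₂ Q₃ q₁) + d (Q₂ * σ₁) + 4 * S₂ d Q₁ Q₂ Q₃ q₂,
    d (Q₃ * σ₁) + 2 * S₂ d Q₁ Q₂ Q₃ q₂]

theorem miuraDeriv_linear (h h' : Fin 3 → R) (a b : ℝ) :
    miuraDeriv d Q₁ Q₂ Q₃ (a • h + b • h') =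
      a • miuraDeriv d Q₁ Q₂ Q₃ h + b • miuraDeriv d Q₁ Q₂ Q₃ h' := by
  funext i
  fin_cases i <;>
  simp only [miuraDeriv, Fin.zero_eta, Fin.mk_one, Fin.reduceFinMk, Pi.smul_apply, Pi.add_apply,
    Matrix.cons_val_zero, Matrix.cons_val_one, Matrix.cons_val] <;>
  try simp only [map_add, Derivation.map_smul, smul_mul_assoc, mul_smul_comm, add_mul, mul_add]
  all_goals module

variable {d}

/-- Scaling by `4` clears the denominators of `A`, `B`, `C`, so the identity has integer
coefficients. The nonlocal `σ₁`, `σ₂` enter only through `d σᵢ = Sᵢ`; their undifferentiated parts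
cancel. -/
theorem opJ₁_flowCovector (hσ₁ : d σ₁ = S₁ d Q₁ Q₂ Q₃ q₁) (hσ₂ : d σ₂ = S₂ d Q₁ Q₂ Q₃ q₂) :
    opJ₁ d (miura d Q₁ Q₂ Q₃) (flowCovector d Q₁ Q₂ Q₃ q₁ σ₁ σ₂) =
      (4 : ℝ) • miuraDeriv d Q₁ Q₂ Q₃ (assocRHS d Q₁ Q₂ Q₃ q₁ q₂) := by
  funext i
  rw [Pi.smul_apply, ofNat_smul_eq_nsmul, nsmul_eq_mul]
  fin_cases i <;>
  simp only [opJ₁, flowCovector, miuraDeriv, miura, assocRHS, Fin.zero_eta, Fin.mk_one,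
    Fin.reduceFinMk, Matrix.cons_val_zero, Matrix.cons_val_one, Matrix.cons_val, hσ₁, hσ₂, S₁, S₂,
    map_add, map_sub, map_neg, map_zero, Derivation.leibniz, Derivation.map_one_eq_zero,
    smul_eq_mul, derivation_ofNat, mul_zero, add_zero, Nat.cast_ofNat] <;>
  ring

theorem opK₁_flowCovector (hσ₁ : d σ₁ = S₁ d Q₁ Q₂ Q₃ q₁) (hσ₂ : d σ₂ = S₂ d Q₁ Q₂ Q₃ q₂) :
    opK₁ d (miura d Q₁ Q₂ Q₃) (flowCovector d Q₁ Q₂ Q₃ q₁ σ₁ σ₂) =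
      (2 : ℝ) • miuraDeriv d Q₁ Q₂ Q₃ (flowResidual d Q₁ Q₂ Q₃ q₁ q₂ σ₁) := by
  funext i
  rw [Pi.smul_apply, ofNat_smul_eq_nsmul, nsmul_eq_mul]
  fin_cases i <;>
  simp only [opK₁, chi₁, chi₂, negAdjChi₁, flowCovector, miuraDeriv, miura, flowResidual,
    Fin.zero_eta, Fin.mk_one,
    Fin.reduceFinMk, Matrix.cons_val_zero, Matrix.cons_val_one, Matrix.cons_val, hσ₁, hσ₂, S₁, S₂,
    map_add, map_sub, map_neg, map_zero, Derivation.leibniz, Derivation.map_one_eq_zero,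
    smul_eq_mul, derivation_ofNat, mul_zero, add_zero, Nat.cast_ofNat] <;>
  ring

end Algebraic

variable {D : Set (ℝ × ℝ)} {Q₁ Q₂ Q₃ q₁ q₂ σ₁ σ₂ : ℝ × ℝ → ℝ} {F₁ F₂ F₃ p₁ p₂ s₁ s₂ : SmoothFun D}

theorem Rep.flowABC (hD : IsOpen D) (h₁ : Rep D id Q₁ F₁) (h₂ : Rep D id Q₂ F₂)
    (h₃ : Rep D id Q₃ F₃) (hq₁ : Rep D id q₁ p₁) (hσ₁ : Rep D id σ₁ s₁) (hσ₂ : Rep D id σ₂ s₂)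
    (i : Fin 3) :
    Rep D id (flowABC Q₁ Q₂ Q₃ q₁ σ₁ σ₂ i)
      (((1 / 4 : ℝ) • flowCovector (SmoothFun.d1 hD) F₁ F₂ F₃ p₁ s₁ s₂) i) := by
  have hd : ∀ {f F}, Rep D id f F → Rep D id (pd1 f) (SmoothFun.d1 hD F) := Rep.pd1_id hD
  have hm := Rep.miura hd h₁ h₂ h₃ 0
  fin_cases i
  · refine Rep.congr_fun (Rep.smul (1 / 4) (f := pd1 σ₁ - ThreeDP.miura pd1 Q₁ Q₂ Q₃ 0 * σ₁ - 2 * σ₂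
      - 4 * (Q₃ * pd1 q₁) - 4 * (Q₃ * Q₃ * q₁)) ?_) fun z => ?_
    · repeat' first | assumption | apply Rep.sub | apply Rep.ofNat | apply Rep.mul | apply hd
    · simp [ThreeDP.flowABC]; ring
  · refine Rep.congr_fun (Rep.smul (1 / 4) (f := 2 * σ₁ - 4 * (Q₃ * q₁)) ?_) fun z => ?_
    · repeat' first | assumption | apply Rep.sub | apply Rep.ofNat | apply Rep.mul
    · simp [ThreeDP.flowABC]; ring
  · refine Rep.congr_fun (Rep.smul (1 / 4) (f := -(4 * q₁)) ?_) fun z => ?_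
    · repeat' first | assumption | apply Rep.neg | apply Rep.ofNat | apply Rep.mul
    · simp [ThreeDP.flowABC]

theorem Rep.flowG (hD : IsOpen D) (h₁ : Rep D id Q₁ F₁) (h₂ : Rep D id Q₂ F₂)
    (h₃ : Rep D id Q₃ F₃) (hq₁ : Rep D id q₁ p₁) (hq₂ : Rep D id q₂ p₂) (hσ₁ : Rep D id σ₁ s₁)
    (i : Fin 3) :
    Rep D id (flowG Q₁ Q₂ Q₃ q₁ q₂ σ₁ i)
      (((1 / 2 : ℝ) • flowResidual (SmoothFun.d1 hD) F₁ F₂ F₃ p₁ p₂ s₁) i) := by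
  have hd : ∀ {f F}, Rep D id f F → Rep D id (pd1 f) (SmoothFun.d1 hD F) := Rep.pd1_id hD
  have hS₁ := Rep.S₁ hd h₁ h₂ h₃ hq₁
  have hS₂ := Rep.S₂ hd h₁ h₂ h₃ hq₂
  fin_cases i
  · refine Rep.congr_fun (Rep.smul (1 / 2) (f := 2 * (Q₁ * ThreeDP.S₁ pd1 Q₁ Q₂ Q₃ q₁) + pd1 Q₁ * σ₁
      + 2 * pd1 (ThreeDP.S₂ pd1 Q₁ Q₂ Q₃ q₂) - 2 * (Q₂ * ThreeDP.S₂ pd1 Q₁ Q₂ Q₃ q₂)) ?_)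
      fun z => ?_
    · repeat' first | assumption | apply Rep.sub | apply Rep.add | apply Rep.ofNat
                    | apply Rep.mul | apply hd
    · simp [ThreeDP.flowG]; ring
  · refine Rep.congr_fun (Rep.smul (1 / 2) (f := pd1 (ThreeDP.S₁ pd1 Q₁ Q₂ Q₃ q₁) + pd1 (Q₂ * σ₁)
      + 4 * ThreeDP.S₂ pd1 Q₁ Q₂ Q₃ q₂) ?_) fun z => ?_
    · repeat' first | assumption | apply Rep.add | apply Rep.ofNat | apply Rep.mul | apply hd
    · simp [ThreeDP.flowG]; ring
  · refine Rep.congr_fun (Rep.smul (1 / 2) (f := pd1 (Q₃ * σ₁)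
      + 2 * ThreeDP.S₂ pd1 Q₁ Q₂ Q₃ q₂) ?_) fun z => ?_
    · repeat' first | assumption | apply Rep.add | apply Rep.ofNat | apply Rep.mul | apply hd
    · simp [ThreeDP.flowG]; ring

theorem negativeFlow_identities (hD : IsOpen D) (h₁ : ContDiffOn ℝ ∞ Q₁ D)
    (h₂ : ContDiffOn ℝ ∞ Q₂ D) (h₃ : ContDiffOn ℝ ∞ Q₃ D) (hq₁ : ContDiffOn ℝ ∞ q₁ D)
    (hq₂ : ContDiffOn ℝ ∞ q₂ D) (hσ₁ : ContDiffOn ℝ ∞ σ₁ D) (hσ₂ : ContDiffOn ℝ ∞ σ₂ D)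
    (hs₁ : ∀ z ∈ D, pd1 σ₁ z = S₁ pd1 Q₁ Q₂ Q₃ q₁ z)
    (hs₂ : ∀ z ∈ D, pd1 σ₂ z = S₂ pd1 Q₁ Q₂ Q₃ q₂ z) {z : ℝ × ℝ} (hz : z ∈ D) (i : Fin 3) :
    miuraDeriv pd1 Q₁ Q₂ Q₃ (assocRHS pd1 Q₁ Q₂ Q₃ q₁ q₂) i z =
      opJ₁ pd1 (miura pd1 Q₁ Q₂ Q₃) (flowABC Q₁ Q₂ Q₃ q₁ σ₁ σ₂) i z ∧
    miuraDeriv pd1 Q₁ Q₂ Q₃ (flowG Q₁ Q₂ Q₃ q₁ q₂ σ₁) i z =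
      opK₁ pd1 (miura pd1 Q₁ Q₂ Q₃) (flowABC Q₁ Q₂ Q₃ q₁ σ₁ σ₂) i z := by
  have hd : ∀ {f F}, Rep D id f F → Rep D id (pd1 f) (SmoothFun.d1 hD F) := Rep.pd1_id hD
  have r₁ := Rep.mk_id h₁
  have r₂ := Rep.mk_id h₂
  have r₃ := Rep.mk_id h₃
  have t₁ := Rep.mk_id hq₁
  have t₂ := Rep.mk_id hq₂
  have w₁ := Rep.mk_id hσ₁
  have w₂ := Rep.mk_id hσ₂
  have e₁ : SmoothFun.d1 hD (SmoothFun.mk σ₁ hσ₁) = S₁ (SmoothFun.d1 hD) (SmoothFun.mk Q₁ h₁)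
      (SmoothFun.mk Q₂ h₂) (SmoothFun.mk Q₃ h₃) (SmoothFun.mk q₁ hq₁) :=
    SmoothFun.eq_of_eval fun z => by
      rw [← (hd w₁).2, ← (Rep.S₁ hd r₁ r₂ r₃ t₁).2]; exact hs₁ z z.2
  have e₂ : SmoothFun.d1 hD (SmoothFun.mk σ₂ hσ₂) = S₂ (SmoothFun.d1 hD) (SmoothFun.mk Q₁ h₁)
      (SmoothFun.mk Q₂ h₂) (SmoothFun.mk Q₃ h₃) (SmoothFun.mk q₂ hq₂) :=
    SmoothFun.eq_of_eval fun z => by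
      rw [← (hd w₂).2, ← (Rep.S₂ hd r₁ r₂ r₃ t₂).2]; exact hs₂ z z.2
  have habc := Rep.flowABC hD r₁ r₂ r₃ t₁ w₁ w₂
  constructor
  · rw [show z = id ((⟨z, hz⟩ : D) : ℝ × ℝ) from rfl,
      (Rep.miuraDeriv hd r₁ r₂ r₃ (Rep.assocRHS hd r₁ r₂ r₃ t₁ t₂) i).2,
      (Rep.opJ₁ hd (Rep.miura hd r₁ r₂ r₃) habc i).2]
    have := opJ₁_linear (SmoothFun.d1 hD) (miura (SmoothFun.d1 hD) (SmoothFun.mk Q₁ h₁)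
      (SmoothFun.mk Q₂ h₂) (SmoothFun.mk Q₃ h₃)) (flowCovector (SmoothFun.d1 hD)
      (SmoothFun.mk Q₁ h₁) (SmoothFun.mk Q₂ h₂) (SmoothFun.mk Q₃ h₃) (SmoothFun.mk q₁ hq₁)
      (SmoothFun.mk σ₁ hσ₁) (SmoothFun.mk σ₂ hσ₂)) 0 (1 / 4) 0
    rw [zero_smul, zero_smul, add_zero, add_zero, opJ₁_flowCovector e₁ e₂, smul_smul] at this
    rw [this]
    norm_num
  · rw [show z = id ((⟨z, hz⟩ : D) : ℝ × ℝ) from rfl,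
      (Rep.miuraDeriv hd r₁ r₂ r₃ (Rep.flowG hD r₁ r₂ r₃ t₁ t₂ w₁) i).2,
      (Rep.opK₁ hd (Rep.miura hd r₁ r₂ r₃) habc i).2]
    have := opK₁_linear (SmoothFun.d1 hD) (miura (SmoothFun.d1 hD) (SmoothFun.mk Q₁ h₁)
      (SmoothFun.mk Q₂ h₂) (SmoothFun.mk Q₃ h₃)) (flowCovector (SmoothFun.d1 hD)
      (SmoothFun.mk Q₁ h₁) (SmoothFun.mk Q₂ h₂) (SmoothFun.mk Q₃ h₃) (SmoothFun.mk q₁ hq₁)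
      (SmoothFun.mk σ₁ hσ₁) (SmoothFun.mk σ₂ hσ₂)) 0 (1 / 4) 0
    have h' := miuraDeriv_linear (SmoothFun.d1 hD) (Q₁ := SmoothFun.mk Q₁ h₁)
      (Q₂ := SmoothFun.mk Q₂ h₂) (Q₃ := SmoothFun.mk Q₃ h₃) (flowResidual (SmoothFun.d1 hD)
      (SmoothFun.mk Q₁ h₁) (SmoothFun.mk Q₂ h₂) (SmoothFun.mk Q₃ h₃) (SmoothFun.mk q₁ hq₁)
      (SmoothFun.mk q₂ hq₂) (SmoothFun.mk σ₁ hσ₁)) 0 (1 / 2) 0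
    rw [zero_smul, zero_smul, add_zero, add_zero] at h'
    rw [zero_smul, zero_smul, add_zero, add_zero, opK₁_flowCovector e₁ e₂, smul_smul] at this
    rw [this, h']
    norm_num

theorem IsAssocThreeDP.flowG_eq_zero (hD : IsOpen D) (h : IsAssocThreeDP D Q₁ Q₂ Q₃ q₁ q₂)
    {z : ℝ × ℝ} (hz : z ∈ D) (i : Fin 3) : flowG Q₁ Q₂ Q₃ q₁ q₂ 0 i z = 0 := by
  have e₁ : pd1 (S₁ pd1 Q₁ Q₂ Q₃ q₁) z = 0 :=
    (pd1_congr hD (g := fun _ => 0) h.eq_S₁ hz).trans (pd1_const _ _)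
  have e₂ : pd1 (S₂ pd1 Q₁ Q₂ Q₃ q₂) z = 0 :=
    (pd1_congr hD (g := fun _ => 0) h.eq_S₂ hz).trans (pd1_const _ _)
  have e₀ : pd1 (0 : ℝ × ℝ → ℝ) z = 0 := pd1_const _ _
  fin_cases i <;> simp [flowG, e₁, e₂, e₀, h.eq_S₁ z hz, h.eq_S₂ z hz]

theorem IsAssocThreeDP.isNegativeFlow (hD : IsOpen D) (h : IsAssocThreeDP D Q₁ Q₂ Q₃ q₁ q₂) :
    IsNegativeFlow D Q₁ Q₂ Q₃ (flowABC Q₁ Q₂ Q₃ q₁ 0 0 0) (flowABC Q₁ Q₂ Q₃ q₁ 0 0 1)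
      (flowABC Q₁ Q₂ Q₃ q₁ 0 0 2) := by
  have hd : ∀ {f F}, Rep D id f F → Rep D id (pd1 f) (SmoothFun.d1 hD F) := Rep.pd1_id hD
  have r₁ := Rep.mk_id h.smooth_Q₁
  have r₂ := Rep.mk_id h.smooth_Q₂
  have r₃ := Rep.mk_id h.smooth_Q₃
  have t₁ := Rep.mk_id h.smooth_q₁
  have t₂ := Rep.mk_id h.smooth_q₂
  have w : Rep D id 0 (0 : SmoothFun D) := Rep.zero
  have habc := Rep.flowABC hD r₁ r₂ r₃ t₁ w w
  have e₀ : ∀ z, pd1 (0 : ℝ × ℝ → ℝ) z = 0 := pd1_const _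
  have key := fun z (hz : z ∈ D) i => negativeFlow_identities hD h.smooth_Q₁ h.smooth_Q₂
    h.smooth_Q₃ h.smooth_q₁ h.smooth_q₂ (σ₁ := 0) (σ₂ := 0) w.1 w.1
    (fun z hz => (e₀ z).trans (h.eq_S₁ z hz).symm) (fun z hz => (e₀ z).trans (h.eq_S₂ z hz).symm)
    hz i
  have hv : (![flowABC Q₁ Q₂ Q₃ q₁ 0 0 0, flowABC Q₁ Q₂ Q₃ q₁ 0 0 1, flowABC Q₁ Q₂ Q₃ q₁ 0 0 2] :
      Fin 3 → ℝ × ℝ → ℝ) = flowABC Q₁ Q₂ Q₃ q₁ 0 0 := by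
    funext i; fin_cases i <;> rfl
  refine ⟨h.smooth_Q₁, h.smooth_Q₂, h.smooth_Q₃, (habc 0).1, (habc 1).1, (habc 2).1,
    fun z hz i => ?_, fun z hz i => ?_⟩
  · rw [hv, ← (key z hz i).1]
    have hR := Rep.assocRHS hd r₁ r₂ r₃ t₁ t₂
    -- The time derivatives equal the right-hand sides only on `D`, not as functions on the plane;
    -- being represented by the same ring elements lets them be exchanged under `∂_y`.
    have hT : ∀ i, Rep D id ((![pd2 Q₁, pd2 Q₂, pd2 Q₃] : Fin 3 → ℝ × ℝ → ℝ) i) (assocRHS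
        (SmoothFun.d1 hD) (SmoothFun.mk Q₁ h.smooth_Q₁) (SmoothFun.mk Q₂ h.smooth_Q₂)
        (SmoothFun.mk Q₃ h.smooth_Q₃) (SmoothFun.mk q₁ h.smooth_q₁)
        (SmoothFun.mk q₂ h.smooth_q₂) i) := by
      intro i
      refine ⟨?_, fun z => ?_⟩
      · fin_cases i
        exacts [contDiffOn_pd2 hD h.smooth_Q₁, contDiffOn_pd2 hD h.smooth_Q₂,
          contDiffOn_pd2 hD h.smooth_Q₃]
      · rw [← (hR i).2]
        fin_cases i
        exacts [h.eq_Q₁ z z.2, h.eq_Q₂ z z.2, h.eq_Q₃ z z.2]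
    exact ((Rep.miuraDeriv hd r₁ r₂ r₃ hT i).2 ⟨z, hz⟩).trans
      ((Rep.miuraDeriv hd r₁ r₂ r₃ hR i).2 ⟨z, hz⟩).symm
  · rw [hv, ← (key z hz i).2]
    have hG := Rep.flowG hD r₁ r₂ r₃ t₁ t₂ w
    have hT : ∀ i, Rep D id ((0 : Fin 3 → ℝ × ℝ → ℝ) i) (((1 / 2 : ℝ) • flowResidual
        (SmoothFun.d1 hD) (SmoothFun.mk Q₁ h.smooth_Q₁) (SmoothFun.mk Q₂ h.smooth_Q₂)
        (SmoothFun.mk Q₃ h.smooth_Q₃) (SmoothFun.mk q₁ h.smooth_q₁)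
        (SmoothFun.mk q₂ h.smooth_q₂) 0) i) := fun i => ⟨contDiffOn_const, fun z => by
      rw [← (hG i).2]; exact (h.flowG_eq_zero hD z.2 i).symm⟩
    exact ((Rep.miuraDeriv hd r₁ r₂ r₃ hT i).2 ⟨z, hz⟩).trans
      ((Rep.miuraDeriv hd r₁ r₂ r₃ hG i).2 ⟨z, hz⟩).symm

end NegativeFlow

/-! ## The Liouville transformation in a differential ring -/

section LiouvilleAlgebra

variable {R : Type*} [CommRing R] [Algebra ℝ R]

/-- Elements of a ring with two commuting derivations which satisfy the 3-DP equation, with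
inverses `u'` and `v'` of `u` and `v`. -/
structure ThreeDPRelations (d₁ d₂ : Derivation ℝ R R) (u u' v v' w p r : R) : Prop where
  comm : ∀ F, d₂ (d₁ F) = d₁ (d₂ F)
  inv_u : u * u' = 1
  inv_v : v * v' = 1
  d₂_u : d₂ u = -d₁ (u * p * r)
  d₂_v : d₂ v = -(3 * v * d₁ p * r + d₁ v * p * r + u * u * p)
  d₂_w : d₂ w = -(3 * w * p * d₁ r + d₁ w * p * r - u * u * r)
  d₁_d₁_p : d₁ (d₁ p) = p - v
  d₁_d₁_r : d₁ (d₁ r) = r - w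

theorem derivation_inv (d : Derivation ℝ R R) {u u' : R} (h : u * u' = 1) :
    d u' = -(u' * u' * d u) := by
  have := congrArg d h
  rw [d.leibniz, d.map_one_eq_zero, smul_eq_mul, smul_eq_mul] at this
  linear_combination u' * this - d u' * h

variable (d₁ d₂ : Derivation ℝ R R) (u u' v v' w p r : R)

/-- The derivation `∂_y` in the old variables. -/
def dY : Derivation ℝ R R := u' • d₁

/-- The derivation `∂_τ` in the old variables. -/
def dTau : Derivation ℝ R R := d₂ + (p * r) • d₁

theorem dY_apply (F : R) : dY d₁ u' F = u' * d₁ F := rfl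

theorem dTau_apply (F : R) : dTau d₁ d₂ p r F = d₂ F + p * r * d₁ F := rfl

/-- The transforms `b, Q₁, Q₂, Q₃, q₁, q₂`. -/
def ringB : R := v * w * (u' * u') + 2 * (d₁ u * u') - d₁ v * v'

def ringQ₁ : R := (1 + d₁ (ringB d₁ u u' v v' w) - ringB d₁ u u' v v' w * ringB d₁ u u' v v' w)
  * (u' * u')

def ringQ₂ : R := (2 * v * w - 2 * (u * u) * (d₁ v * v') + 3 * u * d₁ u) * (u' * u' * u')

def ringQ₃ : R := v * w * (u' * u' * u')

def ringq₁ : R := p * (u * u) * v'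

def ringq₂ : R := r * v * u'

variable {d₁ d₂ u u' v v' w p r}

/-- Homomorphisms to `ℝ` separate the ring, so each identity is checked in a field, where the values
of the fields and of their `x`-derivatives are treated as independent numbers. Time derivatives and
second derivatives of `p`, `r` are first removed by the equations. The final conjunct is the
conservation law behind the gauge exponent. -/
theorem liouville_identities (h : ThreeDPRelations d₁ d₂ u u' v v' w p r)
    (sep : ∀ F G : R, (∀ e : R →ₐ[ℝ] ℝ, e F = e G) → F = G) :
    dTau d₁ d₂ p r (ringQ₁ d₁ u u' v v' w) = assocRHS (dY d₁ u') (ringQ₁ d₁ u u' v v' w)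
      (ringQ₂ d₁ u u' v v' w) (ringQ₃ u' v w) (ringq₁ u v' p) (ringq₂ u' v r) 0 ∧
    dTau d₁ d₂ p r (ringQ₂ d₁ u u' v v' w) = assocRHS (dY d₁ u') (ringQ₁ d₁ u u' v v' w)
      (ringQ₂ d₁ u u' v v' w) (ringQ₃ u' v w) (ringq₁ u v' p) (ringq₂ u' v r) 1 ∧
    dTau d₁ d₂ p r (ringQ₃ u' v w) = assocRHS (dY d₁ u') (ringQ₁ d₁ u u' v v' w)
      (ringQ₂ d₁ u u' v v' w) (ringQ₃ u' v w) (ringq₁ u v' p) (ringq₂ u' v r) 2 ∧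
    S₁ (dY d₁ u') (ringQ₁ d₁ u u' v v' w) (ringQ₂ d₁ u u' v v' w) (ringQ₃ u' v w)
      (ringq₁ u v' p) = 0 ∧
    S₂ (dY d₁ u') (ringQ₁ d₁ u u' v v' w) (ringQ₂ d₁ u u' v v' w) (ringQ₃ u' v w)
      (ringq₂ u' v r) = 0 ∧
    d₂ (v * w * (u' * u')) = d₁ (p * d₁ r - d₁ p * r - p * r * (v * w * (u' * u'))) := by
  refine ⟨?_, ?_, ?_, ?_, ?_, ?_⟩ <;>
  · refine sep _ _ fun e => ?_
    have hu : e u * e u' = 1 := by rw [← map_mul, h.inv_u, map_one]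
    have hv : e v * e v' = 1 := by rw [← map_mul, h.inv_v, map_one]
    simp only [assocRHS, S₁, S₂, Matrix.cons_val, dTau_apply, dY_apply, ringQ₁, ringQ₂, ringQ₃,
      ringq₁, ringq₂, ringB, Derivation.leibniz, map_add, map_sub, map_neg, smul_eq_mul,
      derivation_ofNat, Derivation.map_one_eq_zero, h.comm, derivation_inv _ h.inv_u,
      derivation_inv _ h.inv_v, h.d₂_u, h.d₂_v, h.d₂_w, h.d₁_d₁_p, h.d₁_d₁_r, map_mul, map_ofNat,
      map_one, map_zero, mul_zero, add_zero]
    -- In a field `u'` and `v'` are true inverses and denominators can be cleared; the conservation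
    -- law involves no `v'`.
    rw [eq_inv_of_mul_eq_one_right hu]
    try rw [eq_inv_of_mul_eq_one_right hv]
    have hu0 := left_ne_zero_of_mul_eq_one hu
    have hv0 := left_ne_zero_of_mul_eq_one hv
    field_simp
    ring

end LiouvilleAlgebra

/-! ## Potentials of closed forms -/

section Potential

variable {Ω : Set (ℝ × ℝ)}

/-- The linear form `α dx + β dt`. -/
def form (α β : ℝ × ℝ → ℝ) (z : ℝ × ℝ) : ℝ × ℝ →L[ℝ] ℝ :=
  α z • ContinuousLinearMap.fst ℝ ℝ ℝ + β z • ContinuousLinearMap.snd ℝ ℝ ℝ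

theorem form_apply (α β : ℝ × ℝ → ℝ) (z w : ℝ × ℝ) : form α β z w = α z * w.1 + β z * w.2 := rfl

theorem contDiffOn_form {α β : ℝ × ℝ → ℝ} (hα : ContDiffOn ℝ ∞ α Ω) (hβ : ContDiffOn ℝ ∞ β Ω) :
    ContDiffOn ℝ ∞ (form α β) Ω :=
  (hα.smul contDiffOn_const).add (hβ.smul contDiffOn_const)

/-- The Poincaré lemma on a convex open set; closedness of `α dx + β dt` is the symmetry of the
derivative of the form. -/
theorem exists_potential (hΩ : IsOpen Ω) (hc : Convex ℝ Ω) {α β : ℝ × ℝ → ℝ}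
    (hα : ContDiffOn ℝ ∞ α Ω) (hβ : ContDiffOn ℝ ∞ β Ω) (h : ∀ z ∈ Ω, pd2 α z = pd1 β z) :
    ∃ y : ℝ × ℝ → ℝ, ContDiffOn ℝ ∞ y Ω ∧ (∀ z ∈ Ω, pd1 y z = α z) ∧ ∀ z ∈ Ω, pd2 y z = β z := by
  have hω := contDiffOn_form hα hβ
  have hs : ∀ a ∈ Ω, ∀ z w : ℝ × ℝ,
      fderiv ℝ (form α β) a z w = fderiv ℝ (form α β) a w z := fun a ha z w => by
      have dα := hα.differentiableAt_of_isOpen hΩ ha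
      have dβ := hβ.differentiableAt_of_isOpen hΩ ha
      have hd : HasFDerivAt (form α β)
          ((fderiv ℝ α a).smulRight (ContinuousLinearMap.fst ℝ ℝ ℝ)
            + (fderiv ℝ β a).smulRight (ContinuousLinearMap.snd ℝ ℝ ℝ)) a :=
        (dα.hasFDerivAt.smul_const (ContinuousLinearMap.fst ℝ ℝ ℝ)).add
          (dβ.hasFDerivAt.smul_const (ContinuousLinearMap.snd ℝ ℝ ℝ))
      obtain ⟨z₁, z₂⟩ := z
      obtain ⟨w₁, w₂⟩ := w
      rw [hd.fderiv]
      simp only [_root_.add_apply, ContinuousLinearMap.smulRight_apply,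
        fderiv_apply_eq dα, fderiv_apply_eq dβ, h a ha, smul_eq_mul, _root_.smul_apply,
        ContinuousLinearMap.coe_fst', ContinuousLinearMap.coe_snd']
      ring
  obtain ⟨y, hy⟩ := hc.exists_forall_hasFDerivAt_of_fderiv_symmetric hΩ
    (hω.differentiableOn (by simp)) hs
  refine ⟨y, (contDiffOn_infty_iff_fderiv_of_isOpen hΩ).2
    ⟨fun z hz => (hy z hz).differentiableAt.differentiableWithinAt,
      hω.congr fun z hz => (hy z hz).fderiv⟩, fun z hz => ?_, fun z hz => ?_⟩
  · rw [pd1_eq_fderiv (hy z hz).differentiableAt, (hy z hz).fderiv, form_apply]; simp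
  · rw [pd2_eq_fderiv (hy z hz).differentiableAt, (hy z hz).fderiv, form_apply]; simp

end Potential

/-! ## The change of independent variables -/

section ChangeOfVariables

variable {Ω : Set (ℝ × ℝ)} {y : ℝ × ℝ → ℝ}

theorem contDiffOn_liouvilleMap (hy : ContDiffOn ℝ ∞ y Ω) :
    ContDiffOn ℝ ∞ (liouvilleMap y) Ω :=
  hy.prodMk contDiffOn_snd

theorem fderiv_liouvilleMap {z : ℝ × ℝ} (hy : DifferentiableAt ℝ y z) (a b : ℝ) :
    fderiv ℝ (liouvilleMap y) z (a, b) = (a * pd1 y z + b * pd2 y z, b) := by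
  have : HasFDerivAt (liouvilleMap y) _ z := hy.hasFDerivAt.prodMk hasFDerivAt_snd
  rw [this.fderiv, ContinuousLinearMap.prod_apply, fderiv_apply_eq hy]
  rfl

/-- The shear `(a, b) ↦ (a c + b e, b)`. -/
def shear (c e : ℝ) (hc : c ≠ 0) : (ℝ × ℝ) ≃L[ℝ] ℝ × ℝ :=
  ContinuousLinearEquiv.equivOfInverse
    ((c • ContinuousLinearMap.fst ℝ ℝ ℝ + e • ContinuousLinearMap.snd ℝ ℝ ℝ).prod
      (ContinuousLinearMap.snd ℝ ℝ ℝ))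
    ((c⁻¹ • (ContinuousLinearMap.fst ℝ ℝ ℝ - e • ContinuousLinearMap.snd ℝ ℝ ℝ)).prod
      (ContinuousLinearMap.snd ℝ ℝ ℝ))
    (fun z => by
      ext
      · simp; field_simp
      · simp)
    (fun z => by
      ext
      · simp; field_simp; ring
      · simp)

theorem shear_apply (c e : ℝ) (hc : c ≠ 0) (a b : ℝ) :
    shear c e hc (a, b) = (c * a + e * b, b) := rfl

/-- The Jacobian matrix is the shear with rows `(y_x, y_t)` and `(0, 1)`, invertible when `y_x ≠ 0`;
hence the inverse function theorem applies. -/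
theorem exists_localInverse (hΩ : IsOpen Ω) (hy : ContDiffOn ℝ ∞ y Ω) {z : ℝ × ℝ} (hz : z ∈ Ω)
    (hu : pd1 y z ≠ 0) :
    ∃ g : ℝ × ℝ → ℝ × ℝ, ContDiffAt ℝ ∞ g (liouvilleMap y z) ∧ g (liouvilleMap y z) = z ∧
      ∀ᶠ w in nhds (liouvilleMap y z), g w ∈ Ω ∧ liouvilleMap y (g w) = w := by
  have hd := hy.differentiableAt_of_isOpen hΩ hz
  have hc : ContDiffAt ℝ ∞ (liouvilleMap y) z :=
    (contDiffOn_liouvilleMap hy).contDiffAt (hΩ.mem_nhds hz)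
  have hf : HasFDerivAt (liouvilleMap y) (shear (pd1 y z) (pd2 y z) hu : ℝ × ℝ →L[ℝ] ℝ × ℝ) z := by
    have : fderiv ℝ (liouvilleMap y) z = (shear (pd1 y z) (pd2 y z) hu : ℝ × ℝ →L[ℝ] ℝ × ℝ) := by
      refine ContinuousLinearMap.ext fun w => ?_
      obtain ⟨a, b⟩ := w
      rw [fderiv_liouvilleMap hd, ContinuousLinearEquiv.coe_coe, shear_apply, mul_comm a,
        mul_comm b]
    rw [← this]
    exact (hc.differentiableAt (by simp)).hasFDerivAt
  have hn : (∞ : WithTop ℕ∞) ≠ 0 := by simp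
  have hg := hc.to_localInverse hf hn
  have he := hc.localInverse_apply_image hf hn
  refine ⟨hc.localInverse hf hn, hg, he, Filter.Eventually.and ?_
    (hc.hasStrictFDerivAt' hf hn).eventually_right_inverse⟩
  exact hg.continuousAt.eventually_mem (by rw [he]; exact hΩ.mem_nhds hz)

theorem isOpen_image_liouvilleMap (hΩ : IsOpen Ω) (hy : ContDiffOn ℝ ∞ y Ω)
    (hu : ∀ z ∈ Ω, pd1 y z ≠ 0) : IsOpen (liouvilleMap y '' Ω) := by
  rw [isOpen_iff_mem_nhds]
  rintro _ ⟨z, hz, rfl⟩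
  obtain ⟨g, -, -, h⟩ := exists_localInverse hΩ hy hz (hu z hz)
  exact h.mono fun w hw => ⟨g w, hw⟩

/-- Near a point of the image, `f` is `g` composed with a smooth local inverse, so global
injectivity is not needed. -/
theorem contDiffOn_image_liouvilleMap {E : Type*} [NormedAddCommGroup E] [NormedSpace ℝ E]
    {f g : ℝ × ℝ → E} {n : WithTop ℕ∞} (hn : n ≤ ∞)
    (hΩ : IsOpen Ω) (hy : ContDiffOn ℝ ∞ y Ω) (hu : ∀ z ∈ Ω, pd1 y z ≠ 0)
    (hg : ContDiffOn ℝ n g Ω) (h : ∀ z ∈ Ω, f (liouvilleMap y z) = g z) :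
    ContDiffOn ℝ n f (liouvilleMap y '' Ω) := by
  rintro _ ⟨z, hz, rfl⟩
  obtain ⟨G, hG, hGz, hev⟩ := exists_localInverse hΩ hy hz (hu z hz)
  have : ContDiffAt ℝ n (g ∘ G) (liouvilleMap y z) :=
    ContDiffAt.comp _ (by rw [hGz]; exact hg.contDiffAt (hΩ.mem_nhds hz)) (hG.of_le hn)
  refine (this.congr_of_eventuallyEq (hev.mono fun w hw => ?_)).contDiffWithinAt
  rw [Function.comp_apply, ← h _ hw.1, hw.2]

theorem differentiableOn_image_liouvilleMap {E : Type*} [NormedAddCommGroup E] [NormedSpace ℝ E]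
    {f g : ℝ × ℝ → E} (hΩ : IsOpen Ω) (hy : ContDiffOn ℝ ∞ y Ω) (hu : ∀ z ∈ Ω, pd1 y z ≠ 0)
    (hg : DifferentiableOn ℝ g Ω) (h : ∀ z ∈ Ω, f (liouvilleMap y z) = g z) :
    DifferentiableOn ℝ f (liouvilleMap y '' Ω) := by
  rintro _ ⟨z, hz, rfl⟩
  obtain ⟨G, hG, hGz, hev⟩ := exists_localInverse hΩ hy hz (hu z hz)
  have : DifferentiableAt ℝ (g ∘ G) (liouvilleMap y z) :=
    DifferentiableAt.comp _ (by rw [hGz]; exact hg.differentiableAt (hΩ.mem_nhds hz))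
      (hG.differentiableAt (by simp))
  refine (this.congr_of_eventuallyEq (hev.mono fun w hw => ?_)).differentiableWithinAt
  rw [Function.comp_apply, ← h _ hw.1, hw.2]

theorem pd1_comp_liouvilleMap {E : Type*} [NormedAddCommGroup E] [NormedSpace ℝ E]
    {f : ℝ × ℝ → E} {z : ℝ × ℝ} (hy : DifferentiableAt ℝ y z)
    (hf : DifferentiableAt ℝ f (liouvilleMap y z)) :
    pd1 (fun w => f (liouvilleMap y w)) z = pd1 y z • pd1 f (liouvilleMap y z) := by
  have hd : DifferentiableAt ℝ (liouvilleMap y) z := hy.prodMk differentiableAt_snd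
  rw [pd1_eq_fderiv (f := fun w => f (liouvilleMap y w)) (hf.comp z hd),
    fderiv_fun_comp z hf hd, ContinuousLinearMap.comp_apply, fderiv_liouvilleMap hy,
    fderiv_apply_eq hf]
  simp

theorem pd2_comp_liouvilleMap {E : Type*} [NormedAddCommGroup E] [NormedSpace ℝ E]
    {f : ℝ × ℝ → E} {z : ℝ × ℝ} (hy : DifferentiableAt ℝ y z)
    (hf : DifferentiableAt ℝ f (liouvilleMap y z)) :
    pd2 (fun w => f (liouvilleMap y w)) z =
      pd2 y z • pd1 f (liouvilleMap y z) + pd2 f (liouvilleMap y z) := by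
  have hd : DifferentiableAt ℝ (liouvilleMap y) z := hy.prodMk differentiableAt_snd
  rw [pd2_eq_fderiv (f := fun w => f (liouvilleMap y w)) (hf.comp z hd),
    fderiv_fun_comp z hf hd, ContinuousLinearMap.comp_apply, fderiv_liouvilleMap hy,
    fderiv_apply_eq hf]
  simp

/-- Time is preserved, and on each line of constant time Rolle's theorem excludes equal values of
`y`. -/
theorem injOn_liouvilleMap {J : Set ℝ} (hJ : IsOpen J) (hy : ContDiffOn ℝ ∞ y (Set.univ ×ˢ J))
    (hu : ∀ z ∈ Set.univ ×ˢ J, pd1 y z ≠ 0) : Set.InjOn (liouvilleMap y) (Set.univ ×ˢ J) := by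
  have hΩ : IsOpen (Set.univ ×ˢ J : Set (ℝ × ℝ)) := isOpen_univ.prod hJ
  rintro ⟨x, t⟩ hz ⟨x', t'⟩ - h
  obtain ⟨h, rfl⟩ : y (x, t) = y (x', t') ∧ t = t' := by simpa [liouvilleMap] using h
  have ht : t ∈ J := hz.2
  by_contra hne
  have hx : x ≠ x' := fun e => hne (by rw [e])
  have hd : ∀ s, HasDerivAt (fun s => y (s, t)) (pd1 y (s, t)) s := fun s =>
    hasDerivAt_pd1 (z := (s, t)) (hy.differentiableAt_of_isOpen hΩ ⟨trivial, ht⟩)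
  obtain ⟨c, hc⟩ : ∃ c, deriv (fun s => y (s, t)) c = 0 := by
    rcases lt_or_gt_of_ne hx with hlt | hlt
    · obtain ⟨c, -, hc⟩ := exists_deriv_eq_zero hlt
        (fun s _ => (hd s).continuousAt.continuousWithinAt) h
      exact ⟨c, hc⟩
    · obtain ⟨c, -, hc⟩ := exists_deriv_eq_zero hlt
        (fun s _ => (hd s).continuousAt.continuousWithinAt) h.symm
      exact ⟨c, hc⟩
  exact hu (c, t) ⟨trivial, ht⟩ hc

end ChangeOfVariables

/-! ## The Liouville transformation of solutions -/

section LiouvilleSolutions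

variable {Ω : Set (ℝ × ℝ)} {u v w p r y : ℝ × ℝ → ℝ}

theorem threeDPRelations (hΩ : IsOpen Ω) (h : IsThreeDP Ω u v w p r) (hu : ∀ z ∈ Ω, u z ≠ 0)
    (hv : ∀ z ∈ Ω, v z ≠ 0) :
    ThreeDPRelations (SmoothFun.d1 hΩ) (SmoothFun.d2 hΩ) (SmoothFun.mk u h.smooth_u)
      (SmoothFun.mk (fun z => (u z)⁻¹) (h.smooth_u.inv hu)) (SmoothFun.mk v h.smooth_v)
      (SmoothFun.mk (fun z => (v z)⁻¹) (h.smooth_v.inv hv)) (SmoothFun.mk w h.smooth_w)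
      (SmoothFun.mk p h.smooth_p) (SmoothFun.mk r h.smooth_r) := by
  have ru := Rep.mk_id h.smooth_u
  have rv := Rep.mk_id h.smooth_v
  have rw' := Rep.mk_id h.smooth_w
  have rp := Rep.mk_id h.smooth_p
  have rr := Rep.mk_id h.smooth_r
  refine ⟨SmoothFun.d2_d1 hΩ, SmoothFun.eq_of_eval fun z => ?_, SmoothFun.eq_of_eval fun z => ?_,
    SmoothFun.eq_of_eval fun z => ?_, SmoothFun.eq_of_eval fun z => ?_,
    SmoothFun.eq_of_eval fun z => ?_, SmoothFun.eq_of_eval fun z => ?_,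
    SmoothFun.eq_of_eval fun z => ?_⟩
  · simp [hu z z.2]
  · simp [hv z z.2]
  · rw [map_neg, ← (ru.pd2_id hΩ).2, ← (((ru.mul rp).mul rr).pd1_id hΩ).2]
    exact eq_neg_of_add_eq_zero_left (h.eq_u z z.2)
  · simp only [map_neg, map_add, map_mul, map_ofNat, ← (rv.pd2_id hΩ).2, ← (rv.pd1_id hΩ).2,
      ← (rp.pd1_id hΩ).2, SmoothFun.eval_mk, id]
    linear_combination h.eq_v z z.2
  · simp only [map_neg, map_add, map_sub, map_mul, map_ofNat, ← (rw'.pd2_id hΩ).2,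
      ← (rw'.pd1_id hΩ).2, ← (rr.pd1_id hΩ).2, SmoothFun.eval_mk, id]
    linear_combination h.eq_w z z.2
  · rw [map_sub, ← ((rp.pd1_id hΩ).pd1_id hΩ).2, SmoothFun.eval_mk, SmoothFun.eval_mk, id]
    linear_combination h.eq_p z z.2
  · rw [map_sub, ← ((rr.pd1_id hΩ).pd1_id hΩ).2, SmoothFun.eval_mk, SmoothFun.eval_mk, id]
    linear_combination h.eq_r z z.2

theorem SmoothFun.separates {F G : SmoothFun Ω} (h : ∀ e : SmoothFun Ω →ₐ[ℝ] ℝ, e F = e G) :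
    F = G :=
  SmoothFun.eq_of_eval fun z => h (SmoothFun.eval z)

/-! ### Chain rule for the Liouville change of variables -/

section Derivatives

variable {f : ℝ × ℝ → ℝ} {F : SmoothFun Ω}

theorem Rep.pd1_liouville (hΩ : IsOpen Ω) (hu : ContDiffOn ℝ ∞ u Ω) (hu0 : ∀ z ∈ Ω, u z ≠ 0)
    (hy : IsReciprocal Ω u p r y) (hf : Rep (liouvilleMap y '' Ω) (liouvilleMap y) f F) :
    Rep (liouvilleMap y '' Ω) (liouvilleMap y) (pd1 f)
      (dY (SmoothFun.d1 hΩ) (SmoothFun.mk (fun z => (u z)⁻¹) (hu.inv hu0)) F) := by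
  have hu' : ∀ z ∈ Ω, pd1 y z ≠ 0 := fun z hz => by rw [hy.d_x z hz]; exact hu0 z hz
  have hD := isOpen_image_liouvilleMap hΩ hy.smooth hu'
  refine ⟨contDiffOn_pd1 hD hf.1, fun z => ?_⟩
  have h₁ := pd1_comp_liouvilleMap (hy.smooth.differentiableAt_of_isOpen hΩ z.2)
    (hf.1.differentiableAt_of_isOpen hD ⟨z, z.2, rfl⟩)
  rw [dY_apply, map_mul, SmoothFun.eval_mk, SmoothFun.eval_d1,
    pd1_congr hΩ (SmoothFun.eqOn_extend (f := fun w => f (liouvilleMap y w)) hf.2) z.2, h₁,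
    hy.d_x z z.2, smul_eq_mul, inv_mul_cancel_left₀ (hu0 z z.2)]

/-- Since `y_t = -upr = -pr y_x`, the field `∂_t + pr∂_x` annihilates `y` and so is `∂_τ`. -/
theorem Rep.pd2_liouville (hΩ : IsOpen Ω) (hu0 : ∀ z ∈ Ω, u z ≠ 0) (hp : ContDiffOn ℝ ∞ p Ω)
    (hr : ContDiffOn ℝ ∞ r Ω)
    (hy : IsReciprocal Ω u p r y) (hf : Rep (liouvilleMap y '' Ω) (liouvilleMap y) f F) :
    Rep (liouvilleMap y '' Ω) (liouvilleMap y) (pd2 f)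
      (dTau (SmoothFun.d1 hΩ) (SmoothFun.d2 hΩ) (SmoothFun.mk p hp) (SmoothFun.mk r hr) F) := by
  have hu' : ∀ z ∈ Ω, pd1 y z ≠ 0 := fun z hz => by rw [hy.d_x z hz]; exact hu0 z hz
  have hD := isOpen_image_liouvilleMap hΩ hy.smooth hu'
  refine ⟨contDiffOn_pd2 hD hf.1, fun z => ?_⟩
  have h₁ := pd1_comp_liouvilleMap (hy.smooth.differentiableAt_of_isOpen hΩ z.2)
    (hf.1.differentiableAt_of_isOpen hD ⟨z, z.2, rfl⟩)
  have h₂ := pd2_comp_liouvilleMap (hy.smooth.differentiableAt_of_isOpen hΩ z.2)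
    (hf.1.differentiableAt_of_isOpen hD ⟨z, z.2, rfl⟩)
  have he := SmoothFun.eqOn_extend (f := fun w => f (liouvilleMap y w)) hf.2
  rw [dTau_apply, map_add, map_mul, map_mul, SmoothFun.eval_mk, SmoothFun.eval_mk,
    SmoothFun.eval_d1, SmoothFun.eval_d2, pd1_congr hΩ he z.2, pd2_congr hΩ he z.2, h₁, h₂,
    hy.d_x z z.2, hy.d_t z z.2, smul_eq_mul, smul_eq_mul]
  ring

end Derivatives

theorem liouvilleTransform_rep (hΩ : IsOpen Ω) (h : IsThreeDP Ω u v w p r)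
    (hu : ∀ z ∈ Ω, u z ≠ 0) (hv : ∀ z ∈ Ω, v z ≠ 0) (hy : IsReciprocal Ω u p r y)
    {Q₁ Q₂ Q₃ q₁ q₂ : ℝ × ℝ → ℝ} (hQ : IsLiouvilleTransform Ω y u v w p r Q₁ Q₂ Q₃ q₁ q₂) :
    Rep (liouvilleMap y '' Ω) (liouvilleMap y) Q₁ (ringQ₁ (SmoothFun.d1 hΩ)
      (SmoothFun.mk u h.smooth_u) (SmoothFun.mk (fun z => (u z)⁻¹) (h.smooth_u.inv hu))
      (SmoothFun.mk v h.smooth_v) (SmoothFun.mk (fun z => (v z)⁻¹) (h.smooth_v.inv hv))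
      (SmoothFun.mk w h.smooth_w)) ∧
    Rep (liouvilleMap y '' Ω) (liouvilleMap y) Q₂ (ringQ₂ (SmoothFun.d1 hΩ)
      (SmoothFun.mk u h.smooth_u) (SmoothFun.mk (fun z => (u z)⁻¹) (h.smooth_u.inv hu))
      (SmoothFun.mk v h.smooth_v) (SmoothFun.mk (fun z => (v z)⁻¹) (h.smooth_v.inv hv))
      (SmoothFun.mk w h.smooth_w)) ∧
    Rep (liouvilleMap y '' Ω) (liouvilleMap y) Q₃ (ringQ₃
      (SmoothFun.mk (fun z => (u z)⁻¹) (h.smooth_u.inv hu))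
      (SmoothFun.mk v h.smooth_v) (SmoothFun.mk w h.smooth_w)) ∧
    Rep (liouvilleMap y '' Ω) (liouvilleMap y) q₁ (ringq₁ (SmoothFun.mk u h.smooth_u)
      (SmoothFun.mk (fun z => (v z)⁻¹) (h.smooth_v.inv hv)) (SmoothFun.mk p h.smooth_p)) ∧
    Rep (liouvilleMap y '' Ω) (liouvilleMap y) q₂ (ringq₂
      (SmoothFun.mk (fun z => (u z)⁻¹) (h.smooth_u.inv hu))
      (SmoothFun.mk v h.smooth_v) (SmoothFun.mk r h.smooth_r)) := by
  have hu' : ∀ z ∈ Ω, pd1 y z ≠ 0 := fun z hz => by rw [hy.d_x z hz]; exact hu z hz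
  -- Smoothness in the new variables is automatic once the values agree with a ring element.
  have mkRep : ∀ {f : ℝ × ℝ → ℝ} {F : SmoothFun Ω}, (∀ z : Ω, f (liouvilleMap y z) =
      SmoothFun.eval z F) → Rep (liouvilleMap y '' Ω) (liouvilleMap y) f F := fun {f F} hf =>
    ⟨contDiffOn_image_liouvilleMap le_rfl hΩ hy.smooth hu' (SmoothFun.contDiffOn_extend F)
      fun z hz => (hf ⟨z, hz⟩).trans (SmoothFun.extend_apply F ⟨z, hz⟩).symm, hf⟩
  have ru := Rep.mk_id h.smooth_u
  have rv := Rep.mk_id h.smooth_v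
  have rw' := Rep.mk_id h.smooth_w
  have rui := Rep.mk_id (f := fun z => (u z)⁻¹) (h.smooth_u.inv hu)
  have rvi := Rep.mk_id (f := fun z => (v z)⁻¹) (h.smooth_v.inv hv)
  have hb : Rep Ω id (liouvilleB u v w) (ringB (SmoothFun.d1 hΩ) _ _ _ _ _) :=
    Rep.congr_fun (((rv.mul rw').mul (rui.mul rui)).add ((Rep.ofNat 2).mul
      ((ru.pd1_id hΩ).mul rui)) |>.sub ((rv.pd1_id hΩ).mul rvi)) fun z => by
        simp [liouvilleB, div_eq_mul_inv, sq]
  refine ⟨mkRep fun z => ?_, mkRep fun z => ?_, mkRep fun z => ?_, mkRep fun z => ?_,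
    mkRep fun z => ?_⟩
  · rw [(hQ z z.2).1, liouvilleP₁, ringQ₁]
    simp only [map_mul, map_add, map_sub, map_one, ← hb.2, ←
        (hb.pd1_id hΩ).2, SmoothFun.eval_mk, id]
    rw [div_eq_mul_inv, sq, sq, mul_inv]
  · rw [(hQ z z.2).2.1, liouvilleP₂, ringQ₂]
    simp only [map_mul, map_add, map_sub, map_ofNat, ← (ru.pd1_id hΩ).2, ← (rv.pd1_id hΩ).2,
      SmoothFun.eval_mk, id]
    rw [div_eq_mul_inv, div_eq_mul_inv, ← inv_pow]
    ring
  · rw [(hQ z z.2).2.2.1, liouvilleP₃, ringQ₃]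
    simp only [map_mul, SmoothFun.eval_mk]
    rw [div_eq_mul_inv, ← inv_pow]
    ring
  · rw [(hQ z z.2).2.2.2.1, ringq₁]
    simp only [map_mul, SmoothFun.eval_mk]
    rw [div_eq_mul_inv, sq]
  · rw [(hQ z z.2).2.2.2.2, ringq₂]
    simp only [map_mul, SmoothFun.eval_mk]
    rw [div_eq_mul_inv]

theorem isAssocThreeDP_of_liouville (hΩ : IsOpen Ω) (h : IsThreeDP Ω u v w p r)
    (hu : ∀ z ∈ Ω, u z ≠ 0) (hv : ∀ z ∈ Ω, v z ≠ 0) (hy : IsReciprocal Ω u p r y)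
    {Q₁ Q₂ Q₃ q₁ q₂ : ℝ × ℝ → ℝ} (hQ : IsLiouvilleTransform Ω y u v w p r Q₁ Q₂ Q₃ q₁ q₂) :
    IsAssocThreeDP (liouvilleMap y '' Ω) Q₁ Q₂ Q₃ q₁ q₂ := by
  have hrel := threeDPRelations hΩ h hu hv
  obtain ⟨e₁, e₂, e₃, s₁, s₂, -⟩ := liouville_identities hrel fun _ _ => SmoothFun.separates
  obtain ⟨R₁, R₂, R₃, r₁, r₂⟩ := liouvilleTransform_rep hΩ h hu hv hy hQ
  have hd : ∀ {f F}, Rep (liouvilleMap y '' Ω) (liouvilleMap y) f F →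
      Rep (liouvilleMap y '' Ω) (liouvilleMap y) (pd1 f)
        (dY (SmoothFun.d1 hΩ) (SmoothFun.mk (fun z => (u z)⁻¹) (h.smooth_u.inv hu)) F) :=
    Rep.pd1_liouville hΩ h.smooth_u hu hy
  have hA := Rep.assocRHS hd R₁ R₂ R₃ r₁ r₂
  refine ⟨R₁.1, R₂.1, R₃.1, r₁.1, r₂.1, ?_, ?_, ?_, ?_, ?_⟩ <;> rintro _ ⟨z, hz, rfl⟩
  · rw [(R₁.pd2_liouville hΩ hu h.smooth_p h.smooth_r hy).2 ⟨z, hz⟩, e₁]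
    exact ((hA 0).2 ⟨z, hz⟩).symm
  · rw [(R₂.pd2_liouville hΩ hu h.smooth_p h.smooth_r hy).2 ⟨z, hz⟩, e₂]
    exact ((hA 1).2 ⟨z, hz⟩).symm
  · rw [(R₃.pd2_liouville hΩ hu h.smooth_p h.smooth_r hy).2 ⟨z, hz⟩, e₃]
    exact ((hA 2).2 ⟨z, hz⟩).symm
  · rw [(Rep.S₁ hd R₁ R₂ R₃ r₁).2 ⟨z, hz⟩, s₁, map_zero]
  · rw [(Rep.S₂ hd R₁ R₂ R₃ r₂).2 ⟨z, hz⟩, s₂, map_zero]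

end LiouvilleSolutions

/-! ## Existence of the new space variable and of the gauge exponent -/

section Existence

variable {Ω : Set (ℝ × ℝ)} {u v w p r : ℝ × ℝ → ℝ}

theorem exists_isReciprocal (hΩ : IsOpen Ω) (hc : Convex ℝ Ω) (h : IsThreeDP Ω u v w p r) :
    ∃ y, IsReciprocal Ω u p r y := by
  have hs : ContDiffOn ℝ ∞ (u * p * r) Ω := (h.smooth_u.mul h.smooth_p).mul h.smooth_r
  obtain ⟨y, hy, h₁, h₂⟩ := exists_potential hΩ hc h.smooth_u hs.neg fun z hz => by
    rw [eq_neg_of_add_eq_zero_left (h.eq_u z hz)]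
    exact (hasDerivAt_pd1 (hs.differentiableAt_of_isOpen hΩ hz)).neg.deriv.symm
  exact ⟨y, hy, h₁, h₂⟩

theorem exists_isGaugeExponent (hΩ : IsOpen Ω) (hc : Convex ℝ Ω) (h : IsThreeDP Ω u v w p r)
    (hu : ∀ z ∈ Ω, u z ≠ 0) (hv : ∀ z ∈ Ω, v z ≠ 0) : ∃ E, IsGaugeExponent Ω u v w p r E := by
  obtain ⟨-, -, -, -, -, hcl⟩ := liouville_identities (threeDPRelations hΩ h hu hv) fun _ _ =>
    SmoothFun.separates
  have rui := Rep.mk_id (f := fun z => (u z)⁻¹) (h.smooth_u.inv hu)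
  have rp := Rep.mk_id h.smooth_p
  have rr := Rep.mk_id h.smooth_r
  have hα : Rep Ω id (fun z => v z * w z / u z ^ 2) _ :=
    (((Rep.mk_id h.smooth_v).mul (Rep.mk_id h.smooth_w)).mul (rui.mul rui)).congr_fun fun z => by
      simp [div_eq_mul_inv, sq]
  have hβ : Rep Ω id (fun z => p z * pd1 r z - pd1 p z * r z
      - p z * r z * (v z * w z / u z ^ 2)) _ :=
    (((rp.mul (rr.pd1_id hΩ)).sub ((rp.pd1_id hΩ).mul rr)).sub ((rp.mul rr).mul hα)).congr_fun
      fun z => by simp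
  obtain ⟨E, hE, h₁, h₂⟩ := exists_potential hΩ hc hα.1 hβ.1 fun z hz => by
    have e₁ := (hα.pd2_id hΩ).2 ⟨z, hz⟩
    have e₂ := (hβ.pd1_id hΩ).2 ⟨z, hz⟩
    exact e₁.trans ((congrArg _ hcl).trans e₂.symm)
  exact ⟨E, hE, h₁, h₂⟩

/-- Any potential `y` satisfies `∫ u = lim (y(x, t) - y(s, t))` as `s → -∞`, so the integral differs
from `y` by a function of `t` alone, to be shown constant. -/
theorem isReciprocal_integral {J : Set ℝ} (hJ : IsOpen J) (hJ' : J.OrdConnected)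
    (h : IsThreeDP (Set.univ ×ˢ J) u v w p r)
    (hint : ∀ t ∈ J, ∀ x, MeasureTheory.IntegrableOn (fun ξ => u (ξ, t)) (Set.Iic x))
    (hlim : TendstoLocallyUniformlyOn (fun x t => u (x, t) * p (x, t) * r (x, t)) (fun _ => 0)
      Filter.atBot J) :
    IsReciprocal (Set.univ ×ˢ J) u p r (fun z => ∫ ξ in Set.Iic z.1, u (ξ, z.2)) := by
  have hΩ : IsOpen (Set.univ ×ˢ J : Set (ℝ × ℝ)) := isOpen_univ.prod hJ
  obtain ⟨y, hy⟩ := exists_isReciprocal hΩ (convex_univ.prod hJ'.convex) h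
  have hI : ∀ t ∈ J, ∀ x, Filter.Tendsto (fun s => y (x, t) - y (s, t)) Filter.atBot
      (nhds (∫ ξ in Set.Iic x, u (ξ, t))) := fun t ht x => by
    refine (MeasureTheory.intervalIntegral_tendsto_integral_Iic x (hint t ht x)
      Filter.tendsto_id).congr fun s => ?_
    refine intervalIntegral.integral_eq_sub_of_hasDerivAt (f := fun s => y (s, t))
      (fun ξ _ => ?_) ?_
    · have := hasDerivAt_pd1 (hy.smooth.differentiableAt_of_isOpen hΩ
        (show (ξ, t) ∈ Set.univ ×ˢ J from ⟨trivial, ht⟩))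
      rwa [hy.d_x _ ⟨trivial, ht⟩] at this
    · refine Continuous.intervalIntegrable (continuous_iff_continuousAt.2 fun ξ => ?_) _ _
      have hu : ContinuousAt u (ξ, t) :=
        (h.smooth_u.differentiableAt_of_isOpen hΩ ⟨trivial, ht⟩).continuousAt
      exact hu.comp (f := fun ξ => (ξ, t)) (by fun_prop)
  -- The difference is the limit of `-y(s, t)`, whose `t`-derivatives `upr` tend to zero locally
  -- uniformly; derivative and limit may be exchanged, and `J` is connected.
  obtain ⟨c, hc⟩ : ∃ c : ℝ, ∀ t ∈ J, (∫ ξ in Set.Iic 0, u (ξ, t)) - y (0, t) = c := by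
    have hd : ∀ t ∈ J, HasDerivAt (fun t => (∫ ξ in Set.Iic 0, u (ξ, t)) - y (0, t)) 0 t :=
      fun t ht => by
        refine hasDerivAt_of_tendstoLocallyUniformlyOn (f := fun s t => -y (s, t)) hJ hlim
          (Filter.Eventually.of_forall fun s t ht => ?_) (fun t ht => ?_) ht
        · have := (hasDerivAt_pd2 (hy.smooth.differentiableAt_of_isOpen hΩ
            (show (s, t) ∈ Set.univ ×ˢ J from ⟨trivial, ht⟩))).neg
          rwa [hy.d_t _ ⟨trivial, ht⟩, neg_neg] at this
        · exact ((hI t ht 0).sub_const (y (0, t))).congr fun s => by ring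
    rcases J.eq_empty_or_nonempty with rfl | ⟨t₀, ht₀⟩
    · exact ⟨0, fun t ht => ht.elim⟩
    · exact ⟨_, fun t ht => hJ.is_const_of_deriv_eq_zero hJ'.isPreconnected
        (fun s hs => (hd s hs).differentiableAt.differentiableWithinAt)
        (fun s hs => (hd s hs).deriv) ht ht₀⟩
  have heq : Set.EqOn (fun z => ∫ ξ in Set.Iic z.1, u (ξ, z.2)) (fun z => y z + c)
      (Set.univ ×ˢ J) := by
    rintro ⟨x, t⟩ ⟨-, ht⟩
    have h₁ : (∫ ξ in Set.Iic x, u (ξ, t)) =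
        (∫ ξ in Set.Iic 0, u (ξ, t)) + (y (x, t) - y (0, t)) :=
      tendsto_nhds_unique (hI t ht x)
        (((hI t ht 0).add_const (y (x, t) - y (0, t))).congr fun s => by ring)
    have h₂ := hc t ht
    simp only
    linarith
  refine ⟨(hy.smooth.add contDiffOn_const).congr heq, fun z hz => ?_, fun z hz => ?_⟩
  · rw [pd1_congr hΩ heq hz, ← hy.d_x z hz]
    exact ((hasDerivAt_pd1 (hy.smooth.differentiableAt_of_isOpen hΩ hz)).add_const c).deriv
  · rw [pd2_congr hΩ heq hz, ← hy.d_t z hz]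
    exact ((hasDerivAt_pd2 (hy.smooth.differentiableAt_of_isOpen hΩ hz)).add_const c).deriv

end Existence

/-! ## Gauge transformations and changes of variables of linear systems -/

section LinearSystems

variable {Ω : Set (ℝ × ℝ)} {φ χ : ℝ × ℝ → Fin 3 → ℂ} {M K U V U' V' : ℝ × ℝ → Matrix (Fin 3)
    (Fin 3) ℂ}

theorem pd1_mulVec {z : ℝ × ℝ} (hM : ∀ i j, DifferentiableAt ℝ (fun z => M z i j) z)
    (hφ : DifferentiableAt ℝ φ z) :
    pd1 (fun z => (M z).mulVec (φ z)) z =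
      (Matrix.of fun i j => pd1 (fun z => M z i j) z).mulVec (φ z) + (M z).mulVec (pd1 φ z) := by
  have h := hasDerivAt_pi.2 fun i => HasDerivAt.fun_sum (u := Finset.univ) fun j _ =>
    (hasDerivAt_pd1 (hM i j)).mul (hasDerivAt_pi.1 (hasDerivAt_pd1 hφ) j)
  refine (HasDerivAt.deriv h).trans ?_
  funext i
  simp [Matrix.mulVec, dotProduct, Finset.sum_add_distrib]

theorem pd2_mulVec {z : ℝ × ℝ} (hM : ∀ i j, DifferentiableAt ℝ (fun z => M z i j) z)
    (hφ : DifferentiableAt ℝ φ z) :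
    pd2 (fun z => (M z).mulVec (φ z)) z =
      (Matrix.of fun i j => pd2 (fun z => M z i j) z).mulVec (φ z) + (M z).mulVec (pd2 φ z) := by
  have h := hasDerivAt_pi.2 fun i => HasDerivAt.fun_sum (u := Finset.univ) fun j _ =>
    (hasDerivAt_pd2 (hM i j)).mul (hasDerivAt_pi.1 (hasDerivAt_pd2 hφ) j)
  refine (HasDerivAt.deriv h).trans ?_
  funext i
  simp [Matrix.mulVec, dotProduct, Finset.sum_add_distrib]

theorem differentiableOn_mulVec (hM : ∀ i j, DifferentiableOn ℝ (fun z => M z i j) Ω)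
    (hφ : DifferentiableOn ℝ φ Ω) : DifferentiableOn ℝ (fun z => (M z).mulVec (φ z)) Ω :=
  differentiableOn_pi.2 fun i =>
    show DifferentiableOn ℝ (fun z => ∑ j, M z i j * φ z j) Ω from
      DifferentiableOn.fun_sum fun j _ => (hM i j).fun_mul (differentiableOn_pi.1 hφ j)

/-- Differentiating `χ = Mφ` and using the intertwining relations shows that the residuals of the
two systems differ by the factor `M`, which is injective. The inverse `K` also carries
differentiability back from `χ` to `φ`. -/
theorem isLaxSolution_gauge (hΩ : IsOpen Ω) (hM : ∀ i j, DifferentiableOn ℝ (fun z => M z i j) Ω)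
    (hK : ∀ i j, DifferentiableOn ℝ (fun z => K z i j) Ω) (hKM : ∀ z ∈ Ω, K z * M z = 1)
    (hχ : ∀ z ∈ Ω, χ z = (M z).mulVec (φ z))
    (h₁ : ∀ z ∈ Ω, (Matrix.of fun i j => pd1 (fun z => M z i j) z) + M z * U z = U' z * M z)
    (h₂ : ∀ z ∈ Ω, (Matrix.of fun i j => pd2 (fun z => M z i j) z) + M z * V z = V' z * M z) :
    IsLaxSolution Ω U V φ ↔ IsLaxSolution Ω U' V' χ := by
  have hφ : ∀ z ∈ Ω, φ z = (K z).mulVec (χ z) := fun z hz => by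
    rw [hχ z hz, Matrix.mulVec_mulVec, hKM z hz, Matrix.one_mulVec]
  have hd : DifferentiableOn ℝ φ Ω ↔ DifferentiableOn ℝ χ Ω :=
    ⟨fun h => (differentiableOn_mulVec hM h).congr hχ,
      fun h => (differentiableOn_mulVec hK h).congr hφ⟩
  have hinj : ∀ z ∈ Ω, Function.Injective (M z).mulVec := fun z hz x y hxy => by
    have := congrArg (K z).mulVec hxy
    simpa only [Matrix.mulVec_mulVec, hKM z hz, Matrix.one_mulVec] using this
  unfold IsLaxSolution
  rw [← hd]
  refine and_congr_right fun h => forall₂_congr fun z hz => and_congr ?_ ?_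
  · rw [pd1_congr hΩ hχ hz, pd1_mulVec (fun i j => (hM i j).differentiableAt (hΩ.mem_nhds hz))
      (h.differentiableAt (hΩ.mem_nhds hz)), hχ z hz, Matrix.mulVec_mulVec, ← h₁ z hz,
      Matrix.add_mulVec, add_right_inj, ← Matrix.mulVec_mulVec]
    exact (hinj z hz).eq_iff.symm
  · rw [pd2_congr hΩ hχ hz, pd2_mulVec (fun i j => (hM i j).differentiableAt (hΩ.mem_nhds hz))
      (h.differentiableAt (hΩ.mem_nhds hz)), hχ z hz, Matrix.mulVec_mulVec, ← h₂ z hz,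
      Matrix.add_mulVec, add_right_inj, ← Matrix.mulVec_mulVec]
    exact (hinj z hz).eq_iff.symm

variable {u p r y : ℝ × ℝ → ℝ}

theorem isLaxSolution_comp_liouvilleMap (hΩ : IsOpen Ω) (hu : ∀ z ∈ Ω, u z ≠ 0)
    (hy : IsReciprocal Ω u p r y) {Φ : ℝ × ℝ → Fin 3 → ℂ} :
    IsLaxSolution Ω (fun z => (u z : ℂ) • U (liouvilleMap y z))
      (fun z => V (liouvilleMap y z)
        - ((u z * p z * r z : ℝ) : ℂ) • U (liouvilleMap y z)) (fun z => Φ (liouvilleMap y z)) ↔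
    IsLaxSolution (liouvilleMap y '' Ω) U V Φ := by
  have hu' : ∀ z ∈ Ω, pd1 y z ≠ 0 := fun z hz => by rw [hy.d_x z hz]; exact hu z hz
  have hD := isOpen_image_liouvilleMap hΩ hy.smooth hu'
  have hdiff : DifferentiableOn ℝ (fun z => Φ (liouvilleMap y z)) Ω ↔
      DifferentiableOn ℝ Φ (liouvilleMap y '' Ω) :=
    ⟨fun h => differentiableOn_image_liouvilleMap hΩ hy.smooth hu' h fun _ _ => rfl,
      fun h => h.comp ((contDiffOn_liouvilleMap hy.smooth).differentiableOn (by simp))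
        (Set.mapsTo_image _ _)⟩
  unfold IsLaxSolution
  rw [hdiff, Set.forall_mem_image]
  refine and_congr_right fun h => forall₂_congr fun z hz => ?_
  have hyz := hy.smooth.differentiableAt_of_isOpen hΩ hz
  have hΦ := h.differentiableAt (hD.mem_nhds ⟨z, hz, rfl⟩)
  rw [pd1_comp_liouvilleMap hyz hΦ, pd2_comp_liouvilleMap hyz hΦ, hy.d_x z hz, hy.d_t z hz,
    Matrix.sub_mulVec, Matrix.smul_mulVec, Matrix.smul_mulVec, ← Complex.coe_smul (u z),
    ← Complex.coe_smul (-(u z * p z * r z))]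
  have hc : (u z : ℂ) ≠ 0 := Complex.ofReal_ne_zero.2 (hu z hz)
  rw [(smul_right_injective _ hc).eq_iff]
  -- The spatial equation replaces `∂_y Φ` in the chain rule for the time derivative.
  refine and_congr_right fun h₁ => ?_
  rw [h₁, Complex.ofReal_neg, neg_smul, neg_add_eq_sub, sub_left_inj]

end LinearSystems

/-! ## The gauge transformation between the Lax pairs -/

section GaugeAlgebra

/-- The shape of the gauge transformation. -/
def gaugeMat (μ A B C G : ℂ) : Matrix (Fin 3) (Fin 3) ℂ :=
  !![A, 0, 0; B, C, 0; A * μ, 0, G * μ⁻¹]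

/-- The shape of the inverse gauge transformation. -/
def gaugeMatInv (μ A B C G : ℂ) : Matrix (Fin 3) (Fin 3) ℂ :=
  !![A, 0, 0; B, C, 0; G * (-μ ^ 2), 0, G * μ]

variable {R : Type*} [CommRing R] [Algebra ℝ R] {d₁ d₂ : Derivation ℝ R R}
  {u u' v v' w p r a a' : R}

/-- `-b` is the logarithmic derivative of `a`, so the term with `e^{-E}` only rescales both sides
and the entries are rational in the remaining fields. -/
theorem gauge_identity₁ (h : ThreeDPRelations d₁ d₂ u u' v v' w p r) (ha : a * a' = 1)
    (ha₁ : d₁ a = -(ringB d₁ u u' v v' w * a)) (e : R →ₐ[ℝ] ℂ) {μ : ℂ} (hμ : μ ≠ 0) :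
    gaugeMat μ (e (d₁ a')) (e (d₁ (-(u' * (a' * a' * d₁ a))))) (e (d₁ (u' * a')))
        (e (d₁ (v * u' * u' * a')))
      + gaugeMat μ (e a') (e (-(u' * (a' * a' * d₁ a)))) (e (u' * a')) (e (v * u' * u' * a')) *
        !![0, 1, 0; 1 + μ ^ 2 * e u ^ 2, 0, e v; μ ^ 2 * e w, 0, 0] =
    (e u • !![0, 1, 0;
        e (ringQ₁ d₁ u u' v v' w), e (ringQ₂ d₁ u u' v v' w), μ;
        0, μ, e (ringQ₃ u' v w)]) *
      gaugeMat μ (e a') (e (-(u' * (a' * a' * d₁ a)))) (e (u' * a')) (e (v * u' * u' * a')) := by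
  have hu : e u * e u' = 1 := by rw [← map_mul, h.inv_u, map_one]
  have hv : e v * e v' = 1 := by rw [← map_mul, h.inv_v, map_one]
  have hα : e a * e a' = 1 := by rw [← map_mul, ha, map_one]
  have hu0 := left_ne_zero_of_mul_eq_one hu
  have hv0 := left_ne_zero_of_mul_eq_one hv
  have ha0 := left_ne_zero_of_mul_eq_one hα
  ext i j
  fin_cases i <;> fin_cases j <;>
  simp [gaugeMat, Matrix.mul_apply, Fin.sum_univ_three, ringQ₁, ringQ₂, ringQ₃, ringB, ha₁,
    derivation_inv _ ha, derivation_inv _ h.inv_u, derivation_inv _ h.inv_v, derivation_ofNat,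
    map_ofNat, h.d₁_d₁_p, h.d₁_d₁_r, eq_inv_of_mul_eq_one_right hu, eq_inv_of_mul_eq_one_right hv,
    eq_inv_of_mul_eq_one_right hα] <;>
  field_simp <;> ring

set_option maxHeartbeats 4000000 in
theorem gauge_identity₂ (h : ThreeDPRelations d₁ d₂ u u' v v' w p r) (ha : a * a' = 1)
    (ha₁ : d₁ a = -(ringB d₁ u u' v v' w * a))
    (ha₂ : d₂ a = (d₂ v * v' - 2 * (d₂ u * u')
      - (p * d₁ r - d₁ p * r - p * r * (v * w * (u' * u')))) * a)
    (e : R →ₐ[ℝ] ℂ) {μ : ℂ} (hμ : μ ≠ 0) :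
    gaugeMat μ (e (d₂ a')) (e (d₂ (-(u' * (a' * a' * d₁ a))))) (e (d₂ (u' * a')))
        (e (d₂ (v * u' * u' * a')))
      + gaugeMat μ (e a') (e (-(u' * (a' * a' * d₁ a)))) (e (u' * a')) (e (v * u' * u' * a')) *
        !![1 / (3 * μ ^ 2) + e p * e (d₁ r), -(e p * e r), e p / μ ^ 2;
          e (d₁ p) * e (d₁ r) - μ ^ 2 * e u ^ 2 * e p * e r, 1 / (3 * μ ^ 2) - e (d₁ p) * e r,
            e (d₁ p) / μ ^ 2 - e v * e p * e r;
          -(μ ^ 2 * e w * e p * e r) - e (d₁ r), e r,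
            e (d₁ p) * e r - e p * e (d₁ r) - 2 / (3 * μ ^ 2)] =
    (!![1 / (3 * μ ^ 2), 0, e (ringq₁ u v' p) / μ;
        0, 1 / (3 * μ ^ 2) + e (ringq₁ u v' p),
          (e (ringQ₃ u' v w) * e (ringq₁ u v' p) + e (dY d₁ u' (ringq₁ u v' p))) / μ;
        (1 - e (dY d₁ u' (ringq₂ u' v r)) + (e (ringQ₃ u' v w) - e (ringQ₂ d₁ u u' v v' w))
          * e (ringq₂ u' v r)) / μ, e (ringq₂ u' v r) / μ, e (ringq₁ u v' p) - 2 / (3 * μ ^ 2)]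
      - (e u * e p * e r) • !![0, 1, 0;
        e (ringQ₁ d₁ u u' v v' w), e (ringQ₂ d₁ u u' v v' w), μ;
        0, μ, e (ringQ₃ u' v w)]) *
      gaugeMat μ (e a') (e (-(u' * (a' * a' * d₁ a)))) (e (u' * a')) (e (v * u' * u' * a')) := by
  have hu : e u * e u' = 1 := by rw [← map_mul, h.inv_u, map_one]
  have hv : e v * e v' = 1 := by rw [← map_mul, h.inv_v, map_one]
  have hα : e a * e a' = 1 := by rw [← map_mul, ha, map_one]
  have hu0 := left_ne_zero_of_mul_eq_one hu
  have hv0 := left_ne_zero_of_mul_eq_one hv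
  have ha0 := left_ne_zero_of_mul_eq_one hα
  ext i j
  fin_cases i <;> fin_cases j <;>
  simp [gaugeMat, Matrix.mul_apply, Fin.sum_univ_three, ringQ₁, ringQ₂, ringQ₃, ringB, ringq₁,
    ringq₂, dY_apply, h.comm, ha₁, ha₂, h.d₂_u, h.d₂_v, h.d₂_w,
    derivation_inv _ ha, derivation_inv _ h.inv_u, derivation_inv _ h.inv_v, derivation_ofNat,
    map_ofNat, h.d₁_d₁_p, h.d₁_d₁_r, eq_inv_of_mul_eq_one_right hu, eq_inv_of_mul_eq_one_right hv,
    eq_inv_of_mul_eq_one_right hα] <;>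
  field_simp <;> ring

end GaugeAlgebra

/-! ### Equivalence of the Lax pairs for functions -/

section GaugeLax

variable {Ω : Set (ℝ × ℝ)} {u v w p r y E : ℝ × ℝ → ℝ}

/-- Complex-valued evaluation at a point. -/
def SmoothFun.ceval (z : Ω) : SmoothFun Ω →ₐ[ℝ] ℂ := Complex.ofRealAm.comp (SmoothFun.eval z)

theorem SmoothFun.ofReal_extend (F : SmoothFun Ω) (z : Ω) :
    (SmoothFun.extend F z : ℂ) = SmoothFun.ceval z F := by
  rw [SmoothFun.extend_apply]; rfl

theorem SmoothFun.differentiableOn_ofReal_extend_mul (F : SmoothFun Ω) (c : ℂ) :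
    DifferentiableOn ℝ (fun z => (SmoothFun.extend F z : ℂ) * c) Ω :=
  (Complex.ofRealCLM.differentiable.comp_differentiableOn
    ((SmoothFun.contDiffOn_extend F).differentiableOn (by simp))).mul_const c

theorem SmoothFun.pd1_ofReal_extend_mul (hΩ : IsOpen Ω) (F : SmoothFun Ω) (c : ℂ) (z : Ω) :
    pd1 (fun z => (SmoothFun.extend F z : ℂ) * c) z = SmoothFun.ceval z (SmoothFun.d1 hΩ F) * c :=
  ((hasDerivAt_pd1 ((SmoothFun.contDiffOn_extend F).differentiableAt_of_isOpen hΩ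
    z.2)).ofReal_comp.mul_const c).deriv

theorem SmoothFun.pd2_ofReal_extend_mul (hΩ : IsOpen Ω) (F : SmoothFun Ω) (c : ℂ) (z : Ω) :
    pd2 (fun z => (SmoothFun.extend F z : ℂ) * c) z = SmoothFun.ceval z (SmoothFun.d2 hΩ F) * c :=
  ((hasDerivAt_pd2 ((SmoothFun.contDiffOn_extend F).differentiableAt_of_isOpen hΩ
    z.2)).ofReal_comp.mul_const c).deriv

/-- A family of gauge matrices with smooth entries. -/
def gaugeField (μ : ℂ) (A B C G : SmoothFun Ω) (z : ℝ × ℝ) : Matrix (Fin 3) (Fin 3) ℂ :=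
  gaugeMat μ (SmoothFun.extend A z) (SmoothFun.extend B z) (SmoothFun.extend C z)
    (SmoothFun.extend G z)

/-- A family of inverse gauge matrices with smooth entries. -/
def gaugeFieldInv (μ : ℂ) (A B C G : SmoothFun Ω) (z : ℝ × ℝ) : Matrix (Fin 3) (Fin 3) ℂ :=
  gaugeMatInv μ (SmoothFun.extend A z) (SmoothFun.extend B z) (SmoothFun.extend C z)
    (SmoothFun.extend G z)

theorem gaugeField_apply (μ : ℂ) (A B C G : SmoothFun Ω) (z : Ω) :
    gaugeField μ A B C G z = gaugeMat μ (SmoothFun.ceval z A) (SmoothFun.ceval z B)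
      (SmoothFun.ceval z C) (SmoothFun.ceval z G) := by
  simp only [gaugeField, SmoothFun.ofReal_extend]

theorem gaugeFieldInv_apply (μ : ℂ) (A B C G : SmoothFun Ω) (z : Ω) :
    gaugeFieldInv μ A B C G z = gaugeMatInv μ (SmoothFun.ceval z A) (SmoothFun.ceval z B)
      (SmoothFun.ceval z C) (SmoothFun.ceval z G) := by
  simp only [gaugeFieldInv, SmoothFun.ofReal_extend]

theorem differentiableOn_gaugeField (μ : ℂ) (A B C G : SmoothFun Ω) (i j : Fin 3) :
    DifferentiableOn ℝ (fun z => gaugeField μ A B C G z i j) Ω := by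
  have h₁ := fun F : SmoothFun Ω => by
    simpa using SmoothFun.differentiableOn_ofReal_extend_mul F 1
  have h := @SmoothFun.differentiableOn_ofReal_extend_mul Ω
  fin_cases i <;> fin_cases j
  exacts [h₁ A, differentiableOn_const 0, differentiableOn_const 0, h₁ B, h₁ C,
    differentiableOn_const 0, h A _, differentiableOn_const 0, h G _]

theorem differentiableOn_gaugeFieldInv (μ : ℂ) (A B C G : SmoothFun Ω) (i j : Fin 3) :
    DifferentiableOn ℝ (fun z => gaugeFieldInv μ A B C G z i j) Ω := by
  have h₁ := fun F : SmoothFun Ω => by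
    simpa using SmoothFun.differentiableOn_ofReal_extend_mul F 1
  have h := @SmoothFun.differentiableOn_ofReal_extend_mul Ω
  fin_cases i <;> fin_cases j
  exacts [h₁ A, differentiableOn_const 0, differentiableOn_const 0, h₁ B, h₁ C,
    differentiableOn_const 0, h G _, differentiableOn_const 0, h G _]

theorem pd1_gaugeField (hΩ : IsOpen Ω) (μ : ℂ) (A B C G : SmoothFun Ω) (z : Ω) :
    (Matrix.of fun i j => pd1 (fun z => gaugeField μ A B C G z i j) z) =
      gaugeMat μ (SmoothFun.ceval z (SmoothFun.d1 hΩ A)) (SmoothFun.ceval z (SmoothFun.d1 hΩ B))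
        (SmoothFun.ceval z (SmoothFun.d1 hΩ C)) (SmoothFun.ceval z (SmoothFun.d1 hΩ G)) := by
  have h₁ := fun F : SmoothFun Ω => by
    simpa using SmoothFun.pd1_ofReal_extend_mul hΩ F 1 z
  have h := fun F c => SmoothFun.pd1_ofReal_extend_mul hΩ F c z
  ext i j
  fin_cases i <;> fin_cases j
  exacts [h₁ A, pd1_const 0 _, pd1_const 0 _, h₁ B, h₁ C, pd1_const 0 _, h A _, pd1_const 0 _,
    h G _]

theorem pd2_gaugeField (hΩ : IsOpen Ω) (μ : ℂ) (A B C G : SmoothFun Ω) (z : Ω) :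
    (Matrix.of fun i j => pd2 (fun z => gaugeField μ A B C G z i j) z) =
      gaugeMat μ (SmoothFun.ceval z (SmoothFun.d2 hΩ A)) (SmoothFun.ceval z (SmoothFun.d2 hΩ B))
        (SmoothFun.ceval z (SmoothFun.d2 hΩ C)) (SmoothFun.ceval z (SmoothFun.d2 hΩ G)) := by
  have h₁ := fun F : SmoothFun Ω => by
    simpa using SmoothFun.pd2_ofReal_extend_mul hΩ F 1 z
  have h := fun F c => SmoothFun.pd2_ofReal_extend_mul hΩ F c z
  ext i j
  fin_cases i <;> fin_cases j
  exacts [h₁ A, pd2_const 0 _, pd2_const 0 _, h₁ B, h₁ C, pd2_const 0 _, h A _, pd2_const 0 _,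
    h G _]

theorem contDiffOn_gaugeFactor (h : IsThreeDP Ω u v w p r) (hu : ∀ z ∈ Ω, u z ≠ 0)
    (hE : IsGaugeExponent Ω u v w p r E) : ContDiffOn ℝ ∞ (gaugeFactor u v E) Ω :=
  (h.smooth_v.div (h.smooth_u.pow 2) fun z hz => pow_ne_zero 2 (hu z hz)).mul hE.smooth.neg.exp

theorem gaugeFactor_ne_zero {z : ℝ × ℝ} (hu : u z ≠ 0) (hv : v z ≠ 0) : gaugeFactor u v E z ≠ 0 :=
  mul_ne_zero (div_ne_zero hv (pow_ne_zero 2 hu)) (Real.exp_ne_zero _)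

/-- Logarithmic derivatives of `a = v u⁻² e^{-E}`; the two equations for `E` remove the exponential
from them. The ring elements are named by equations so that they can be treated as opaque. -/
theorem derivations_gaugeFactor (hΩ : IsOpen Ω) (h : IsThreeDP Ω u v w p r)
    (hu : ∀ z ∈ Ω, u z ≠ 0) (hv : ∀ z ∈ Ω, v z ≠ 0) (hE : IsGaugeExponent Ω u v w p r E)
    {U U' V V' W P R' a : SmoothFun Ω} (hU : U = SmoothFun.mk u h.smooth_u)
    (hU' : U' = SmoothFun.mk (fun z => (u z)⁻¹) (h.smooth_u.inv hu))
    (hV : V = SmoothFun.mk v h.smooth_v)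
    (hV' : V' = SmoothFun.mk (fun z => (v z)⁻¹) (h.smooth_v.inv hv))
    (hW : W = SmoothFun.mk w h.smooth_w) (hP : P = SmoothFun.mk p h.smooth_p)
    (hR : R' = SmoothFun.mk r h.smooth_r)
    (ha : a = SmoothFun.mk (gaugeFactor u v E) (contDiffOn_gaugeFactor h hu hE)) :
    SmoothFun.d1 hΩ a = -(ringB (SmoothFun.d1 hΩ) U U' V V' W * a) ∧
    SmoothFun.d2 hΩ a = (SmoothFun.d2 hΩ V * V' - 2 * (SmoothFun.d2 hΩ U * U')
      - (P * SmoothFun.d1 hΩ R' - SmoothFun.d1 hΩ P * R' - P * R' * (V * W * (U' * U')))) * a := by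
  have hrel := threeDPRelations hΩ h hu hv
  rw [← hU, ← hU', ← hV, ← hV', ← hW, ← hP, ← hR] at hrel
  have rp := Rep.mk_id h.smooth_p
  have rr := Rep.mk_id h.smooth_r
  have hX : ContDiffOn ℝ ∞ (fun z => Real.exp (-E z)) Ω := hE.smooth.neg.exp
  obtain ⟨X, hXe⟩ : ∃ X, X = SmoothFun.mk (fun z => Real.exp (-E z)) hX := ⟨_, rfl⟩
  have rX := Rep.mk_id hX
  have haX : a = V * (U' * U') * X := by
    rw [ha, hV, hU', hXe]
    refine SmoothFun.eq_of_eval fun z => ?_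
    simp [gaugeFactor, div_eq_mul_inv, sq]
  have hX₁ : SmoothFun.d1 hΩ X = -(X * (V * W * (U' * U'))) := SmoothFun.eq_of_eval fun z => by
    rw [hXe, ← (rX.pd1_id hΩ).2, hV, hW, hU']
    have := (hasDerivAt_pd1 (hE.smooth.differentiableAt_of_isOpen hΩ z.2)).neg.exp.deriv
    rw [hE.d_x z z.2] at this
    refine (Eq.trans ?_ this).trans ?_
    · rfl
    · simp [div_eq_mul_inv, sq]
  have hX₂ : SmoothFun.d2 hΩ X = -(X * (P * SmoothFun.d1 hΩ R' - SmoothFun.d1 hΩ P * R'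
      - P * R' * (V * W * (U' * U')))) := SmoothFun.eq_of_eval fun z => by
    rw [hXe, ← (rX.pd2_id hΩ).2, hV, hW, hU', hP, hR]
    have := (hasDerivAt_pd2 (hE.smooth.differentiableAt_of_isOpen hΩ z.2)).neg.exp.deriv
    rw [hE.d_t z z.2] at this
    refine (Eq.trans ?_ this).trans ?_
    · rfl
    · simp only [map_neg, map_mul, map_sub, SmoothFun.eval_mk, ← (rp.pd1_id hΩ).2,
        ← (rr.pd1_id hΩ).2, id]
      simp [div_eq_mul_inv, sq]
      ring
  constructor
  · simp only [haX, ringB, Derivation.leibniz, smul_eq_mul, hX₁, derivation_inv _ hrel.inv_u]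
    linear_combination (-(SmoothFun.d1 hΩ V * U' * U' * X)) * hrel.inv_v
  · simp only [haX, Derivation.leibniz, smul_eq_mul, hX₂, derivation_inv _ hrel.inv_u]
    linear_combination (-(SmoothFun.d2 hΩ V * U' * U' * X)) * hrel.inv_v

theorem isLaxSolution_liouville_iff (hΩ : IsOpen Ω) (h : IsThreeDP Ω u v w p r)
    (hu : ∀ z ∈ Ω, u z ≠ 0) (hv : ∀ z ∈ Ω, v z ≠ 0) (hy : IsReciprocal Ω u p r y)
    {Q₁ Q₂ Q₃ q₁ q₂ : ℝ × ℝ → ℝ} (hQ : IsLiouvilleTransform Ω y u v w p r Q₁ Q₂ Q₃ q₁ q₂)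
    (hE : IsGaugeExponent Ω u v w p r E) {μ : ℂ} (hμ : μ ≠ 0) {φ Φ : ℝ × ℝ → Fin 3 → ℂ}
    (hΦ : ∀ z ∈ Ω, Φ (liouvilleMap y z) = gaugeTransform u v E μ φ z) :
    IsLaxSolution Ω (laxU u v w (μ ^ 2)) (laxV u v w p r (μ ^ 2)) φ ↔
      IsLaxSolution (liouvilleMap y '' Ω) (assocU Q₁ Q₂ Q₃ μ) (assocV Q₂ Q₃ q₁ q₂ μ) Φ := by
  have hrel := threeDPRelations hΩ h hu hv
  obtain ⟨R₁, R₂, R₃, r₁, r₂⟩ := liouvilleTransform_rep hΩ h hu hv hy hQ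
  have r₁' := r₁.pd1_liouville hΩ h.smooth_u hu hy
  have r₂' := r₂.pd1_liouville hΩ h.smooth_u hu hy
  have rp := (Rep.mk_id h.smooth_p).pd1_id hΩ
  have rr := (Rep.mk_id h.smooth_r).pd1_id hΩ
  have hs := contDiffOn_gaugeFactor h hu hE
  have hne : ∀ z ∈ Ω, gaugeFactor u v E z ≠ 0 := fun z hz =>
    gaugeFactor_ne_zero (hu z hz) (hv z hz)
  obtain ⟨ha₁, ha₂⟩ := derivations_gaugeFactor hΩ h hu hv hE rfl rfl rfl rfl rfl rfl rfl rfl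
  have rax := (Rep.mk_id hs).pd1_id hΩ
  generalize hU : SmoothFun.mk u h.smooth_u = U at *
  generalize hU' : SmoothFun.mk (fun z => (u z)⁻¹) (h.smooth_u.inv hu) = U' at *
  generalize hV : SmoothFun.mk v h.smooth_v = V at *
  generalize hV' : SmoothFun.mk (fun z => (v z)⁻¹) (h.smooth_v.inv hv) = V' at *
  generalize hW : SmoothFun.mk w h.smooth_w = W at *
  generalize hP : SmoothFun.mk p h.smooth_p = P at *
  generalize hR : SmoothFun.mk r h.smooth_r = R' at *
  generalize ha : SmoothFun.mk (gaugeFactor u v E) hs = a at *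
  obtain ⟨a', ha'⟩ : ∃ a', SmoothFun.mk (fun z => (gaugeFactor u v E z)⁻¹) (hs.inv hne) = a' :=
    ⟨_, rfl⟩
  have haa : a * a' = 1 := SmoothFun.eq_of_eval fun z => by
    rw [← ha, ← ha']; simp [hne z z.2]
  rw [← isLaxSolution_comp_liouvilleMap hΩ hu hy]
  -- The entries of `M` are read off from `gaugeTransform`. Those of its inverse come from `φ₁ =
  -- aϕ₁`, `φ₂ = a_x ϕ₁ + u a ϕ₁_y` and `φ₃ = μ (u²/v) a (ϕ₂ - μϕ₁)`.
  refine isLaxSolution_gauge hΩ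
    (differentiableOn_gaugeField μ a' (-(U' * (a' * a' * SmoothFun.d1 hΩ a))) (U' * a')
      (V * U' * U' * a'))
    (differentiableOn_gaugeFieldInv μ a (SmoothFun.d1 hΩ a) (U * a) (U * U * V' * a)) ?_ ?_ ?_ ?_
  · intro z hz
    rw [gaugeField_apply _ _ _ _ _ ⟨z, hz⟩, gaugeFieldInv_apply _ _ _ _ _ ⟨z, hz⟩]
    generalize SmoothFun.ceval ⟨z, hz⟩ = e
    have h₁ : e U * e U' = 1 := by rw [← map_mul, hrel.inv_u, map_one]
    have h₂ : e V * e V' = 1 := by rw [← map_mul, hrel.inv_v, map_one]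
    have h₃ : e a * e a' = 1 := by rw [← map_mul, haa, map_one]
    have n₁ := left_ne_zero_of_mul_eq_one h₁
    have n₂ := left_ne_zero_of_mul_eq_one h₂
    have n₃ := left_ne_zero_of_mul_eq_one h₃
    ext i j
    fin_cases i <;> fin_cases j <;>
    simp [gaugeMat, gaugeMatInv, Matrix.mul_apply, Fin.sum_univ_three,
      eq_inv_of_mul_eq_one_right h₁, eq_inv_of_mul_eq_one_right h₂,
      eq_inv_of_mul_eq_one_right h₃] <;>
    field_simp <;> ring
  · intro z hz
    rw [hΦ z hz, gaugeField_apply _ _ _ _ _ ⟨z, hz⟩]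
    have e₁ : SmoothFun.ceval ⟨z, hz⟩ a = (gaugeFactor u v E z : ℂ) := by rw [← ha]; rfl
    have e₂ : SmoothFun.ceval ⟨z, hz⟩ a' = (gaugeFactor u v E z : ℂ)⁻¹ := by
      rw [← ha', ← Complex.ofReal_inv]; rfl
    have e₃ : SmoothFun.ceval ⟨z, hz⟩ U' = (u z : ℂ)⁻¹ := by
      rw [← hU', ← Complex.ofReal_inv]; rfl
    have e₄ : SmoothFun.ceval ⟨z, hz⟩ V = (v z : ℂ) := by rw [← hV]; rfl
    have e₅ : SmoothFun.ceval ⟨z, hz⟩ (SmoothFun.d1 hΩ a) =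
        ((pd1 (gaugeFactor u v E) z : ℝ) : ℂ) :=
      congrArg Complex.ofReal (rax.2 ⟨z, hz⟩).symm
    have n₁ : (u z : ℂ) ≠ 0 := Complex.ofReal_ne_zero.2 (hu z hz)
    have n₂ : (v z : ℂ) ≠ 0 := Complex.ofReal_ne_zero.2 (hv z hz)
    have n₃ : (gaugeFactor u v E z : ℂ) ≠ 0 := Complex.ofReal_ne_zero.2 (hne z hz)
    funext i
    fin_cases i <;>
    simp [gaugeTransform, gaugeMat, Matrix.mulVec, dotProduct, Fin.sum_univ_three, e₁, e₂, e₃, e₄,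
      e₅]
    all_goals field_simp
    ring
  · intro z hz
    rw [pd1_gaugeField hΩ _ _ _ _ _ ⟨z, hz⟩, gaugeField_apply _ _ _ _ _ ⟨z, hz⟩]
    refine Eq.trans ?_ ((gauge_identity₁ hrel haa ha₁ (SmoothFun.ceval ⟨z, hz⟩) hμ).trans ?_)
    · rw [← hU, ← hV, ← hW]; rfl
    · simp only [assocU, R₁.2 ⟨z, hz⟩, R₂.2 ⟨z, hz⟩, R₃.2 ⟨z, hz⟩]
      rw [← hU]; rfl
  · intro z hz
    rw [pd2_gaugeField hΩ _ _ _ _ _ ⟨z, hz⟩, gaugeField_apply _ _ _ _ _ ⟨z, hz⟩]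
    refine Eq.trans ?_ ((gauge_identity₂ hrel haa ha₁ ha₂ (SmoothFun.ceval ⟨z, hz⟩) hμ).trans ?_)
    · have e₁ : ((pd1 p z : ℝ) : ℂ) = SmoothFun.ceval ⟨z, hz⟩ (SmoothFun.d1 hΩ P) :=
        congrArg Complex.ofReal (rp.2 ⟨z, hz⟩)
      have e₂ : ((pd1 r z : ℝ) : ℂ) = SmoothFun.ceval ⟨z, hz⟩ (SmoothFun.d1 hΩ R') :=
        congrArg Complex.ofReal (rr.2 ⟨z, hz⟩)
      simp only [laxV, e₁, e₂]
      rw [← hU, ← hV, ← hW, ← hP, ← hR]; rfl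
    · simp only [assocU, assocV, R₁.2 ⟨z, hz⟩, R₂.2 ⟨z, hz⟩, R₃.2 ⟨z, hz⟩, r₁.2 ⟨z, hz⟩,
        r₂.2 ⟨z, hz⟩, r₁'.2 ⟨z, hz⟩, r₂'.2 ⟨z, hz⟩, Complex.ofReal_mul]
      rw [← hU, ← hP, ← hR]; rfl

end GaugeLax

end ThreeDP

end

open ThreeDP in
theorem mainTheorem6 :
    -- the Liouville transformation carries the 3-DP equation and its Lax pair
    -- to the associated 3-DP equation and its Lax pair
    (∀ (J : Set ℝ) (u v w p r : ℝ × ℝ → ℝ), IsOpen J → J.OrdConnected →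
      IsThreeDP (Set.univ ×ˢ J) u v w p r →
      (∀ z ∈ Set.univ ×ˢ J, u z ≠ 0) → (∀ z ∈ Set.univ ×ˢ J, v z ≠ 0) →
      ((∀ t ∈ J, ∀ x, MeasureTheory.IntegrableOn (fun ξ => u (ξ, t)) (Set.Iic x)) →
        TendstoLocallyUniformlyOn (fun x t => u (x, t) * p (x, t) * r (x, t)) (fun _ => 0)
          Filter.atBot J →
        IsReciprocal (Set.univ ×ˢ J) u p r (fun z => ∫ ξ in Set.Iic z.1, u (ξ, z.2))) ∧
      (∃ y, IsReciprocal (Set.univ ×ˢ J) u p r y) ∧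
      (∃ E, IsGaugeExponent (Set.univ ×ˢ J) u v w p r E) ∧
      ∀ y, IsReciprocal (Set.univ ×ˢ J) u p r y →
        Set.InjOn (liouvilleMap y) (Set.univ ×ˢ J) ∧
        IsOpen (liouvilleMap y '' (Set.univ ×ˢ J)) ∧
        ∀ Q₁ Q₂ Q₃ q₁ q₂ : ℝ × ℝ → ℝ,
          IsLiouvilleTransform (Set.univ ×ˢ J) y u v w p r Q₁ Q₂ Q₃ q₁ q₂ →
          IsAssocThreeDP (liouvilleMap y '' (Set.univ ×ˢ J)) Q₁ Q₂ Q₃ q₁ q₂ ∧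
          ∀ E, IsGaugeExponent (Set.univ ×ˢ J) u v w p r E →
            ∀ (μ : ℂ), μ ≠ 0 → ∀ φ Φ : ℝ × ℝ → Fin 3 → ℂ,
              (∀ z ∈ Set.univ ×ˢ J, Φ (liouvilleMap y z) = gaugeTransform u v E μ φ z) →
              (IsLaxSolution (Set.univ ×ˢ J) (laxU u v w (μ ^ 2)) (laxV u v w p r (μ ^ 2)) φ ↔
                IsLaxSolution (liouvilleMap y '' (Set.univ ×ˢ J))
                  (assocU Q₁ Q₂ Q₃ μ) (assocV Q₂ Q₃ q₁ q₂ μ) Φ)) ∧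
    -- the compatibility condition of the associated Lax pair is the associated 3-DP equation
    (∀ (D : Set (ℝ × ℝ)) (Q₁ Q₂ Q₃ q₁ q₂ : ℝ × ℝ → ℝ), IsOpen D →
      ContDiffOn ℝ ∞ Q₁ D → ContDiffOn ℝ ∞ Q₂ D → ContDiffOn ℝ ∞ Q₃ D →
      ContDiffOn ℝ ∞ q₁ D → ContDiffOn ℝ ∞ q₂ D →
      ((∀ μ : ℂ, μ ≠ 0 → ZeroCurvature D (assocU Q₁ Q₂ Q₃ μ) (assocV Q₂ Q₃ q₁ q₂ μ)) ↔
        IsAssocThreeDP D Q₁ Q₂ Q₃ q₁ q₂)) ∧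
    -- the negative flow of the generalized mKdV hierarchy for the chosen `(A, B, C)`
    (∀ (D : Set (ℝ × ℝ)) (Q₁ Q₂ Q₃ q₁ q₂ σ₁ σ₂ : ℝ × ℝ → ℝ), IsOpen D →
      ContDiffOn ℝ ∞ Q₁ D → ContDiffOn ℝ ∞ Q₂ D → ContDiffOn ℝ ∞ Q₃ D →
      ContDiffOn ℝ ∞ q₁ D → ContDiffOn ℝ ∞ q₂ D →
      ContDiffOn ℝ ∞ σ₁ D → ContDiffOn ℝ ∞ σ₂ D →
      (∀ z ∈ D, pd1 σ₁ z = S₁ pd1 Q₁ Q₂ Q₃ q₁ z) →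
      (∀ z ∈ D, pd1 σ₂ z = S₂ pd1 Q₁ Q₂ Q₃ q₂ z) →
      ∀ z ∈ D, ∀ i,
        miuraDeriv pd1 Q₁ Q₂ Q₃ (assocRHS pd1 Q₁ Q₂ Q₃ q₁ q₂) i z =
          opJ₁ pd1 (miura pd1 Q₁ Q₂ Q₃) (flowABC Q₁ Q₂ Q₃ q₁ σ₁ σ₂) i z ∧
        miuraDeriv pd1 Q₁ Q₂ Q₃ (flowG Q₁ Q₂ Q₃ q₁ q₂ σ₁) i z =
          opK₁ pd1 (miura pd1 Q₁ Q₂ Q₃) (flowABC Q₁ Q₂ Q₃ q₁ σ₁ σ₂) i z) ∧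
    -- the associated 3-DP equation is its reduction `S₁ = S₂ = 0`
    (∀ (D : Set (ℝ × ℝ)) (Q₁ Q₂ Q₃ q₁ q₂ : ℝ × ℝ → ℝ), IsOpen D →
      IsAssocThreeDP D Q₁ Q₂ Q₃ q₁ q₂ →
      (∀ z ∈ D, ∀ i, flowG Q₁ Q₂ Q₃ q₁ q₂ 0 i z = 0) ∧
      IsNegativeFlow D Q₁ Q₂ Q₃ (flowABC Q₁ Q₂ Q₃ q₁ 0 0 0) (flowABC Q₁ Q₂ Q₃ q₁ 0 0 1)
        (flowABC Q₁ Q₂ Q₃ q₁ 0 0 2)) ∧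
    -- the Miura map `F`: factorization of the scalar spectral operator, Fréchet derivative,
    -- and the Hamiltonian pair obtained through it
    (∀ f : DiffPoly,
      let g := DiffPoly.tot (DiffPoly.tot f) - DiffPoly.Q 1 * DiffPoly.tot f - DiffPoly.Q 0 * f
      DiffPoly.tot g - DiffPoly.Q 2 * g =
        DiffPoly.tot (DiffPoly.tot (DiffPoly.tot f) + DiffPoly.miuraField 0 * DiffPoly.tot f
          + DiffPoly.miuraField 1 * f) + DiffPoly.miuraField 2 * f) ∧
    (∀ (h : Fin 3 → DiffPoly) (i : Fin 3),
      DiffPoly.miuraD h i = DiffPoly.evol h (DiffPoly.miuraField i)) ∧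
    DiffPoly.IsHamiltonianPair DiffPoly.opJ₂ DiffPoly.opK₂ := by
  refine ⟨fun J u v w p r hJ hJ' h hu hv => ?_,
    fun D Q₁ Q₂ Q₃ q₁ q₂ hD h₁ h₂ h₃ hq₁ hq₂ => zeroCurvature_iff hD h₁ h₂ h₃ hq₁ hq₂,
    fun D Q₁ Q₂ Q₃ q₁ q₂ σ₁ σ₂ hD h₁ h₂ h₃ hq₁ hq₂ hσ₁ hσ₂ hs₁ hs₂ z hz i =>
      negativeFlow_identities hD h₁ h₂ h₃ hq₁ hq₂ hσ₁ hσ₂ hs₁ hs₂ hz i,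
    fun D Q₁ Q₂ Q₃ q₁ q₂ hD h => ⟨fun z hz i => h.flowG_eq_zero hD hz i, h.isNegativeFlow hD⟩,
    DiffPoly.miura_factorization, DiffPoly.miuraD_eq_evol, DiffPoly.isHamiltonianPair⟩
  have hΩ : IsOpen (Set.univ ×ˢ J : Set (ℝ × ℝ)) := isOpen_univ.prod hJ
  have hc : Convex ℝ (Set.univ ×ˢ J : Set (ℝ × ℝ)) := convex_univ.prod hJ'.convex
  refine ⟨isReciprocal_integral hJ hJ' h, exists_isReciprocal hΩ hc h,
    exists_isGaugeExponent hΩ hc h hu hv, fun y hy => ?_⟩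
  have hu' : ∀ z ∈ Set.univ ×ˢ J, pd1 y z ≠ 0 := fun z hz => by rw [hy.d_x z hz]; exact hu z hz
  exact ⟨injOn_liouvilleMap hJ hy.smooth hu', isOpen_image_liouvilleMap hΩ hy.smooth hu',
    fun Q₁ Q₂ Q₃ q₁ q₂ hQ => ⟨isAssocThreeDP_of_liouville hΩ h hu hv hy hQ,
      fun E hE μ hμ φ Φ hΦ => isLaxSolution_liouville_iff hΩ h hu hv hy hQ hE hμ hΦ⟩⟩
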